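/- **Theorem (Explicit shifted QR).** *Setting.* Let $A\in\mathbb C^{n\times n}$ be Hermitian, let $p,q\in\mathbb C^n$, and suppose that $A+pq^*$ is lower Hessenberg, i.e. $(A+pq^*)_{i,j}=0$ for $j>i+1$. Let $d$ and $\beta$ be the diagonal and superdiagonal of $A$. All computations are in floating point arithmetic with unit roundoff $u>0$: each basic operation $+,-,\times,/$ (real or complex) and each real square root returns the exact result multiplied by $1+\delta$ for some $\delta$ with $|\delta|\le u$; negation and conjugation are exact. A hat or the word "computed" refers to this arithmetic. *One QR iteration* on indices $i,\dots,n$ with data $d,\beta,p,q$. (a) Set $\gamma\leftarrow\overline\beta$, $\tilde q\leftarrow q$. For $k=n,n-1,\dots,i+1$: compute the rotation $Q_k=\begin{pmatrix}c&-s\\ \bar s&\bar c\end{pmatrix}$, $c=x_2/\sqrt{|x_1|^2+|x_2|^2}$, $s=x_1/\sqrt{|x_1|^2+|x_2|^2}$ ($c=1,s=0$ if $x=0$), for $x=(\beta_{k-1}+p_{k-1}\overline{q_k},\,d_k+p_k\overline{q_k})$; if $k\ne i+1$ replace $\gamma_{k-2}$ by the first entry of $Q_k(\gamma_{k-2},-\tilde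 q_k\overline{p_{k-2}})^T$; multiply each of $(d_{k-1},\gamma_{k-1})^T$, $(\beta_{k-1},d_k)^T$, $(p_{k-1},p_k)^T$ by $Q_k$; if now $|p_{k-1}\overline{q_k}|^2+|p_k\overline{q_k}|^2>|\beta_{k-1}|^2+|d_k|^2$, set $p_{k-1}\leftarrow-\beta_{k-1}/\overline{q_k}$; multiply $(\tilde q_{k-1},\tilde q_k)^T$ by $Q_k$. (b) For $k=n,n-1,\dots,i+1$: set $(d_{k-1},\beta_{k-1})^T\leftarrow\overline{Q_k}(d_{k-1},-p_{k-1}\overline{q_k})^T$, replace $d_k$ by the second entry of $\overline{Q_k}(\gamma_{k-1},d_k)^T$, and set $(q_{k-1},q_k)^T\leftarrow Q_k(q_{k-1},q_k)^T$. *Algorithm* (tolerance $\epsilon>0$). For $i=1,\dots,n-1$: set $\mu_{\rm sum}\leftarrow0$; while $|\beta_i+p_i\overline{q_{i+1}}|\ge\epsilon$, compute the eigenvalues $\mu_1,\mu_2$ of $$\begin{pmatrix}d_i+p_i\overline{q_i}&\beta_i+p_i\overline{q_{i+1}}\\ \overline{\beta_i}+p_{i+1}\overline{q_i}&d_{i+1}+p_{i+1}\overline{q_{i+1}}\end{pmatrix}$$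 (by any routine with some finite relative backward error $\eta$; nothing below depends on $\eta$), let $\mu$ be the one closest to $d_i+p_i\overline{q_i}$, set $\mu_{\rm sum}\leftarrow\mu_{\rm sum}+\mu$ and $d_j\leftarrow d_j-\mu$ for $j=i,\dots,n$, and perform one QR iteration on indices $i,\dots,n$; after the while loop, set $d_j\leftarrow d_j+\mu_{\rm sum}$ for $j=i,\dots,n$. Finally output $\lambda_i\leftarrow d_i+p_i\overline{q_i}$ for $i=1,\dots,n$. *Statement.* Let $\|\cdot\|$ be the Euclidean norm of vectors and the Frobenius norm of matrices. For every $\kappa\in\mathbb N$ there is a $C\in\mathbb N$, depending on $\kappa$ only, such that the following holds for all $n$, $A,p,q,u$ as above and all $0<\epsilon\le\kappa(n+1)^\kappa\|A\|u$. Suppose that the algorithm, carried out in floating point arithmetic, terminates with outputs $\hat\lambda_1,\dots,\hat\lambda_n$. For $\ell\in\{1,\dots,n\}$ let $K_\ell$ be the total number of QR iterations performed for $i=1,\dots,\ell$ in the outer loop, and let $|\mu^{(\ell)}|$ be the largest modulus of a computed total shift $\mu_{\rm sum}$ encountered at any point for $i=1,\dots,\ell$ (zero if there is none). Put $c_\ell=C\,(n+K_\ell+1)^C$.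 Then, for each $\ell=1,\dots,n$ with $c_\ell u\le1$, there exist $\delta A\in\mathbb C^{n\times n}$ and $\delta p,\delta q\in\mathbb C^n$ such that $\hat\lambda_1,\dots,\hat\lambda_\ell$ are exact eigenvalues (counted with multiplicity) of $$(A+\delta A)+(p+\delta p)(q+\delta q)^*,$$ and $$\|\delta A\|\le c_\ell\,(\|A\|+|\mu^{(\ell)}|)\,u,\qquad \|\delta p\|\le c_\ell\,\|p\|\,u,\qquad \|\delta q\|\le c_\ell\,\|q\|\,u .$$ -/

import Mathlib

open scoped ComplexConjugate

attribute [local instance] Matrix.frobeniusNormedAddCommGroup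

/-! ## Floating point operations

The standard model: the computed value of `x op y` is `(x op y) * (1 + δ)` with `|δ| ≤ u`. The
rounding errors are otherwise arbitrary, so a floating point computation is a relation between
inputs and possible outputs. The model is used for real and for complex operands. Negation and
conjugation are exact. -/

/-- `y` is a possible result of rounding the exact value `x`, with unit roundoff `u`. -/
def Rounds {𝕜 : Type*} [RCLike 𝕜] (u : ℝ) (x y : 𝕜) : Prop :=
  ∃ δ : 𝕜, ‖δ‖ ≤ u ∧ y = x * (1 + δ)

/-- `r` is a computed value of `|z|^2 = (re z)^2 + (im z)^2`. -/
def FlNormSq (u : ℝ) (z : ℂ) (r : ℝ) : Prop :=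
  ∃ a b : ℝ, Rounds u (z.re * z.re) a ∧ Rounds u (z.im * z.im) b ∧ Rounds u (a + b) r

/-- `r` is a computed value of the modulus `|z|`. -/
def FlAbs (u : ℝ) (z : ℂ) (r : ℝ) : Prop :=
  ∃ a : ℝ, FlNormSq u z a ∧ Rounds u (Real.sqrt a) r

/-- `r` is a computed value of `|x|^2 + |y|^2`. -/
def FlSumSq (u : ℝ) (x y : ℂ) (r : ℝ) : Prop :=
  ∃ a b : ℝ, FlNormSq u x a ∧ FlNormSq u y b ∧ Rounds u (a + b) r

/-- `r` is a computed value of `a + x * conj y`, an entry of `A + p q^*`. -/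
def FlEntry (u : ℝ) (a x y r : ℂ) : Prop :=
  ∃ t : ℂ, Rounds u (x * conj y) t ∧ Rounds u (a + t) r

/-- `y` is a computed value of `(Q x)_1`, where `Q = [[c, -s], [conj s, conj c]]`. -/
def FlRotFst (u : ℝ) (c s x₁ x₂ y : ℂ) : Prop :=
  ∃ a b : ℂ, Rounds u (c * x₁) a ∧ Rounds u (s * x₂) b ∧ Rounds u (a - b) y

/-- `y` is a computed value of `(Q x)_2`, where `Q = [[c, -s], [conj s, conj c]]`. -/
def FlRotSnd (u : ℝ) (c s x₁ x₂ y : ℂ) : Prop :=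
  ∃ a b : ℂ, Rounds u (conj s * x₁) a ∧ Rounds u (conj c * x₂) b ∧ Rounds u (a + b) y

/-- `c` and `s` are computed values of the parameters of the plane rotation
`Q = [[c, -s], [conj s, conj c]]` in `SU(2)` with `(Q x)_1 = 0`, that is, of
`c = x₂ / sqrt (|x₁|^2 + |x₂|^2)` and `s = x₁ / sqrt (|x₁|^2 + |x₂|^2)`; by convention `c = 1`
and `s = 0` when `x = 0`. -/
def FlRotation (u : ℝ) (x₁ x₂ c s : ℂ) : Prop :=
  (x₁ = 0 ∧ x₂ = 0 ∧ c = 1 ∧ s = 0) ∨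
  (¬ (x₁ = 0 ∧ x₂ = 0) ∧ ∃ r ρ : ℝ, FlSumSq u x₁ x₂ r ∧ Rounds u (Real.sqrt r) ρ ∧
    Rounds u (x₂ / (ρ : ℂ)) c ∧ Rounds u (x₁ / (ρ : ℂ)) s)

/-! ## One sweep of explicit QR on the generators

Vectors are stored as functions on `ℕ`; the entries used are those with index `0, …, n - 1`
(`0, …, n - 2` for the off-diagonals). All indices start at zero. The sweep acts on the trailing
submatrix with rows and columns `i, …, n - 1`. Rotation number `m` acts on the plane `(m, m+1)`. -/

/-- The generators of a matrix `A + p q^*`: diagonal and superdiagonal of `A`, and `p`, `q`. -/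
structure Generators where
  d : ℕ → ℂ
  β : ℕ → ℂ
  p : ℕ → ℂ
  q : ℕ → ℂ

/-- The variables of the elimination of the superdiagonal: diagonal, superdiagonal, subdiagonal,
`p`, and the rotated copy `qt` of `q`. -/
structure ElimState where
  d : ℕ → ℂ
  β : ℕ → ℂ
  γ : ℕ → ℂ
  p : ℕ → ℂ
  qt : ℕ → ℂ

/-- Elimination of the superdiagonal entry `(m, m+1)` in floating point arithmetic, turning the
variables `E` into `E'`; `i` is the first index of the submatrix and `q` the unrotated vector.
The computed rotation has parameters `c` and `s`. -/
structure ElimStep (u : ℝ) (i : ℕ) (q : ℕ → ℂ) (m : ℕ) (E E' : ElimState) (c s : ℂ) : Prop where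
  /-- Construct the rotation eliminating the first entry of
  `(β_m + p_m conj q_{m+1}, d_{m+1} + p_{m+1} conj q_{m+1})`. -/
  rotation : ∃ x₁ x₂ : ℂ, FlEntry u (E.β m) (E.p m) (q (m + 1)) x₁ ∧
    FlEntry u (E.d (m + 1)) (E.p (m + 1)) (q (m + 1)) x₂ ∧ FlRotation u x₁ x₂ c s
  /-- Rotate the subdiagonal and the sub-subdiagonal (unless this is the last rotation), and the
  diagonal and the subdiagonal. -/
  sub : ∃ g : ℂ, FlRotSnd u c s (E.d m) (E.γ m) g ∧
    ((m = i ∧ E'.γ = Function.update E.γ m g) ∨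
      (m ≠ i ∧ ∃ w g' : ℂ, Rounds u (E.qt (m + 1) * conj (E.p (m - 1))) w ∧
        FlRotFst u c s (E.γ (m - 1)) (-w) g' ∧
        E'.γ = Function.update (Function.update E.γ (m - 1) g') m g))
  /-- The diagonal (rotated with the subdiagonal in row `m`, with the superdiagonal in
  row `m+1`). -/
  diag : ∃ x y : ℂ, FlRotFst u c s (E.d m) (E.γ m) x ∧ FlRotSnd u c s (E.β m) (E.d (m + 1)) y ∧
    E'.d = Function.update (Function.update E.d m x) (m + 1) y
  /-- The superdiagonal. -/
  super : ∃ b : ℂ, FlRotFst u c s (E.β m) (E.d (m + 1)) b ∧ E'.β = Function.update E.β m b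
  /-- Rotate `p`, and then correct `p_m` to `- β_m / conj q_{m+1}` if
  `|p_m conj q_{m+1}|^2 + |p_{m+1} conj q_{m+1}|^2 > |β_m|^2 + |d_{m+1}|^2`
  for the computed quantities. -/
  rank_one : ∃ (x y v w : ℂ) (r r' : ℝ), FlRotFst u c s (E.p m) (E.p (m + 1)) x ∧
    FlRotSnd u c s (E.p m) (E.p (m + 1)) y ∧
    Rounds u (x * conj (q (m + 1))) v ∧ Rounds u (y * conj (q (m + 1))) w ∧
    FlSumSq u v w r ∧ FlSumSq u (E'.β m) (E'.d (m + 1)) r' ∧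
    ((r > r' ∧ ∃ z : ℂ, Rounds u (E'.β m / conj (q (m + 1))) z ∧
        E'.p = Function.update (Function.update E.p m (-z)) (m + 1) y) ∨
      (¬ r > r' ∧ E'.p = Function.update (Function.update E.p m x) (m + 1) y))
  /-- Rotate the copy of `q`. -/
  copy : ∃ x y : ℂ, FlRotFst u c s (E.qt m) (E.qt (m + 1)) x ∧
    FlRotSnd u c s (E.qt m) (E.qt (m + 1)) y ∧
    E'.qt = Function.update (Function.update E.qt m x) (m + 1) y

/-- The variables of the rotation back to Hessenberg form. -/
structure BackState where
  d : ℕ → ℂ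
  β : ℕ → ℂ
  q : ℕ → ℂ

/-- Application of rotation number `m` on the right, in floating point arithmetic: the entries of
rows `m` and `m+1` in columns `m, m+1` are multiplied by `conj Q`, and `q` by `Q`. -/
structure BackStep (u : ℝ) (γ p : ℕ → ℂ) (c s : ℂ) (m : ℕ) (R R' : BackState) : Prop where
  diag_super : ∃ w x y b : ℂ, Rounds u (p m * conj (R.q (m + 1))) w ∧
    FlRotFst u (conj c) (conj s) (R.d m) (-w) x ∧
    FlRotSnd u (conj c) (conj s) (R.d m) (-w) b ∧
    FlRotSnd u (conj c) (conj s) (γ m) (R.d (m + 1)) y ∧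
    R'.d = Function.update (Function.update R.d m x) (m + 1) y ∧
    R'.β = Function.update R.β m b
  rotate_q : ∃ x y : ℂ, FlRotFst u c s (R.q m) (R.q (m + 1)) x ∧
    FlRotSnd u c s (R.q m) (R.q (m + 1)) y ∧
    R'.q = Function.update (Function.update R.q m x) (m + 1) y

/-- `S'` is a possible result of one floating point iteration of explicit QR (elimination of the
superdiagonal, then rotation back to Hessenberg form; both for `m = n-2, n-3, …, i`) applied to
the submatrix with rows and columns `i, …, n-1` of the matrix with generators `S`. Here `E m` and
`R m` are the variables after rotation number `m`, and `E (n-1)`, `R (n-1)` the initial ones. -/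
def FlSweep (u : ℝ) (n i : ℕ) (S S' : Generators) : Prop :=
  ∃ (E : ℕ → ElimState) (R : ℕ → BackState) (c s : ℕ → ℂ),
    E (n - 1) = ⟨S.d, S.β, fun j => conj (S.β j), S.p, S.q⟩ ∧
    (∀ m, i ≤ m → m + 1 < n → ElimStep u i S.q m (E (m + 1)) (E m) (c m) (s m)) ∧
    R (n - 1) = ⟨(E i).d, S.β, S.q⟩ ∧
    (∀ m, i ≤ m → m + 1 < n →
      BackStep u (E i).γ (E i).p (c m) (s m) m (R (m + 1)) (R m)) ∧
    S' = ⟨(R i).d, (R i).β, (E i).p, (R i).q⟩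

/-! ## Explicit QR with Wilkinson shifts -/

/-- `μ` is a computed Wilkinson shift: the `2 × 2` block of `A + p q^*` in rows and columns
`i, i+1` is formed in floating point arithmetic, its eigenvalues `μ₁`, `μ₂` are computed by a
routine whose backward error (relative to the norm of the block) is at most `η`, and `μ` is the
one that is found to be closest to the `(i, i)` entry. -/
def FlWilkinsonShift (u η : ℝ) (i : ℕ) (S : Generators) (μ : ℂ) : Prop :=
  ∃ (M F : Matrix (Fin 2) (Fin 2) ℂ) (μ₁ μ₂ w₁ w₂ : ℂ) (r₁ r₂ : ℝ),
    FlEntry u (S.d i) (S.p i) (S.q i) (M 0 0) ∧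
    FlEntry u (S.β i) (S.p i) (S.q (i + 1)) (M 0 1) ∧
    FlEntry u (conj (S.β i)) (S.p (i + 1)) (S.q i) (M 1 0) ∧
    FlEntry u (S.d (i + 1)) (S.p (i + 1)) (S.q (i + 1)) (M 1 1) ∧
    ‖F‖ ≤ η * ‖M‖ ∧ (M + F).charpoly.roots = {μ₁, μ₂} ∧
    Rounds u (μ₁ - M 0 0) w₁ ∧ FlAbs u w₁ r₁ ∧ Rounds u (μ₂ - M 0 0) w₂ ∧ FlAbs u w₂ r₂ ∧
    μ = if r₁ ≤ r₂ then μ₁ else μ₂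

/-- `d'` is a computed value of the vector `d` with `μ` added to the entries `i, …, n-1`. -/
def FlAddDiag (u : ℝ) (n i : ℕ) (d : ℕ → ℂ) (μ : ℂ) (d' : ℕ → ℂ) : Prop :=
  ∀ j, if i ≤ j ∧ j < n then Rounds u (d j + μ) (d' j) else d' j = d j

/-- `r` is a computed value of `|(A + p q^*)_{i,i+1}|`, the quantity in the stopping test. -/
def FlSuperAbs (u : ℝ) (i : ℕ) (S : Generators) (r : ℝ) : Prop :=
  ∃ z : ℂ, FlEntry u (S.β i) (S.p i) (S.q (i + 1)) z ∧ FlAbs u z r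

/-- `FlInnerLoop u ε η n i S σ S' σ' L`: the `while` loop for the index `i`, started with
generators `S` and accumulated shift `σ`, may terminate with generators `S'` and accumulated
shift `σ'`; `L` lists the accumulated (total) shifts after each update, one for each QR
iteration that is performed. -/
inductive FlInnerLoop (u ε η : ℝ) (n i : ℕ) :
    Generators → ℂ → Generators → ℂ → List ℂ → Prop
  | stop_test {S : Generators} {σ : ℂ} {r : ℝ} (hr : FlSuperAbs u i S r) (hlt : r < ε) :
      FlInnerLoop u ε η n i S σ S σ []
  | iterate {S S₁ S' : Generators} {σ σ₁ σ' μ : ℂ} {r : ℝ} {d₁ : ℕ → ℂ} {L : List ℂ}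
      (hr : FlSuperAbs u i S r) (hge : ε ≤ r)
      (hμ : FlWilkinsonShift u η i S μ)
      (hσ : Rounds u (σ + μ) σ₁)
      (hd : FlAddDiag u n i S.d (-μ) d₁)
      (hsweep : FlSweep u n i ⟨d₁, S.β, S.p, S.q⟩ S₁)
      (hrest : FlInnerLoop u ε η n i S₁ σ₁ S' σ' L) :
      FlInnerLoop u ε η n i S σ S' σ' (σ₁ :: L)

/-- One pass of the outer loop: set the accumulated shift to zero, run the inner loop, and add
the accumulated shift back to the diagonal. -/
def FlOuterStep (u ε η : ℝ) (n i : ℕ) (S S' : Generators) (L : List ℂ) : Prop :=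
  ∃ (T : Generators) (σ : ℂ) (d' : ℕ → ℂ), FlInnerLoop u ε η n i S 0 T σ L ∧
    FlAddDiag u n i T.d σ d' ∧ S' = ⟨d', T.β, T.p, T.q⟩

/-- The generators of `A + p q^*`, padded with zeros. -/
def initialGenerators {n : ℕ} (A : Matrix (Fin n) (Fin n) ℂ) (p q : Fin n → ℂ) : Generators where
  d := fun j => if h : j < n then A ⟨j, h⟩ ⟨j, h⟩ else 0
  β := fun j => if h : j + 1 < n then A ⟨j, by omega⟩ ⟨j + 1, h⟩ else 0
  p := fun j => if h : j < n then p ⟨j, h⟩ else 0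
  q := fun j => if h : j < n then q ⟨j, h⟩ else 0

/-- `FlShiftedQR u ε η A p q lam L`: the explicit QR algorithm with Wilkinson shifts and tolerance
`ε`, applied to the generators of `A + p q^*` and carried out in floating point arithmetic with
unit roundoff `u`, may terminate with the outputs `lam`, where `L i` is the list of total
shifts encountered during the pass `i` of the outer loop (`i = 0, …, n-2`). -/
def FlShiftedQR (u ε η : ℝ) {n : ℕ} (A : Matrix (Fin n) (Fin n) ℂ) (p q : Fin n → ℂ)
    (lam : Fin n → ℂ) (L : ℕ → List ℂ) : Prop :=
  ∃ S : ℕ → Generators, S 0 = initialGenerators A p q ∧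
    (∀ i, i + 1 < n → FlOuterStep u ε η n i (S i) (S (i + 1)) (L i)) ∧
    (∀ i, n ≤ i + 1 → L i = []) ∧
    ∀ j : Fin n, FlEntry u ((S (n - 1)).d j) ((S (n - 1)).p j) ((S (n - 1)).q j) (lam j)

/-- The largest modulus of a total shift encountered in the first `ℓ` passes of the outer loop
(zero if there is none). -/
noncomputable def maxShift (L : ℕ → List ℂ) (ℓ : ℕ) : ℝ :=
  (((List.range ℓ).flatMap L).map fun z => ‖z‖).foldr max 0

/-- The number of QR iterations performed in the first `ℓ` passes of the outer loop. -/
def sweepCount (L : ℕ → List ℂ) (ℓ : ℕ) : ℕ :=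
  ((List.range ℓ).flatMap L).length

/-- All entries above the first superdiagonal vanish. -/
def IsLowerHessenberg {n : ℕ} (M : Matrix (Fin n) (Fin n) ℂ) : Prop :=
  ∀ i j : Fin n, (i : ℕ) + 1 < j → M i j = 0

/-! ## Elementary rounding error bounds -/

/-! Since $A+pq^*$ is lower Hessenberg, the entries of $A$ above the superdiagonal are
$-p_l\overline{q_j}$. So $d,\beta,p,q$ determine $A$ on and above the diagonal, and symmetry gives
the rest (`genMatrix`). The proof follows this represented matrix together with $p$ and $q$, and
shows that each QR iteration applies one common exact unitary to all three. The errors are of order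
$u(\|A\|+|\mu|)$ in the matrix and $u\|p\|$, $u\|q\|$ in the vectors, up to polynomial factors.

The danger is that $\|p\|\|q\|$ may be much larger than $\|A\|$. An entry already stored as
$-p_l\overline{q_j}$ causes no trouble: it is an entry of a matrix of controlled norm, and a
rotation of $p$ or $q$ perturbs it relative to entries of that matrix. The critical position is
$(m,m+1)$, which changes from storage in $\beta$ to the product form during the elimination. There
the correction of $p_m$ is essential (`norm_sub_le_of_rank_one`). If the product terms are not
dominant, the rotated $p_m$ is good enough for the product. If they dominate,
$-\beta_m/\overline{q_{m+1}}$ makes the product right, and the change in $p_m$ is still small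
relative to $p$.

Exact rotations preserve Frobenius and Euclidean norms, so the local errors of a sweep simply add
(`elim_phase`, `back_phase`, `FlSweep.exists_unitary`). The sweep controls the result only on and
above the diagonal. Below it the represented matrix is a reflection, whereas the exact similarity is
Hermitian only up to a skew part, because computed diagonals need not be real.
`norm_sub_unitary_conj_le` bounds this discrepancy and shows that the skew part grows only
additively from step to step.

Accumulated shifts multiply the projection onto the active coordinates, which commutes with the
sweep's unitary. Deflation replaces $\beta_i$ by $-p_i\overline{q_{i+1}}$, which costs about
$\epsilon$. `NearSimilar` records the accumulated errors. In the end the finished rows of the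
represented matrix plus $pq^*$ vanish right of the diagonal, so their diagonal entries are
eigenvalues. The rounding of the outputs is absorbed into the diagonal and into $p$, and undoing the
unitary gives the perturbations of the original data. -/

theorem Rounds.norm_sub_le {𝕜 : Type*} [RCLike 𝕜] {u : ℝ} {x y : 𝕜} (h : Rounds u x y) :
    ‖y - x‖ ≤ u * ‖x‖ := by
  obtain ⟨δ, hδ, rfl⟩ := h
  have : x * (1 + δ) - x = δ * x := by ring
  rw [this, norm_mul]
  gcongr

theorem Rounds.norm_le {𝕜 : Type*} [RCLike 𝕜] {u : ℝ} {x y : 𝕜} (h : Rounds u x y) :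
    ‖y‖ ≤ (1 + u) * ‖x‖ := by
  have h1 := h.norm_sub_le
  have h2 := norm_le_norm_add_norm_sub' y x
  linarith

theorem Rounds.le_norm {𝕜 : Type*} [RCLike 𝕜] {u : ℝ} {x y : 𝕜} (h : Rounds u x y) :
    (1 - u) * ‖x‖ ≤ ‖y‖ := by
  have h1 := h.norm_sub_le
  have h2 := norm_le_norm_add_norm_sub y x
  linarith

/-- A rounded nonnegative number lies between `1 - u` and `1 + u` times the exact one. -/
theorem Rounds.real_bounds {u x y : ℝ} (h : Rounds u x y) (hx : 0 ≤ x) :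
    (1 - u) * x ≤ y ∧ y ≤ (1 + u) * x := by
  have h1 := h.norm_sub_le
  rw [Real.norm_eq_abs, Real.norm_eq_abs, abs_of_nonneg hx, abs_le] at h1
  constructor <;> linarith [h1.1, h1.2]

theorem FlNormSq.bounds {u : ℝ} {z : ℂ} {r : ℝ} (h : FlNormSq u z r) (hu : 0 ≤ u) (hu1 : u ≤ 1) :
    (1 - u) ^ 2 * ‖z‖ ^ 2 ≤ r ∧ r ≤ (1 + u) ^ 2 * ‖z‖ ^ 2 := by
  obtain ⟨a, b, ha, hb, hr⟩ := h
  have ha := ha.real_bounds (mul_self_nonneg _)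
  have hb := hb.real_bounds (mul_self_nonneg _)
  have h1 : 0 ≤ 1 - u := by linarith
  have hs : ‖z‖ ^ 2 = z.re * z.re + z.im * z.im := by
    rw [← Complex.normSq_eq_norm_sq, Complex.normSq_apply]
  have ha0 := mul_nonneg h1 (mul_self_nonneg z.re)
  have hb0 := mul_nonneg h1 (mul_self_nonneg z.im)
  have hr := hr.real_bounds (by linarith : 0 ≤ a + b)
  rw [hs]
  constructor
  · nlinarith [mul_le_mul_of_nonneg_left (add_le_add ha.1 hb.1) h1]
  · nlinarith [mul_le_mul_of_nonneg_left (add_le_add ha.2 hb.2) (by linarith : 0 ≤ 1 + u)]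

theorem FlSumSq.bounds {u : ℝ} {x y : ℂ} {r : ℝ} (h : FlSumSq u x y r) (hu : 0 ≤ u)
    (hu1 : u ≤ 1) :
    (1 - u) ^ 3 * (‖x‖ ^ 2 + ‖y‖ ^ 2) ≤ r ∧ r ≤ (1 + u) ^ 3 * (‖x‖ ^ 2 + ‖y‖ ^ 2) := by
  obtain ⟨a, b, ha, hb, hr⟩ := h
  have ha := ha.bounds hu hu1
  have hb := hb.bounds hu hu1
  have h1 : 0 ≤ 1 - u := by linarith
  have ha0 : 0 ≤ (1 - u) ^ 2 * ‖x‖ ^ 2 := by positivity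
  have hb0 : 0 ≤ (1 - u) ^ 2 * ‖y‖ ^ 2 := by positivity
  have hr := hr.real_bounds (by linarith : 0 ≤ a + b)
  constructor
  · nlinarith [mul_le_mul_of_nonneg_left (add_le_add ha.1 hb.1) h1]
  · nlinarith [mul_le_mul_of_nonneg_left (add_le_add ha.2 hb.2) (by linarith : 0 ≤ 1 + u)]

theorem FlAbs.le {u : ℝ} {z : ℂ} {r : ℝ} (h : FlAbs u z r) (hu : 0 ≤ u) (hu1 : u ≤ 1) :
    (1 - u) ^ 2 * ‖z‖ ≤ r := by
  obtain ⟨a, ha, hr⟩ := h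
  have ha := (ha.bounds hu hu1).1
  have h1 : 0 ≤ 1 - u := by linarith
  have h2 : (1 - u) * ‖z‖ ≤ Real.sqrt a := by
    apply Real.le_sqrt_of_sq_le
    calc _ = (1 - u) ^ 2 * ‖z‖ ^ 2 := by ring
      _ ≤ a := ha
  have := (hr.real_bounds (Real.sqrt_nonneg a)).1
  nlinarith [mul_le_mul_of_nonneg_left h2 h1]

theorem FlEntry.norm_sub_le {u : ℝ} {a x y r : ℂ} (h : FlEntry u a x y r) (hu : 0 ≤ u)
    (hu1 : u ≤ 1) : ‖r - (a + x * conj y)‖ ≤ 3 * u * (‖a‖ + ‖x‖ * ‖y‖) := by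
  obtain ⟨t, ht, hr⟩ := h
  have h1 := ht.norm_sub_le
  have h2 := hr.norm_sub_le
  have h3 := ht.norm_le
  rw [norm_mul, RCLike.norm_conj] at h1 h3
  have h4 : ‖r - (a + x * conj y)‖ ≤ ‖r - (a + t)‖ + ‖t - x * conj y‖ := by
    rw [← add_sub_add_left_eq_sub t (x * conj y) a]
    exact norm_sub_le_norm_sub_add_norm_sub _ _ _
  have h5 := norm_add_le a t
  have h6 : 0 ≤ ‖x‖ * ‖y‖ := by positivity
  have h7 : u * ‖a + t‖ ≤ u * (‖a‖ + 2 * (‖x‖ * ‖y‖)) := by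
    gcongr; nlinarith
  nlinarith [mul_nonneg hu (norm_nonneg a)]

/-! ## Computed plane rotations -/

/-- The exact plane rotation with parameters `c₀`, `s₀` is close to the computed one. -/
structure RotationApprox (u : ℝ) (c s c₀ s₀ : ℂ) : Prop where
  unit : ‖c₀‖ ^ 2 + ‖s₀‖ ^ 2 = 1
  cos : ‖c - c₀‖ ≤ 8 * u
  sin : ‖s - s₀‖ ≤ 8 * u

theorem RotationApprox.norm_cos_le {u : ℝ} {c s c₀ s₀ : ℂ} (h : RotationApprox u c s c₀ s₀) :
    ‖c₀‖ ≤ 1 := by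
  nlinarith [h.unit, norm_nonneg c₀, sq_nonneg ‖s₀‖]

theorem RotationApprox.norm_sin_le {u : ℝ} {c s c₀ s₀ : ℂ} (h : RotationApprox u c s c₀ s₀) :
    ‖s₀‖ ≤ 1 := by
  nlinarith [h.unit, norm_nonneg s₀, sq_nonneg ‖c₀‖]

theorem RotationApprox.star {u : ℝ} {c s c₀ s₀ : ℂ} (h : RotationApprox u c s c₀ s₀) :
    RotationApprox u (conj c) (conj s) (conj c₀) (conj s₀) := by
  refine ⟨by simpa only [RCLike.norm_conj] using h.unit, ?_, ?_⟩
  · rw [← map_sub, RCLike.norm_conj]; exact h.cos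
  · rw [← map_sub, RCLike.norm_conj]; exact h.sin

/-- The computed hypotenuse `ρ` has relative error below `4 * u`, which perturbs the quotient by at
most `5 * u`. The rounding of the division adds little more than `u`, so `8 * u` leaves some slack.
-/
theorem norm_div_sub_div_le {u h ρ : ℝ} {x c : ℂ} (hu : 0 ≤ u) (hu1 : u ≤ 1 / 1000) (hh : 0 < h)
    (hρ : (1 - u) ^ 3 * h ≤ ρ ∧ ρ ≤ (1 + u) ^ 3 * h) (hx : ‖x‖ ≤ h)
    (hc : Rounds u (x / (ρ : ℂ)) c) : ‖c - x / (h : ℂ)‖ ≤ 8 * u := by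
  have h3 : 1 - 3 * u ≤ (1 - u) ^ 3 := by nlinarith [sq_nonneg u, mul_nonneg hu (sq_nonneg u)]
  have h4 : (1 + u) ^ 3 ≤ 1 + 4 * u := by nlinarith [sq_nonneg u, mul_nonneg hu (sq_nonneg u)]
  have hρ0 : (1 - 3 * u) * h ≤ ρ := (mul_le_mul_of_nonneg_right h3 hh.le).trans hρ.1
  have hρ1 : ρ ≤ (1 + 4 * u) * h := hρ.2.trans (mul_le_mul_of_nonneg_right h4 hh.le)
  have hρpos : 0 < ρ := by nlinarith
  have h5 : ‖x / (ρ : ℂ)‖ ≤ 101 / 100 := by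
    rw [norm_div, Complex.norm_real, Real.norm_of_nonneg hρpos.le, div_le_iff₀ hρpos]
    nlinarith
  have h6 : ‖x / (ρ : ℂ) - x / (h : ℂ)‖ ≤ 5 * u := by
    have e : x / (ρ : ℂ) - x / (h : ℂ) = (x / (ρ : ℂ)) * (((h - ρ : ℝ) : ℂ) / h) := by
      have : (ρ : ℂ) ≠ 0 := by exact_mod_cast hρpos.ne'
      have : (h : ℂ) ≠ 0 := by exact_mod_cast hh.ne'
      push_cast; field_simp
    rw [e, norm_mul]
    have : ‖((h - ρ : ℝ) : ℂ) / h‖ ≤ 4 * u := by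
      rw [norm_div, Complex.norm_real, Complex.norm_real, Real.norm_of_nonneg hh.le,
        div_le_iff₀ hh, Real.norm_eq_abs, abs_le]
      constructor <;> nlinarith
    nlinarith [norm_nonneg (x / (ρ : ℂ)), norm_nonneg (((h - ρ : ℝ) : ℂ) / h)]
  have h7 := hc.norm_sub_le
  have h8 : ‖c - x / (h : ℂ)‖ ≤ ‖c - x / (ρ : ℂ)‖ + ‖x / (ρ : ℂ) - x / (h : ℂ)‖ :=
    norm_sub_le_norm_sub_add_norm_sub _ _ _
  nlinarith

/-- The approximating rotation is the exact one for the computed operands `x₁`, `x₂`. It therefore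
annihilates them exactly, and the rounding in forming the operands can be treated separately. -/
theorem FlRotation.exists_approx {u : ℝ} {x₁ x₂ c s : ℂ} (h : FlRotation u x₁ x₂ c s)
    (hu : 0 ≤ u) (hu1 : u ≤ 1 / 1000) :
    ∃ c₀ s₀ : ℂ, RotationApprox u c s c₀ s₀ ∧ c₀ * x₁ - s₀ * x₂ = 0 := by
  rcases h with ⟨rfl, rfl, rfl, rfl⟩ | ⟨hx, r, ρ, hr, hρ, hc, hs⟩
  · exact ⟨1, 0, ⟨by simp, by simpa using hu, by simpa using hu⟩, by simp⟩
  have hr := hr.bounds hu (by linarith)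
  have hpos : 0 < ‖x₁‖ ^ 2 + ‖x₂‖ ^ 2 := by
    by_contra hneg
    apply hx
    have h1 : ‖x₁‖ = 0 := by nlinarith [sq_nonneg ‖x₁‖, sq_nonneg ‖x₂‖]
    have h2 : ‖x₂‖ = 0 := by nlinarith [sq_nonneg ‖x₁‖, sq_nonneg ‖x₂‖]
    exact ⟨norm_eq_zero.1 h1, norm_eq_zero.1 h2⟩
  set h := Real.sqrt (‖x₁‖ ^ 2 + ‖x₂‖ ^ 2) with hh
  have hh0 : 0 < h := Real.sqrt_pos.2 hpos
  have hsq : h ^ 2 = ‖x₁‖ ^ 2 + ‖x₂‖ ^ 2 := Real.sq_sqrt hpos.le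
  have hu2 : 0 ≤ 1 - u := by linarith
  have h1 : (1 - u) ^ 2 * h ≤ Real.sqrt r := by
    apply Real.le_sqrt_of_sq_le
    refine le_trans ?_ hr.1
    rw [← hsq, mul_pow]
    apply mul_le_mul_of_nonneg_right _ (sq_nonneg h)
    nlinarith [pow_nonneg hu2 3]
  have h2 : Real.sqrt r ≤ (1 + u) ^ 2 * h := by
    apply Real.sqrt_le_iff.2 ⟨by positivity, ?_⟩
    refine hr.2.trans ?_
    rw [← hsq, mul_pow]
    apply mul_le_mul_of_nonneg_right _ (sq_nonneg h)
    nlinarith [pow_nonneg (by linarith : 0 ≤ 1 + u) 3]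
  have h3 := hρ.real_bounds (Real.sqrt_nonneg r)
  have h4 : (1 - u) ^ 3 * h ≤ ρ ∧ ρ ≤ (1 + u) ^ 3 * h := by
    constructor
    · nlinarith
    · nlinarith
  have hx1 : ‖x₁‖ ≤ h := Real.le_sqrt_of_sq_le (by nlinarith [sq_nonneg ‖x₂‖])
  have hx2 : ‖x₂‖ ≤ h := Real.le_sqrt_of_sq_le (by nlinarith [sq_nonneg ‖x₁‖])
  refine ⟨x₂ / h, x₁ / h, ⟨?_, norm_div_sub_div_le hu hu1 hh0 h4 hx2 hc,
    norm_div_sub_div_le hu hu1 hh0 h4 hx1 hs⟩, by ring⟩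
  rw [norm_div, norm_div, Complex.norm_real, Real.norm_of_nonneg hh0.le, div_pow, div_pow,
    ← add_div, add_comm, ← hsq, div_self (by positivity)]

theorem norm_mul_sub_mul_le {u : ℝ} {c c₀ x a : ℂ} (hu : 0 ≤ u) (hu1 : u ≤ 1 / 1000)
    (hc : ‖c - c₀‖ ≤ 8 * u) (hc₀ : ‖c₀‖ ≤ 1) (ha : Rounds u (c * x) a) :
    ‖a - c₀ * x‖ ≤ 10 * u * ‖x‖ := by
  have h1 := ha.norm_sub_le
  have h2 : ‖c * x - c₀ * x‖ ≤ 8 * u * ‖x‖ := by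
    rw [← sub_mul, norm_mul]; gcongr
  have h3 : ‖c * x‖ ≤ (1 + 8 * u) * ‖x‖ := by
    rw [norm_mul]
    have : ‖c‖ ≤ ‖c₀‖ + ‖c - c₀‖ := norm_le_norm_add_norm_sub' _ _
    gcongr; linarith
  have h4 : ‖a - c₀ * x‖ ≤ ‖a - c * x‖ + ‖c * x - c₀ * x‖ :=
    norm_sub_le_norm_sub_add_norm_sub _ _ _
  have h5 := mul_le_mul_of_nonneg_left h3 hu
  nlinarith [mul_nonneg hu (norm_nonneg x)]

theorem norm_rounds_add_sub_le {u : ℝ} {a b a₀ b₀ y : ℂ} {α β : ℝ} (hu : 0 ≤ u)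
    (hu1 : u ≤ 1 / 1000) (ha : ‖a - a₀‖ ≤ 10 * u * α) (hb : ‖b - b₀‖ ≤ 10 * u * β)
    (ha₀ : ‖a₀‖ ≤ α) (hb₀ : ‖b₀‖ ≤ β) (hy : Rounds u (a + b) y) :
    ‖y - (a₀ + b₀)‖ ≤ 16 * u * (α + β) := by
  have h1 := hy.norm_sub_le
  have h2 : ‖(a + b) - (a₀ + b₀)‖ ≤ 10 * u * α + 10 * u * β := by
    rw [add_sub_add_comm]
    exact (norm_add_le _ _).trans (add_le_add ha hb)
  have h3 : ‖a + b‖ ≤ ‖a₀ + b₀‖ + ‖(a + b) - (a₀ + b₀)‖ := norm_le_norm_add_norm_sub' _ _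
  have h4 := norm_add_le a₀ b₀
  have h5 : ‖y - (a₀ + b₀)‖ ≤ ‖y - (a + b)‖ + ‖(a + b) - (a₀ + b₀)‖ :=
    norm_sub_le_norm_sub_add_norm_sub _ _ _
  have hα : 0 ≤ α := (norm_nonneg _).trans ha₀
  have hβ : 0 ≤ β := (norm_nonneg _).trans hb₀
  have h6 : ‖a + b‖ ≤ 2 * (α + β) := by nlinarith
  nlinarith [mul_le_mul_of_nonneg_left h6 hu, mul_nonneg hu hα, mul_nonneg hu hβ]

theorem FlRotFst.norm_sub_le {u : ℝ} {c s c₀ s₀ x₁ x₂ y : ℂ} (h : FlRotFst u c s x₁ x₂ y)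
    (hr : RotationApprox u c s c₀ s₀) (hu : 0 ≤ u) (hu1 : u ≤ 1 / 1000) :
    ‖y - (c₀ * x₁ - s₀ * x₂)‖ ≤ 16 * u * (‖x₁‖ + ‖x₂‖) := by
  obtain ⟨a, b, ha, hb, hy⟩ := h
  rw [sub_eq_add_neg] at hy ⊢
  rw [sub_eq_add_neg]
  refine norm_rounds_add_sub_le hu hu1 (norm_mul_sub_mul_le hu hu1 hr.cos hr.norm_cos_le ha) ?_
    ?_ ?_ hy
  · rw [neg_sub_neg, norm_sub_rev]
    exact norm_mul_sub_mul_le hu hu1 hr.sin hr.norm_sin_le hb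
  · rw [norm_mul]; exact mul_le_of_le_one_left (norm_nonneg _) hr.norm_cos_le
  · rw [norm_neg, norm_mul]; exact mul_le_of_le_one_left (norm_nonneg _) hr.norm_sin_le

theorem FlRotSnd.norm_sub_le {u : ℝ} {c s c₀ s₀ x₁ x₂ y : ℂ} (h : FlRotSnd u c s x₁ x₂ y)
    (hr : RotationApprox u c s c₀ s₀) (hu : 0 ≤ u) (hu1 : u ≤ 1 / 1000) :
    ‖y - (conj s₀ * x₁ + conj c₀ * x₂)‖ ≤ 16 * u * (‖x₁‖ + ‖x₂‖) := by
  obtain ⟨a, b, ha, hb, hy⟩ := h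
  have hr := hr.star
  refine norm_rounds_add_sub_le hu hu1 (norm_mul_sub_mul_le hu hu1 hr.sin hr.norm_sin_le ha)
    (norm_mul_sub_mul_le hu hu1 hr.cos hr.norm_cos_le hb) ?_ ?_ hy
  · rw [norm_mul]; exact mul_le_of_le_one_left (norm_nonneg _) hr.norm_sin_le
  · rw [norm_mul]; exact mul_le_of_le_one_left (norm_nonneg _) hr.norm_cos_le

theorem norm_sq_add_norm_sq_rotation {c s : ℂ} (h : ‖c‖ ^ 2 + ‖s‖ ^ 2 = 1) (x y : ℂ) :
    ‖c * x - s * y‖ ^ 2 + ‖conj s * x + conj c * y‖ ^ 2 = ‖x‖ ^ 2 + ‖y‖ ^ 2 := by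
  have key : (‖c * x - s * y‖ ^ 2 + ‖conj s * x + conj c * y‖ ^ 2 : ℝ) =
      (‖c‖ ^ 2 + ‖s‖ ^ 2) * (‖x‖ ^ 2 + ‖y‖ ^ 2) := by
    simp only [← Complex.normSq_eq_norm_sq, Complex.normSq_apply, Complex.sub_re, Complex.sub_im,
      Complex.add_re, Complex.add_im, Complex.mul_re, Complex.mul_im, Complex.conj_re,
      Complex.conj_im]
    ring
  rw [key, h, one_mul]

/-- The computed sum of squares of an approximately rotated vector. -/
theorem FlSumSq.bounds_of_rotation {u : ℝ} {c s x y x' y' : ℂ} {r : ℝ}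
    (h : FlSumSq u x' y' r) (hu : 0 ≤ u) (hu1 : u ≤ 1 / 1000) (hcs : ‖c‖ ^ 2 + ‖s‖ ^ 2 = 1)
    (hx : ‖x' - (c * x - s * y)‖ ≤ 20 * u * (‖x‖ + ‖y‖))
    (hy : ‖y' - (conj s * x + conj c * y)‖ ≤ 20 * u * (‖x‖ + ‖y‖)) :
    (‖x‖ + ‖y‖) ^ 2 ≤ 5 * r ∧ r ≤ 11 / 5 * (‖x‖ + ‖y‖) ^ 2 := by
  obtain ⟨h1, h2⟩ := h.bounds hu (by linarith)
  have hrot := norm_sq_add_norm_sq_rotation hcs x y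
  set a := ‖c * x - s * y‖
  set b := ‖conj s * x + conj c * y‖
  have ha : |‖x'‖ - a| ≤ 20 * u * (‖x‖ + ‖y‖) := (abs_norm_sub_norm_le _ _).trans hx
  have hb : |‖y'‖ - b| ≤ 20 * u * (‖x‖ + ‖y‖) := (abs_norm_sub_norm_le _ _).trans hy
  have ha0 : 0 ≤ a := norm_nonneg _
  have hb0 : 0 ≤ b := norm_nonneg _
  have hX : 0 ≤ ‖x'‖ := norm_nonneg _
  have hY : 0 ≤ ‖y'‖ := norm_nonneg _
  set F := ‖x‖ + ‖y‖ with hF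
  have hF0 : 0 ≤ F := by positivity
  have huF : 20 * u * F ≤ F / 50 := by nlinarith
  rw [abs_le] at ha hb
  have hFab : a ^ 2 + b ^ 2 ≤ F ^ 2 := by
    rw [hrot, hF]; nlinarith [norm_nonneg x, norm_nonneg y]
  have hFab2 : F ^ 2 ≤ 2 * (a ^ 2 + b ^ 2) := by
    rw [hrot, hF]; nlinarith [sq_nonneg (‖x‖ - ‖y‖)]
  have e1 : 99 / 100 ≤ (1 - u) ^ 3 := by nlinarith [sq_nonneg u, mul_nonneg hu (sq_nonneg u)]
  have e2 : (1 + u) ^ 3 ≤ 101 / 100 := by nlinarith [sq_nonneg u, mul_nonneg hu (sq_nonneg u)]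
  -- From `F ^ 2 / 2 ≤ a ^ 2 + b ^ 2 ≤ (a + b) ^ 2`, since 7/10 lies below $1/\sqrt2$.
  have hab : (7 / 10 * F) ≤ a + b := by
    refine (pow_le_pow_iff_left₀ (by positivity) (by positivity) two_ne_zero).1 ?_
    nlinarith only [mul_nonneg ha0 hb0, hFab2, sq_nonneg F]
  have hsq0 : 0 ≤ ‖x'‖ ^ 2 + ‖y'‖ ^ 2 := by positivity
  constructor
  · have h3 : 66 / 100 * F ≤ ‖x'‖ + ‖y'‖ := by linarith
    have h4 : (66 / 100 * F) ^ 2 ≤ 2 * (‖x'‖ ^ 2 + ‖y'‖ ^ 2) := by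
      have := pow_le_pow_left₀ (by positivity) h3 2
      nlinarith only [this, sq_nonneg (‖x'‖ - ‖y'‖)]
    have h5 := mul_le_mul_of_nonneg_right e1 hsq0
    nlinarith only [h4, h5, h1, sq_nonneg F]
  · have ha1 : a ≤ F := (pow_le_pow_iff_left₀ ha0 hF0 two_ne_zero).1
      (by linarith [sq_nonneg b])
    have hb1 : b ≤ F := (pow_le_pow_iff_left₀ hb0 hF0 two_ne_zero).1
      (by linarith [sq_nonneg a])
    have h3 : ‖x'‖ ≤ 51 / 50 * F := by linarith
    have h4 : ‖y'‖ ≤ 51 / 50 * F := by linarith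
    have h5 := mul_le_mul_of_nonneg_right e2 hsq0
    have h6 := pow_le_pow_left₀ hX h3 2
    have h7 := pow_le_pow_left₀ hY h4 2
    nlinarith only [h2, h5, h6, h7, sq_nonneg F]

/-- Elimination of one superdiagonal entry: the rotated and possibly corrected entry `z` of the
vector `p` is accurate relative to `p`, and the product `z * conj q` cancels the rotated entry of
the Hermitian part up to an error relative to the entries of the Hermitian part. -/
theorem norm_sub_le_of_rank_one {u : ℝ} {b d p₁ p₂ q x₁ x₂ c s c₀ s₀ b' d' x y v w z : ℂ}
    {r r' : ℝ} (hu : 0 ≤ u) (hu1 : u ≤ 1 / 1000)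
    (hx₁ : FlEntry u b p₁ q x₁) (hx₂ : FlEntry u d p₂ q x₂)
    (hcs : RotationApprox u c s c₀ s₀) (h0 : c₀ * x₁ - s₀ * x₂ = 0)
    (hb : FlRotFst u c s b d b') (hd : FlRotSnd u c s b d d')
    (hx : FlRotFst u c s p₁ p₂ x) (hy : FlRotSnd u c s p₁ p₂ y)
    (hv : Rounds u (x * conj q) v) (hw : Rounds u (y * conj q) w)
    (hr : FlSumSq u v w r) (hr' : FlSumSq u b' d' r')
    (hz : (r > r' ∧ ∃ t : ℂ, Rounds u (b' / conj q) t ∧ z = -t) ∨ (¬ r > r' ∧ z = x)) :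
    ‖z - (c₀ * p₁ - s₀ * p₂)‖ ≤ 100 * u * (‖p₁‖ + ‖p₂‖) ∧
    ‖-z * conj q - (c₀ * b - s₀ * d)‖ ≤ 100 * u * (‖b‖ + ‖d‖) := by
  have hx₁ := hx₁.norm_sub_le hu (by linarith)
  have hx₂ := hx₂.norm_sub_le hu (by linarith)
  have hb := hb.norm_sub_le hcs hu hu1
  have hd := hd.norm_sub_le hcs hu hu1
  have hx := hx.norm_sub_le hcs hu hu1
  have hy := hy.norm_sub_le hcs hu hu1
  set P := c₀ * p₁ - s₀ * p₂ with hP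
  set Y := conj s₀ * p₁ + conj c₀ * p₂ with hY
  set B := c₀ * b - s₀ * d with hB
  set ν := ‖b‖ + ‖d‖ with hν
  set π := ‖p₁‖ + ‖p₂‖ with hπ
  have hν0 : 0 ≤ ν := by positivity
  have hπ0 : 0 ≤ π := by positivity
  set α := π * ‖q‖ with hα
  have hα0 : 0 ≤ α := by positivity
  -- The rotation annihilates the computed operands, so `B + P * conj q` consists only of the
  -- rounding errors made in forming them.
  have hres : ‖B + P * conj q‖ ≤ 3 * u * (ν + α) := by
    have e : B + P * conj q =
        s₀ * (x₂ - (d + p₂ * conj q)) - c₀ * (x₁ - (b + p₁ * conj q)) := by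
      rw [hB, hP]; linear_combination h0
    rw [e]
    refine (norm_sub_le _ _).trans ?_
    rw [norm_mul, norm_mul]
    have f1 := mul_le_of_le_one_left (norm_nonneg (x₂ - (d + p₂ * conj q))) hcs.norm_sin_le
    have f2 := mul_le_of_le_one_left (norm_nonneg (x₁ - (b + p₁ * conj q))) hcs.norm_cos_le
    rw [hα, hπ, hν]
    linarith
  have key : ∀ {x v p : ℂ}, Rounds u (x * conj q) v → ‖x - p‖ ≤ 16 * u * π →
      ‖p‖ ≤ π → ‖v - p * conj q‖ ≤ 20 * u * α := by
    intro x v p hv hx hp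
    have f1 := hv.norm_sub_le
    have f2 : ‖x * conj q - p * conj q‖ ≤ 16 * u * α := by
      rw [← sub_mul, norm_mul, RCLike.norm_conj, hα, ← mul_assoc]
      gcongr
    have f3 : ‖v - p * conj q‖ ≤ ‖v - x * conj q‖ + ‖x * conj q - p * conj q‖ :=
      norm_sub_le_norm_sub_add_norm_sub _ _ _
    have f4 : ‖x * conj q‖ ≤ 2 * α := by
      rw [norm_mul, RCLike.norm_conj, hα, ← mul_assoc]
      have := norm_le_norm_add_norm_sub' x p
      gcongr
      nlinarith only [this, hx, hp, hu1, hπ0]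
    linarith [mul_le_mul_of_nonneg_left f4 hu, mul_nonneg hu hα0]
  have hPle : ‖P‖ ≤ π := by
    refine (norm_sub_le _ _).trans ?_
    rw [norm_mul, norm_mul]
    exact add_le_add (mul_le_of_le_one_left (norm_nonneg _) hcs.norm_cos_le)
      (mul_le_of_le_one_left (norm_nonneg _) hcs.norm_sin_le)
  have hYle : ‖Y‖ ≤ π := by
    refine (norm_add_le _ _).trans ?_
    rw [norm_mul, norm_mul]
    exact add_le_add (mul_le_of_le_one_left (norm_nonneg _) hcs.star.norm_sin_le)
      (mul_le_of_le_one_left (norm_nonneg _) hcs.star.norm_cos_le)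
  have hBle : ‖B‖ ≤ ν := by
    refine (norm_sub_le _ _).trans ?_
    rw [norm_mul, norm_mul]
    exact add_le_add (mul_le_of_le_one_left (norm_nonneg _) hcs.norm_cos_le)
      (mul_le_of_le_one_left (norm_nonneg _) hcs.norm_sin_le)
  have hvP := key hv hx hPle
  have hwY := key hw hy hYle
  have huν := mul_nonneg hu hν0
  have huα := mul_nonneg hu hα0
  have huπ := mul_nonneg hu hπ0
  have hR : α ^ 2 ≤ 5 * r ∧ r ≤ 11 / 5 * α ^ 2 := by
    have e : ‖p₁ * conj q‖ + ‖p₂ * conj q‖ = α := by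
      rw [norm_mul, norm_mul, RCLike.norm_conj, hα, hπ]; ring
    rw [← e]
    refine hr.bounds_of_rotation hu hu1 hcs.unit ?_ ?_
    · rw [e]; convert hvP using 2; rw [hP]; ring
    · rw [e]; convert hwY using 2; rw [hY]; ring
  have hR' : ν ^ 2 ≤ 5 * r' ∧ r' ≤ 11 / 5 * ν ^ 2 :=
    hr'.bounds_of_rotation hu hu1 hcs.unit (hb.trans (by rw [← hν]; linarith))
      (hd.trans (by rw [← hν]; linarith))
  -- The computed test compares `r` with `r'`, that is, `α ^ 2` with `ν ^ 2` up to constant factors.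
  -- Its outcome gives `ν ≤ 4 * α` when `p` is corrected and `α ≤ 4 * ν` otherwise; 4 suffices
  -- because 5 · 11/5 = 11 ≤ 16.
  rcases hz with ⟨hlt, t, ht, rfl⟩ | ⟨hle, rfl⟩
  · have hνα : ν ≤ 4 * α := by
      refine (pow_le_pow_iff_left₀ hν0 (by positivity) two_ne_zero).1 ?_
      linarith [hR.2, hR'.1, sq_nonneg α, mul_pow 4 α 2]
    have hq : conj q ≠ 0 := by
      intro hq
      have : q = 0 := by simpa using hq
      have : α = 0 := by rw [hα, this]; simp
      rw [this] at hR
      linarith [hR'.1, sq_nonneg ν, hR.2]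
    have hb'le : ‖b'‖ ≤ 2 * ν := by
      have := norm_le_norm_add_norm_sub' b' B
      nlinarith only [this, hb, hBle, hu1, hν0]
    have ht' : ‖t * conj q - b'‖ ≤ u * (2 * ν) := by
      obtain ⟨δ, hδ, rfl⟩ := ht
      have e : b' / conj q * (1 + δ) * conj q - b' = δ * b' := by
        field_simp; ring
      rw [e, norm_mul]; gcongr
    have htB : ‖t * conj q - B‖ ≤ 18 * u * ν := by
      have : ‖t * conj q - B‖ ≤ ‖t * conj q - b'‖ + ‖b' - B‖ :=
        norm_sub_le_norm_sub_add_norm_sub _ _ _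
      linarith
    constructor
    · have hq' : 0 < ‖q‖ := norm_pos_iff.2 (by simpa using hq)
      -- The corrected value nearly solves the same equation as the exact rotated `P`. Multiplied by
      -- `conj q`, their difference is at most `18uν + 3u(ν + α) ≤ 87uα`, and division by `‖q‖`
      -- makes this relative to `π`.
      have e : (-t - P) * conj q = -((t * conj q - B) + (B + P * conj q)) := by ring
      have f : ‖-t - P‖ * ‖q‖ ≤ 100 * u * π * ‖q‖ := by
        rw [← RCLike.norm_conj q, ← norm_mul, e, norm_neg, RCLike.norm_conj, mul_assoc, ← hα]
        refine (norm_add_le _ _).trans ?_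
        linarith [mul_le_mul_of_nonneg_left hνα hu]
      exact le_of_mul_le_mul_right f hq'
    · rw [neg_neg]; linarith
  · have hαν : α ≤ 4 * ν := by
      refine (pow_le_pow_iff_left₀ hα0 (by positivity) two_ne_zero).1 ?_
      linarith [hR.1, hR'.2, sq_nonneg ν, mul_pow 4 ν 2]
    refine ⟨by linarith only [hx, huπ], ?_⟩
    -- Without correction the error `16uα` of the product and the residual `3u(ν + α)` are both
    -- relative to `ν`, for a total of at most `79uν`.
    have e : -z * conj q - B = -((z - P) * conj q + (B + P * conj q)) := by ring
    have f : ‖(z - P) * conj q‖ ≤ 16 * u * α := by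
      rw [norm_mul, RCLike.norm_conj, hα, ← mul_assoc]; gcongr
    rw [e, norm_neg]
    refine (norm_add_le _ _).trans ?_
    linarith [mul_le_mul_of_nonneg_left hαν hu]

/-! ## Frobenius norms -/

section Norms

variable {n : ℕ}

theorem frobenius_norm_sq (A : Matrix (Fin n) (Fin n) ℂ) : ‖A‖ ^ 2 = ∑ i, ∑ j, ‖A i j‖ ^ 2 := by
  rw [Matrix.frobenius_norm_def, ← Real.sqrt_eq_rpow, Real.sq_sqrt]
  · simp
  · positivity

theorem frobenius_norm_le_of_entries {A B : Matrix (Fin n) (Fin n) ℂ}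
    (h : ∀ i j, ‖A i j‖ ≤ ‖B i j‖) : ‖A‖ ≤ ‖B‖ := by
  refine (pow_le_pow_iff_left₀ (norm_nonneg _) (norm_nonneg _) two_ne_zero).1 ?_
  rw [frobenius_norm_sq, frobenius_norm_sq]
  gcongr
  exact h _ _

theorem norm_entry_le_frobenius_norm (A : Matrix (Fin n) (Fin n) ℂ) (i j : Fin n) :
    ‖A i j‖ ≤ ‖A‖ := by
  refine (pow_le_pow_iff_left₀ (norm_nonneg _) (norm_nonneg _) two_ne_zero).1 ?_
  rw [frobenius_norm_sq]
  refine le_trans ?_ (Finset.single_le_sum (fun i _ => by positivity) (Finset.mem_univ i))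
  exact Finset.single_le_sum (f := fun j => ‖A i j‖ ^ 2) (fun i _ => by positivity)
    (Finset.mem_univ j)

theorem frobenius_norm_le_mul {A : Matrix (Fin n) (Fin n) ℂ} {b : ℝ} (hb : 0 ≤ b)
    (h : ∀ i j, ‖A i j‖ ≤ b) : ‖A‖ ≤ n * b := by
  refine (pow_le_pow_iff_left₀ (norm_nonneg _) (by positivity) two_ne_zero).1 ?_
  rw [frobenius_norm_sq]
  calc ∑ i, ∑ j, ‖A i j‖ ^ 2 ≤ ∑ i : Fin n, ∑ j : Fin n, b ^ 2 := by
        gcongr; exact h _ _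
    _ = _ := by simp; ring

theorem frobenius_norm_sq_eq_trace (A : Matrix (Fin n) (Fin n) ℂ) :
    ((‖A‖ ^ 2 : ℝ) : ℂ) = (A.conjTranspose * A).trace := by
  rw [frobenius_norm_sq, Finset.sum_comm]
  simp only [Matrix.trace, Matrix.diag, Matrix.mul_apply, Matrix.conjTranspose_apply]
  push_cast
  refine Finset.sum_congr rfl fun i _ => Finset.sum_congr rfl fun j _ => ?_
  rw [RCLike.star_def, Complex.conj_mul']

theorem frobenius_norm_unitary_mul {U : Matrix (Fin n) (Fin n) ℂ}
    (hU : U ∈ Matrix.unitaryGroup (Fin n) ℂ) (A : Matrix (Fin n) (Fin n) ℂ) : ‖U * A‖ = ‖A‖ := by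
  have hU' : U.conjTranspose * U = 1 := Matrix.mem_unitaryGroup_iff'.1 hU
  refine (pow_left_inj₀ (norm_nonneg _) (norm_nonneg _) two_ne_zero).1 ?_
  have : ((‖U * A‖ ^ 2 : ℝ) : ℂ) = ((‖A‖ ^ 2 : ℝ) : ℂ) := by
    rw [frobenius_norm_sq_eq_trace, frobenius_norm_sq_eq_trace, Matrix.conjTranspose_mul,
      Matrix.mul_assoc, ← Matrix.mul_assoc _ U A, hU', Matrix.one_mul]
  exact_mod_cast this

theorem frobenius_norm_mul_unitary {U : Matrix (Fin n) (Fin n) ℂ}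
    (hU : U ∈ Matrix.unitaryGroup (Fin n) ℂ) (A : Matrix (Fin n) (Fin n) ℂ) :
    ‖A * U‖ = ‖A‖ := by
  have hU' : U.conjTranspose ∈ Matrix.unitaryGroup (Fin n) ℂ := Unitary.star_mem hU
  rw [← Matrix.frobenius_norm_conjTranspose, Matrix.conjTranspose_mul,
    frobenius_norm_unitary_mul hU', Matrix.frobenius_norm_conjTranspose]

theorem norm_toLp_sq (x : Fin n → ℂ) : ‖WithLp.toLp 2 x‖ ^ 2 = ∑ i, ‖x i‖ ^ 2 := by
  rw [EuclideanSpace.norm_sq_eq]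

theorem norm_entry_le_norm_toLp (x : Fin n → ℂ) (i : Fin n) : ‖x i‖ ≤ ‖WithLp.toLp 2 x‖ :=
  PiLp.norm_apply_le (WithLp.toLp 2 x) i

theorem norm_toLp_le_of_entries {x y : Fin n → ℂ} {b : ℝ} (hb : 0 ≤ b)
    (h : ∀ i, ‖x i‖ ≤ b * ‖y i‖) : ‖WithLp.toLp 2 x‖ ≤ b * ‖WithLp.toLp 2 y‖ := by
  refine (pow_le_pow_iff_left₀ (norm_nonneg _) (by positivity) two_ne_zero).1 ?_
  rw [mul_pow, norm_toLp_sq, norm_toLp_sq, Finset.mul_sum]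
  refine Finset.sum_le_sum fun i _ => ?_
  rw [← mul_pow]
  exact pow_le_pow_left₀ (norm_nonneg _) (h i) 2

theorem norm_toLp_le_mul {x : Fin n → ℂ} {b : ℝ} (hb : 0 ≤ b) (h : ∀ i, ‖x i‖ ≤ b) :
    ‖WithLp.toLp 2 x‖ ≤ n * b := by
  refine (pow_le_pow_iff_left₀ (norm_nonneg _) (by positivity) two_ne_zero).1 ?_
  rw [norm_toLp_sq]
  calc ∑ i, ‖x i‖ ^ 2 ≤ ∑ _i : Fin n, b ^ 2 := by gcongr; exact h _
    _ = n * b ^ 2 := by simp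
    _ ≤ (n * b) ^ 2 := by
      rw [mul_pow]
      gcongr
      exact_mod_cast Nat.le_self_pow two_ne_zero n

theorem norm_toLp_unitary_mulVec {U : Matrix (Fin n) (Fin n) ℂ}
    (hU : U ∈ Matrix.unitaryGroup (Fin n) ℂ) (x : Fin n → ℂ) :
    ‖WithLp.toLp 2 (U.mulVec x)‖ = ‖WithLp.toLp 2 x‖ := by
  have hU' : U.conjTranspose * U = 1 := Matrix.mem_unitaryGroup_iff'.1 hU
  have e : ∀ y : Fin n → ℂ, ((‖WithLp.toLp 2 y‖ ^ 2 : ℝ) : ℂ) = star y ⬝ᵥ y := by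
    intro y
    rw [norm_toLp_sq]
    push_cast
    refine Finset.sum_congr rfl fun i _ => ?_
    rw [Pi.star_apply, RCLike.star_def, Complex.conj_mul']
  refine (pow_left_inj₀ (norm_nonneg _) (norm_nonneg _) two_ne_zero).1 ?_
  have : ((‖WithLp.toLp 2 (U.mulVec x)‖ ^ 2 : ℝ) : ℂ) = ((‖WithLp.toLp 2 x‖ ^ 2 : ℝ) : ℂ) := by
    rw [e, e, Matrix.star_mulVec, Matrix.dotProduct_mulVec, Matrix.vecMul_vecMul, hU',
      Matrix.vecMul_one]
  exact_mod_cast this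

end Norms

/-! ## Plane rotations -/

/-- The matrix with entries `X l j` for `l, j < n`. -/
def toMat (n : ℕ) (X : ℕ → ℕ → ℂ) : Matrix (Fin n) (Fin n) ℂ := Matrix.of fun l j => X l j

/-- The vector with entries `x j` for `j < n`. -/
def toVec (n : ℕ) (x : ℕ → ℂ) : Fin n → ℂ := fun j => x j

theorem toMat_apply (n : ℕ) (X : ℕ → ℕ → ℂ) (l j : Fin n) : toMat n X l j = X l j := rfl

/-- The plane rotation `[[c, -s], [conj s, conj c]]` applied to the entries `m`, `m + 1`. -/
def rotVec (m : ℕ) (c s : ℂ) (x : ℕ → ℂ) : ℕ → ℂ :=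
  Function.update (Function.update x m (c * x m - s * x (m + 1))) (m + 1)
    (conj s * x m + conj c * x (m + 1))

theorem rotVec_fst (m : ℕ) (c s : ℂ) (x : ℕ → ℂ) : rotVec m c s x m = c * x m - s * x (m + 1) := by
  simp [rotVec]

theorem rotVec_snd (m : ℕ) (c s : ℂ) (x : ℕ → ℂ) :
    rotVec m c s x (m + 1) = conj s * x m + conj c * x (m + 1) := by
  simp [rotVec]

theorem rotVec_of_ne {m l : ℕ} (c s : ℂ) (x : ℕ → ℂ) (h : l ≠ m) (h' : l ≠ m + 1) :
    rotVec m c s x l = x l := by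
  simp [rotVec, h, h']

/-- The rotation of rows. -/
def rotRows (m : ℕ) (c s : ℂ) (X : ℕ → ℕ → ℂ) : ℕ → ℕ → ℂ :=
  fun l j => rotVec m c s (fun k => X k j) l

/-- The rotation of columns, from the right by the conjugate transpose. -/
def rotCols (m : ℕ) (c s : ℂ) (X : ℕ → ℕ → ℂ) : ℕ → ℕ → ℂ :=
  fun l => rotVec m (conj c) (conj s) (X l)

/-- The matrix of the plane rotation. -/
def rotMat (n m : ℕ) (c s : ℂ) : Matrix (Fin n) (Fin n) ℂ :=
  toMat n (rotRows m c s fun l j => if l = j then 1 else 0)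

theorem rotMat_mulVec {n m : ℕ} (h : m + 1 < n) (c s : ℂ) (x : ℕ → ℂ) :
    (rotMat n m c s).mulVec (toVec n x) = toVec n (rotVec m c s x) := by
  have e : ∀ a (ha : a < n), ∑ k : Fin n, (if a = (k : ℕ) then x k else 0) = x a := by
    intro a ha
    rw [Finset.sum_eq_single ⟨a, ha⟩]
    · simp
    · intro b _ hb
      rw [if_neg]
      rintro rfl
      exact hb rfl
    · simp
  ext ⟨l, hl⟩
  simp only [Matrix.mulVec, dotProduct, rotMat, toMat_apply, rotRows, toVec]
  by_cases h1 : l = m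
  · subst h1
    simp only [rotVec_fst, sub_mul, mul_assoc, Finset.sum_sub_distrib, ← Finset.mul_sum, ite_mul,
      one_mul, zero_mul, e l hl, e _ h]
  · by_cases h2 : l = m + 1
    · subst h2
      simp only [rotVec_snd, add_mul, mul_assoc, Finset.sum_add_distrib, ← Finset.mul_sum, ite_mul,
        one_mul, zero_mul, e _ hl, e m (by omega)]
    · simp only [rotVec_of_ne _ _ _ h1 h2, ite_mul, one_mul, zero_mul, e l hl]

theorem rotMat_mul {n m : ℕ} (h : m + 1 < n) (c s : ℂ) (X : ℕ → ℕ → ℂ) :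
    rotMat n m c s * toMat n X = toMat n (rotRows m c s X) := by
  ext l j
  exact congrFun (rotMat_mulVec h c s fun k => X k j) l

theorem mul_conjTranspose_rotMat {n m : ℕ} (h : m + 1 < n) (c s : ℂ) (X : ℕ → ℕ → ℂ) :
    toMat n X * (rotMat n m c s).conjTranspose = toMat n (rotCols m c s X) := by
  have e : (toMat n X).conjTranspose = toMat n fun l j => conj (X j l) := rfl
  rw [← Matrix.conjTranspose_conjTranspose (toMat n X), ← Matrix.conjTranspose_mul, e,
    rotMat_mul h]
  ext l j
  simp only [Matrix.conjTranspose_apply, toMat_apply, rotRows, rotCols, RCLike.star_def]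
  by_cases h1 : (j : ℕ) = m
  · simp [h1, rotVec_fst]
  · by_cases h2 : (j : ℕ) = m + 1
    · simp [h2, rotVec_snd]
    · simp [rotVec_of_ne _ _ _ h1 h2]

theorem rotVec_rotVec (m : ℕ) {c s : ℂ} (h : ‖c‖ ^ 2 + ‖s‖ ^ 2 = 1) (x : ℕ → ℂ) :
    rotVec m c s (rotVec m (conj c) (-s) x) = x := by
  have h' : c * conj c + s * conj s = 1 := by
    rw [Complex.mul_conj', Complex.mul_conj']; exact_mod_cast h
  funext l
  by_cases h1 : l = m
  · subst h1
    rw [rotVec_fst, rotVec_fst, rotVec_snd]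
    simp only [map_neg, Complex.conj_conj]
    linear_combination x l * h'
  · by_cases h2 : l = m + 1
    · subst h2
      rw [rotVec_snd, rotVec_fst, rotVec_snd]
      simp only [map_neg, Complex.conj_conj]
      linear_combination x (m + 1) * h'
    · rw [rotVec_of_ne _ _ _ h1 h2, rotVec_of_ne _ _ _ h1 h2]

theorem conjTranspose_rotMat (n m : ℕ) (c s : ℂ) :
    (rotMat n m c s).conjTranspose = rotMat n m (conj c) (-s) := by
  ext l j
  simp only [Matrix.conjTranspose_apply, rotMat, toMat_apply, rotRows, RCLike.star_def]
  by_cases h1 : (l : ℕ) = m <;> by_cases h2 : (l : ℕ) = m + 1 <;>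
  by_cases h3 : (j : ℕ) = m <;> by_cases h4 : (j : ℕ) = m + 1 <;>
  first
  | omega
  | simp_all [rotVec_fst, rotVec_snd, rotVec_of_ne, eq_comm]

theorem rotMat_mem_unitaryGroup {n m : ℕ} (hm : m + 1 < n) {c s : ℂ}
    (h : ‖c‖ ^ 2 + ‖s‖ ^ 2 = 1) : rotMat n m c s ∈ Matrix.unitaryGroup (Fin n) ℂ := by
  rw [Matrix.mem_unitaryGroup_iff, Matrix.star_eq_conjTranspose, conjTranspose_rotMat]
  conv_lhs => rw [rotMat.eq_def n m (conj c) (-s)]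
  rw [rotMat_mul hm]
  ext l j
  have := congrFun (rotVec_rotVec m h fun k => if k = (j : ℕ) then 1 else 0) l
  rw [toMat_apply, rotRows]
  simp only [rotRows]
  rw [this, Matrix.one_apply]
  simp [Fin.ext_iff]

/-- The projection onto the coordinates with index at least `i`. -/
def trailing (n i : ℕ) : Matrix (Fin n) (Fin n) ℂ :=
  toMat n fun l j => if l = j ∧ i ≤ l then 1 else 0

/-- Both coordinates of the rotated plane have index at least `i`, so the projection is the identity
on that plane. This lets a shift of the active diagonal pass through the similarity unchanged. -/
theorem rotMat_mul_trailing {n m i : ℕ} (hm : m + 1 < n) (hi : i ≤ m) (c s : ℂ) :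
    rotMat n m c s * trailing n i = trailing n i * rotMat n m c s := by
  have e : (trailing n i).conjTranspose = trailing n i := by
    ext l j
    simp only [Matrix.conjTranspose_apply, trailing, toMat_apply, RCLike.star_def]
    by_cases h : (l : ℕ) = j
    · simp [h]
    · simp [h, Ne.symm h]
  rw [← Matrix.conjTranspose_conjTranspose (rotMat n m c s), conjTranspose_rotMat]
  conv_lhs => rw [conjTranspose_rotMat]
  rw [trailing, rotMat_mul hm, mul_conjTranspose_rotMat hm]
  have hi' : i ≤ m + 1 := by omega
  have hi'' : ¬ m + 1 < i := by omega
  ext l j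
  simp only [toMat_apply, rotRows, rotCols]
  by_cases h1 : (l : ℕ) = m <;> by_cases h2 : (l : ℕ) = m + 1 <;>
  by_cases h3 : (j : ℕ) = m <;> by_cases h4 : (j : ℕ) = m + 1 <;>
  first
  | omega
  | (simp_all [rotVec_fst, rotVec_snd, rotVec_of_ne, eq_comm])

/-- The product of the rotations in the planes `(m, m + 1)` for `m = n - 2, n - 3, …`, `k` of
them. -/
def rotChain (n : ℕ) (c s : ℕ → ℂ) : ℕ → Matrix (Fin n) (Fin n) ℂ
  | 0 => 1
  | k + 1 => rotMat n (n - 2 - k) (c (n - 2 - k)) (s (n - 2 - k)) * rotChain n c s k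

theorem rotChain_mem_unitaryGroup {n i : ℕ} {c s : ℕ → ℂ}
    (h : ∀ m, i ≤ m → m + 1 < n → ‖c m‖ ^ 2 + ‖s m‖ ^ 2 = 1) (k : ℕ) (hk : i + k + 1 ≤ n) :
    rotChain n c s k ∈ Matrix.unitaryGroup (Fin n) ℂ := by
  induction k with
  | zero => exact one_mem _
  | succ k ih =>
    exact mul_mem (rotMat_mem_unitaryGroup (by omega) (h _ (by omega) (by omega)))
      (ih (by omega))

theorem rotChain_mul_trailing {n i : ℕ} (c s : ℕ → ℂ) (k : ℕ) (hk : i + k + 1 ≤ n) :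
    rotChain n c s k * trailing n i = trailing n i * rotChain n c s k := by
  induction k with
  | zero => simp [rotChain]
  | succ k ih =>
    rw [rotChain, Matrix.mul_assoc, ih (by omega), ← Matrix.mul_assoc,
      rotMat_mul_trailing (by omega) (by omega), Matrix.mul_assoc]

/-! ## Elimination of the superdiagonal -/

/-- The positions at which the variables after the rotation in the plane `(m, m + 1)` determine
the entries of the rotated Hermitian part. -/
def elimRegion (i m l j : ℕ) : Prop := l ≤ j ∨ (i ≤ j ∧ (l = j + 1 ∨ l ≤ m))

/-- The entries of the rotated Hermitian part in terms of the variables of the elimination. -/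
noncomputable def elimEntry (i m : ℕ) (q : ℕ → ℂ) (E : ElimState) (l j : ℕ) : ℂ :=
  if l = j then E.d l
  else if l < j then
    (if j = l + 1 ∧ i ≤ l ∧ l < m then E.β l else -(E.p l * conj (q j)))
  else if l = j + 1 then E.γ j else -(E.qt l * conj (E.p j))

section ElimEntry

variable (i m : ℕ) (q : ℕ → ℂ) (E : ElimState)

theorem elimEntry_diag (l : ℕ) : elimEntry i m q E l l = E.d l := by simp [elimEntry]

theorem elimEntry_super {l : ℕ} (h : i ≤ l) (h' : l < m) :
    elimEntry i m q E l (l + 1) = E.β l := by simp [elimEntry, h, h']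

theorem elimEntry_upper {l j : ℕ} (h : l < j) (h' : ¬ (j = l + 1 ∧ i ≤ l ∧ l < m)) :
    elimEntry i m q E l j = -(E.p l * conj (q j)) := by
  rw [elimEntry, if_neg h.ne, if_pos h, if_neg h']

theorem elimEntry_sub (j : ℕ) : elimEntry i m q E (j + 1) j = E.γ j := by simp [elimEntry]

theorem elimEntry_lower {l j : ℕ} (h : j + 1 < l) :
    elimEntry i m q E l j = -(E.qt l * conj (E.p j)) := by
  rw [elimEntry, if_neg (by omega), if_neg (by omega), if_neg (by omega)]

end ElimEntry

/-- Plain rotations come with `κ = 16` and the corrected entry with `κ = 100`. This puts both in one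
bound when the two operands are entries of a matrix bounded by `N`. -/
theorem norm_sub_le_of_two {u N κ : ℝ} {z x y : ℂ} (hu : 0 ≤ u) (hκ : κ ≤ 100)
    (hx : ‖x‖ ≤ N) (hy : ‖y‖ ≤ N) (h : ‖z‖ ≤ κ * u * (‖x‖ + ‖y‖)) : ‖z‖ ≤ 200 * u * N := by
  have hN : 0 ≤ N := (norm_nonneg _).trans hx
  calc ‖z‖ ≤ κ * u * (‖x‖ + ‖y‖) := h
    _ ≤ 100 * u * (N + N) := by gcongr
    _ = 200 * u * N := by ring

/-- In each column the stored update is compared with the exact rotation of the two stored entries.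
When these share a factor `conj (q j)` or `conj (p j)`, the error of the rotated vector is
multiplied by that factor and so stays relative to the entries. The position `(m, m + 1)` needs
`norm_sub_le_of_rank_one`. The rotation is chosen before `X`, which outside the region is only
required to be bounded, so entries that the algorithm has dropped may be filled in afterwards. -/
theorem ElimStep.exists_rotation {u : ℝ} {i m : ℕ} {q : ℕ → ℂ} {E E' : ElimState} {c s : ℂ}
    (h : ElimStep u i q m E E' c s) (him : i ≤ m) (hu : 0 ≤ u) (hu1 : u ≤ 1 / 1000) :
    ∃ c₀ s₀ : ℂ, RotationApprox u c s c₀ s₀ ∧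
      (∀ l, ‖E'.p l - rotVec m c₀ s₀ E.p l‖ ≤ 100 * u * (‖E.p m‖ + ‖E.p (m + 1)‖)) ∧
      ∀ (n : ℕ) (N : ℝ) (X : ℕ → ℕ → ℂ), m + 1 < n → (∀ l j, l < n → j < n → ‖X l j‖ ≤ N) →
        (∀ l j, elimRegion i (m + 1) l j → X l j = elimEntry i (m + 1) q E l j) →
        ∀ l j, l < n → j < n → elimRegion i m l j →
          ‖elimEntry i m q E' l j - rotRows m c₀ s₀ X l j‖ ≤ 200 * u * N := by
  obtain ⟨x₁, x₂, hx₁, hx₂, hrot⟩ := h.rotation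
  obtain ⟨g, hg, hγ⟩ := h.sub
  obtain ⟨d₀, d₁, hd₀, hd₁, hd⟩ := h.diag
  obtain ⟨b, hb, hβ⟩ := h.super
  obtain ⟨x, y, v, w, r, r', hx, hy, hv, hw, hr, hr', hp⟩ := h.rank_one
  obtain ⟨t₀, t₁, ht₀, ht₁, hqt⟩ := h.copy
  obtain ⟨c₀, s₀, hcs, h0⟩ := hrot.exists_approx hu hu1
  have hbm : E'.β m = b := by rw [hβ, Function.update_self]
  have hdm : E'.d (m + 1) = d₁ := by rw [hd, Function.update_self]
  have hdm' : E'.d m = d₀ := by rw [hd]; simp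
  have hd' : ∀ l, l ≠ m → l ≠ m + 1 → E'.d l = E.d l := by
    intro l h1 h2; rw [hd]; simp [h1, h2]
  have hβ' : ∀ l, l ≠ m → E'.β l = E.β l := by
    intro l h1; rw [hβ]; simp [h1]
  rw [hbm, hdm] at hr'
  obtain ⟨z, hz, hpz⟩ : ∃ z, ((r > r' ∧ ∃ t : ℂ, Rounds u (b / conj (q (m + 1))) t ∧ z = -t) ∨
      (¬ r > r' ∧ z = x)) ∧ E'.p = Function.update (Function.update E.p m z) (m + 1) y := by
    rcases hp with ⟨h1, t, h2, h3⟩ | ⟨h1, h2⟩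
    · exact ⟨-t, Or.inl ⟨h1, t, by rwa [hbm] at h2, rfl⟩, h3⟩
    · exact ⟨x, Or.inr ⟨h1, rfl⟩, h2⟩
  obtain ⟨hzp, hzb⟩ :=
    norm_sub_le_of_rank_one hu hu1 hx₁ hx₂ hcs h0 hb hd₁ hx hy hv hw hr hr' hz
  have hpm : E'.p m = z := by rw [hpz]; simp
  have hpm' : E'.p (m + 1) = y := by rw [hpz]; simp
  have hp' : ∀ l, l ≠ m → l ≠ m + 1 → E'.p l = E.p l := by
    intro l h1 h2; rw [hpz]; simp [h1, h2]
  have hqm : E'.qt m = t₀ := by rw [hqt]; simp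
  have hq' : ∀ l, l ≠ m → l ≠ m + 1 → E'.qt l = E.qt l := by
    intro l h1 h2; rw [hqt]; simp [h1, h2]
  have hγm : E'.γ m = g := by
    rcases hγ with ⟨_, h1⟩ | ⟨_, w, g', _, _, h1⟩ <;> rw [h1] <;> simp
  have hγ' : ∀ l, l ≠ m → l + 1 ≠ m → E'.γ l = E.γ l := by
    intro l h1 h2
    rcases hγ with ⟨_, h3⟩ | ⟨_, w, g', _, _, h3⟩
    · rw [h3]; simp [h1]
    · rw [h3, Function.update_of_ne h1]
      by_cases h4 : m = 0
      · subst h4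
        exact Function.update_of_ne h1 _ _
      · exact Function.update_of_ne (by omega) _ _
  have hy' := hy.norm_sub_le hcs hu hu1
  refine ⟨c₀, s₀, hcs, ?_, ?_⟩
  · intro l
    by_cases h1 : l = m
    · subst h1
      rw [hpm, rotVec_fst]; exact hzp
    · by_cases h2 : l = m + 1
      · subst h2
        rw [hpm', rotVec_snd]
        refine hy'.trans ?_
        gcongr
        norm_num
      · rw [hp' l h1 h2, rotVec_of_ne _ _ _ h1 h2, sub_self, norm_zero]
        positivity
  · intro n N X hmn hN hX l j hl hj hreg
    have hN0 : 0 ≤ N := (norm_nonneg _).trans (hN l j hl hj)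
    by_cases h1 : l = m
    · subst h1
      have hXj : ‖X l j‖ ≤ N := hN _ _ hl hj
      have hXj' : ‖X (l + 1) j‖ ≤ N := hN _ _ hmn hj
      simp only [rotRows, rotVec_fst]
      rcases lt_trichotomy l j with hlj | rfl | hlj
      · rw [elimEntry_upper _ _ _ _ hlj (by omega), hpm]
        -- This position leaves `β` for the product form, and the corrected `p` is what keeps the
        -- error relative to `β` and `d`.
        by_cases h2 : j = l + 1
        · subst h2
          rw [hX _ _ (Or.inl hlj.le), elimEntry_super _ _ _ _ him (by omega)] at hXj ⊢
          rw [hX _ _ (Or.inl le_rfl), elimEntry_diag] at hXj' ⊢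
          rw [neg_mul_eq_neg_mul]
          exact norm_sub_le_of_two hu le_rfl hXj hXj' hzb
        · rw [hX _ _ (Or.inl hlj.le), elimEntry_upper _ _ _ _ hlj (by omega)] at hXj ⊢
          rw [hX (l + 1) j (Or.inl hlj), elimEntry_upper _ _ _ _ (by omega) (by omega)] at hXj' ⊢
          refine norm_sub_le_of_two hu le_rfl hXj hXj' ?_
          have e : -(z * conj (q j)) - (c₀ * -(E.p l * conj (q j)) -
              s₀ * -(E.p (l + 1) * conj (q j))) =
              -((z - (c₀ * E.p l - s₀ * E.p (l + 1))) * conj (q j)) := by ring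
          rw [e, norm_neg, norm_neg, norm_neg, norm_mul, norm_mul, norm_mul, ← add_mul,
            ← mul_assoc]
          gcongr
      · rw [elimEntry_diag, hdm']
        rw [hX _ _ (Or.inl le_rfl), elimEntry_diag] at hXj ⊢
        rw [hX _ _ (Or.inr ⟨him, Or.inl rfl⟩), elimEntry_sub] at hXj' ⊢
        exact norm_sub_le_of_two hu (by norm_num) hXj hXj'
          (hd₀.norm_sub_le hcs hu hu1)
      · have hij : i ≤ j := by rcases hreg with h3 | h3 <;> omega
        rw [hX (l + 1) j (Or.inr ⟨hij, by omega⟩),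
          elimEntry_lower i (l + 1) q E (by omega : j + 1 < l + 1)] at hXj' ⊢
        by_cases h2 : l = j + 1
        · subst h2
          -- For the last rotation `m = i` this position would be in column `i - 1`, outside the
          -- region, so skipping the update of `γ` is harmless. Otherwise the entry of row `m + 1`
          -- is `-(qt (m + 1) * conj (p (m - 1)))`, in which the current rotation leaves `p (m - 1)`
          -- untouched.
          rcases hγ with ⟨h3, _⟩ | ⟨_, w, g', hw, hg', h3⟩
          · omega
          rw [Nat.add_sub_cancel] at hw hg' h3
          have hgj : E'.γ j = g' := by rw [h3]; simp
          rw [elimEntry_sub, hgj]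
          rw [hX _ _ (Or.inr ⟨hij, Or.inl rfl⟩), elimEntry_sub] at hXj ⊢
          have f1 := hg'.norm_sub_le hcs hu hu1
          have f2 := hw.norm_sub_le
          set a := E.qt (j + 1 + 1) * conj (E.p j)
          rw [norm_neg] at hXj' f1
          have f3 := hw.norm_le
          have f4 : ‖s₀ * (w - a)‖ ≤ u * ‖a‖ := by
            rw [norm_mul]
            exact (mul_le_of_le_one_left (norm_nonneg _) hcs.norm_sin_le).trans f2
          have e : g' - (c₀ * E.γ j - s₀ * -a) = (g' - (c₀ * E.γ j - s₀ * -w)) + s₀ * (w - a) := by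
            ring
          rw [e]
          refine (norm_add_le _ _).trans ?_
          have f5 : ‖w‖ ≤ 2 * N := by nlinarith only [f3, hXj', hu1, hN0, norm_nonneg a, hu]
          have f6 : u * ‖a‖ ≤ u * N := by gcongr
          have f7 : 16 * u * (‖E.γ j‖ + ‖w‖) ≤ 16 * u * (N + 2 * N) := by gcongr
          linarith [mul_nonneg hu hN0]
        · rw [elimEntry_lower _ _ _ _ (by omega), hqm, hp' j (by omega) (by omega)]
          rw [hX _ _ (Or.inr ⟨hij, by omega⟩), elimEntry_lower _ _ _ _ (by omega)] at hXj ⊢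
          refine norm_sub_le_of_two hu (by norm_num : (16 : ℝ) ≤ 100) hXj hXj' ?_
          have e : -(t₀ * conj (E.p j)) - (c₀ * -(E.qt l * conj (E.p j)) -
              s₀ * -(E.qt (l + 1) * conj (E.p j))) =
              -((t₀ - (c₀ * E.qt l - s₀ * E.qt (l + 1))) * conj (E.p j)) := by ring
          rw [e, norm_neg, norm_neg, norm_neg, norm_mul, norm_mul, norm_mul, ← add_mul,
            ← mul_assoc]
          gcongr
          exact ht₀.norm_sub_le hcs hu hu1
    · by_cases h2 : l = m + 1
      · subst h2
        have hXj : ‖X m j‖ ≤ N := hN _ _ (by omega) hj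
        have hXj' : ‖X (m + 1) j‖ ≤ N := hN _ _ hmn hj
        simp only [rotRows, rotVec_snd]
        rcases lt_trichotomy (m + 1) j with hlj | rfl | hlj
        · rw [elimEntry_upper _ _ _ _ hlj (by omega), hpm']
          rw [hX m j (Or.inl (by omega)), elimEntry_upper _ _ _ _ (by omega) (by omega)] at hXj ⊢
          rw [hX (m + 1) j (Or.inl hlj.le), elimEntry_upper _ _ _ _ hlj (by omega)] at hXj' ⊢
          refine norm_sub_le_of_two hu (by norm_num : (16 : ℝ) ≤ 100) hXj hXj' ?_
          have e : -(y * conj (q j)) - (conj s₀ * -(E.p m * conj (q j)) +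
              conj c₀ * -(E.p (m + 1) * conj (q j))) =
              -((y - (conj s₀ * E.p m + conj c₀ * E.p (m + 1))) * conj (q j)) := by ring
          rw [e, norm_neg, norm_neg, norm_neg, norm_mul, norm_mul, norm_mul, ← add_mul,
            ← mul_assoc]
          gcongr
        · rw [elimEntry_diag, hdm]
          rw [hX m (m + 1) (Or.inl (by omega)), elimEntry_super _ _ _ _ him (by omega)] at hXj ⊢
          rw [hX (m + 1) (m + 1) (Or.inl le_rfl), elimEntry_diag] at hXj' ⊢
          exact norm_sub_le_of_two hu (by norm_num) hXj hXj'
            (hd₁.norm_sub_le hcs hu hu1)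
        -- After this rotation, row `m + 1` keeps only its subdiagonal entry below the diagonal. The
        -- back rotation needs nothing further down.
        · obtain rfl : j = m := by rcases hreg with h3 | h3 <;> omega
          rw [elimEntry_sub, hγm]
          rw [hX j j (Or.inl le_rfl), elimEntry_diag] at hXj ⊢
          rw [hX (j + 1) j (Or.inr ⟨him, Or.inl rfl⟩), elimEntry_sub] at hXj' ⊢
          exact norm_sub_le_of_two hu (by norm_num) hXj hXj'
            (hg.norm_sub_le hcs hu hu1)
      · simp only [rotRows, rotVec_of_ne c₀ s₀ _ h1 h2]
        have hreg' : elimRegion i (m + 1) l j := by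
          rcases hreg with h3 | h3
          · exact Or.inl h3
          · exact Or.inr ⟨h3.1, by omega⟩
        have e : elimEntry i m q E' l j = X l j := by
          rw [hX l j hreg']
          rcases lt_trichotomy l j with hlj | rfl | hlj
          · by_cases h3 : j = l + 1 ∧ i ≤ l ∧ l < m
            · obtain ⟨rfl, h3, h4⟩ := h3
              rw [elimEntry_super _ _ _ _ h3 h4, elimEntry_super _ _ _ _ h3 (by omega), hβ' l h1]
            · rw [elimEntry_upper _ _ _ _ hlj h3, elimEntry_upper _ _ _ _ hlj (by omega),
                hp' l h1 h2]
          · rw [elimEntry_diag, elimEntry_diag, hd' l h1 h2]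
          · by_cases h3 : l = j + 1
            · subst h3
              rw [elimEntry_sub, elimEntry_sub, hγ' j (by omega) h1]
            · have : l ≤ m := by rcases hreg with h4 | h4 <;> omega
              rw [elimEntry_lower _ _ _ _ (by omega), elimEntry_lower _ _ _ _ (by omega),
                hq' l h1 h2, hp' j (by omega) (by omega)]
        rw [e, sub_self, norm_zero]
        positivity

/-! ## Rotation back to Hessenberg form -/

/-- The positions at which the variables after the rotation of the columns `m`, `m + 1` determine
the entries of the rotated Hermitian part. -/
def backRegion (i m l j : ℕ) : Prop := l ≤ j ∨ (l = j + 1 ∧ i ≤ j ∧ j < m)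

/-- The entries of the rotated Hermitian part in terms of the variables of the back rotation. -/
noncomputable def backEntry (i m : ℕ) (γ p : ℕ → ℂ) (R : BackState) (l j : ℕ) : ℂ :=
  if l = j then R.d l
  else if l < j then
    (if j = l + 1 ∧ i ≤ l ∧ m ≤ l then R.β l else -(p l * conj (R.q j)))
  else γ j

section BackEntry

variable (i m : ℕ) (γ p : ℕ → ℂ) (R : BackState)

theorem backEntry_diag (l : ℕ) : backEntry i m γ p R l l = R.d l := by simp [backEntry]

theorem backEntry_super {l : ℕ} (h : i ≤ l) (h' : m ≤ l) :
    backEntry i m γ p R l (l + 1) = R.β l := by simp [backEntry, h, h']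

theorem backEntry_upper {l j : ℕ} (h : l < j) (h' : ¬ (j = l + 1 ∧ i ≤ l ∧ m ≤ l)) :
    backEntry i m γ p R l j = -(p l * conj (R.q j)) := by
  rw [backEntry, if_neg h.ne, if_pos h, if_neg h']

theorem backEntry_lower {l j : ℕ} (h : j < l) : backEntry i m γ p R l j = γ j := by
  rw [backEntry, if_neg (by omega), if_neg (by omega)]

end BackEntry

/-- `p` is frozen in this phase. As `q` is multiplied by the rotation, the products `-(p l * conj (q
j))` undergo the conjugate rotation of the columns. The entry `(m, m + 1)` returns from product form
to `β`; this product is itself an entry of `X`, hence bounded by `N`, and no correction is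
necessary. -/
theorem BackStep.norm_sub_le {u : ℝ} {i m : ℕ} {γ p : ℕ → ℂ} {R R' : BackState} {c s c₀ s₀ : ℂ}
    (h : BackStep u γ p c s m R R') (hcs : RotationApprox u c s c₀ s₀) (him : i ≤ m)
    (hu : 0 ≤ u) (hu1 : u ≤ 1 / 1000) :
    (∀ l, ‖R'.q l - rotVec m c₀ s₀ R.q l‖ ≤ 100 * u * (‖R.q m‖ + ‖R.q (m + 1)‖)) ∧
      ∀ (n : ℕ) (N : ℝ) (X : ℕ → ℕ → ℂ), m + 1 < n → (∀ l j, l < n → j < n → ‖X l j‖ ≤ N) →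
        (∀ l j, backRegion i (m + 1) l j → X l j = backEntry i (m + 1) γ p R l j) →
        ∀ l j, l < n → j < n → backRegion i m l j →
          ‖backEntry i m γ p R' l j - rotCols m c₀ s₀ X l j‖ ≤ 200 * u * N := by
  obtain ⟨w, x, y, b, hw, hx, hb, hy, hd, hβ⟩ := h.diag_super
  obtain ⟨q₀, q₁, hq₀, hq₁, hq⟩ := h.rotate_q
  have hbm : R'.β m = b := by rw [hβ, Function.update_self]
  have hβ' : ∀ l, l ≠ m → R'.β l = R.β l := by
    intro l h1; rw [hβ]; simp [h1]
  have hdm : R'.d (m + 1) = y := by rw [hd, Function.update_self]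
  have hdm' : R'.d m = x := by rw [hd]; simp
  have hd' : ∀ l, l ≠ m → l ≠ m + 1 → R'.d l = R.d l := by
    intro l h1 h2; rw [hd]; simp [h1, h2]
  have hqm : R'.q m = q₀ := by rw [hq]; simp
  have hqm' : R'.q (m + 1) = q₁ := by rw [hq]; simp
  have hq' : ∀ l, l ≠ m → l ≠ m + 1 → R'.q l = R.q l := by
    intro l h1 h2; rw [hq]; simp [h1, h2]
  have hq₀' := hq₀.norm_sub_le hcs hu hu1
  have hq₁' := hq₁.norm_sub_le hcs hu hu1
  have hcs' := hcs.star
  constructor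
  · intro l
    have h16 : 16 * u * (‖R.q m‖ + ‖R.q (m + 1)‖) ≤ 100 * u * (‖R.q m‖ + ‖R.q (m + 1)‖) := by
      gcongr; norm_num
    by_cases h1 : l = m
    · subst h1
      rw [hqm, rotVec_fst]; exact hq₀'.trans h16
    · by_cases h2 : l = m + 1
      · subst h2
        rw [hqm', rotVec_snd]; exact hq₁'.trans h16
      · rw [hq' l h1 h2, rotVec_of_ne _ _ _ h1 h2, sub_self, norm_zero]
        positivity
  intro n N X hmn hN hX l j hl hj hreg
  have hN0 : 0 ≤ N := (norm_nonneg _).trans (hN l j hl hj)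
  have hXm : ‖X l m‖ ≤ N := hN _ _ hl (by omega)
  have hXm' : ‖X l (m + 1)‖ ≤ N := hN _ _ hl hmn
  -- The operand `w` is the rounded product rather than the exact entry. Replacing it costs at most
  -- `u * N` on top of `48 * u * N` from the rotation.
  have hround : ∀ {ξ η a b z w : ℂ}, ‖z - (ξ * a + η * -w)‖ ≤ 16 * u * (‖a‖ + ‖-w‖) →
      Rounds u b w → ‖η‖ ≤ 1 → ‖a‖ ≤ N → ‖-b‖ ≤ N →
      ‖z - (ξ * a + η * -b)‖ ≤ 200 * u * N := by
    intro ξ η a b z w f1 hw hη ha hb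
    have f2 := hw.norm_sub_le
    have f3 := hw.norm_le
    rw [norm_neg] at hb f1
    have f4 : ‖η * (b - w)‖ ≤ u * ‖b‖ := by
      rw [norm_mul, norm_sub_rev]
      exact (mul_le_of_le_one_left (norm_nonneg _) hη).trans f2
    have e : z - (ξ * a + η * -b) = (z - (ξ * a + η * -w)) + η * (b - w) := by ring
    rw [e]
    refine (norm_add_le _ _).trans ?_
    have f5 : ‖w‖ ≤ 2 * N := by nlinarith only [f3, hb, hu1, hN0, norm_nonneg b, hu]
    have f6 : u * ‖b‖ ≤ u * N := by gcongr
    have f7 : 16 * u * (‖a‖ + ‖w‖) ≤ 16 * u * (N + 2 * N) := by gcongr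
    linarith [mul_nonneg hu hN0]
  by_cases h1 : j = m
  · subst h1
    simp only [rotCols, rotVec_fst]
    rcases lt_trichotomy l j with hlj | rfl | hlj
    · rw [backEntry_upper _ _ _ _ _ hlj (by omega), hqm]
      rw [hX _ _ (Or.inl hlj.le), backEntry_upper _ _ _ _ _ hlj (by omega)] at hXm ⊢
      rw [hX l (j + 1) (Or.inl (by omega)),
        backEntry_upper _ _ _ _ _ (by omega) (by omega)] at hXm' ⊢
      refine norm_sub_le_of_two hu (by norm_num : (16 : ℝ) ≤ 100) hXm hXm' ?_
      have e : -(p l * conj q₀) - (conj c₀ * -(p l * conj (R.q j)) -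
          conj s₀ * -(p l * conj (R.q (j + 1)))) =
          -(p l * conj (q₀ - (c₀ * R.q j - s₀ * R.q (j + 1)))) := by
        simp only [map_sub, map_mul]; ring
      rw [e, norm_neg, norm_neg, norm_neg, norm_mul, norm_mul, norm_mul, ← mul_add,
        RCLike.norm_conj, RCLike.norm_conj, RCLike.norm_conj, mul_left_comm]
      gcongr
    · rw [backEntry_diag, hdm']
      rw [hX _ _ (Or.inl le_rfl), backEntry_diag] at hXm ⊢
      rw [hX _ _ (Or.inl (by omega)), backEntry_upper _ _ _ _ _ (by omega) (by omega)] at hXm' ⊢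
      have f := hx.norm_sub_le hcs' hu hu1
      rw [sub_eq_add_neg (conj c₀ * _), ← neg_mul] at f ⊢
      exact hround f hw (by rw [norm_neg]; exact hcs'.norm_sin_le) hXm hXm'
    · rcases hreg with h3 | h3 <;> omega
  · by_cases h2 : j = m + 1
    · subst h2
      simp only [rotCols, rotVec_snd]
      rcases lt_trichotomy l m with hlj | rfl | hlj
      · rw [backEntry_upper _ _ _ _ _ (by omega) (by omega), hqm']
        rw [hX _ _ (Or.inl hlj.le), backEntry_upper _ _ _ _ _ hlj (by omega)] at hXm ⊢
        rw [hX l (m + 1) (Or.inl (by omega)),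
          backEntry_upper _ _ _ _ _ (by omega) (by omega)] at hXm' ⊢
        refine norm_sub_le_of_two hu (by norm_num : (16 : ℝ) ≤ 100) hXm hXm' ?_
        have e : -(p l * conj q₁) - (conj (conj s₀) * -(p l * conj (R.q m)) +
            conj (conj c₀) * -(p l * conj (R.q (m + 1)))) =
            -(p l * conj (q₁ - (conj s₀ * R.q m + conj c₀ * R.q (m + 1)))) := by
          simp only [map_sub, map_mul, map_add]; ring
        rw [e, norm_neg, norm_neg, norm_neg, norm_mul, norm_mul, norm_mul, ← mul_add,
          RCLike.norm_conj, RCLike.norm_conj, RCLike.norm_conj, mul_left_comm]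
        gcongr
      · rw [backEntry_super _ _ _ _ _ him le_rfl, hbm]
        rw [hX _ _ (Or.inl le_rfl), backEntry_diag] at hXm ⊢
        rw [hX _ _ (Or.inl (by omega)), backEntry_upper _ _ _ _ _ (by omega) (by omega)] at hXm' ⊢
        exact hround (hb.norm_sub_le hcs' hu hu1) hw hcs'.star.norm_cos_le hXm hXm'
      · obtain rfl : l = m + 1 := by rcases hreg with h3 | h3 <;> omega
        rw [backEntry_diag, hdm]
        rw [hX _ _ (Or.inr ⟨rfl, him, by omega⟩), backEntry_lower _ _ _ _ _ (by omega)] at hXm ⊢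
        rw [hX _ _ (Or.inl le_rfl), backEntry_diag] at hXm' ⊢
        exact norm_sub_le_of_two hu (by norm_num) hXm hXm'
          (hy.norm_sub_le hcs' hu hu1)
    · simp only [rotCols, rotVec_of_ne _ _ _ h1 h2]
      have hreg' : backRegion i (m + 1) l j := by
        rcases hreg with h3 | h3
        · exact Or.inl h3
        · exact Or.inr ⟨h3.1, h3.2.1, by omega⟩
      have e : backEntry i m γ p R' l j = X l j := by
        rw [hX l j hreg']
        rcases lt_trichotomy l j with hlj | rfl | hlj
        · by_cases h3 : j = l + 1 ∧ i ≤ l ∧ m ≤ l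
          · obtain ⟨rfl, h3, h4⟩ := h3
            rw [backEntry_super _ _ _ _ _ h3 h4, backEntry_super _ _ _ _ _ h3 (by omega),
              hβ' l (by omega)]
          · rw [backEntry_upper _ _ _ _ _ hlj h3, backEntry_upper _ _ _ _ _ hlj (by omega),
              hq' j h1 h2]
        · rw [backEntry_diag, backEntry_diag, hd' l h1 h2]
        · rw [backEntry_lower _ _ _ _ _ hlj, backEntry_lower _ _ _ _ _ hlj]
      rw [e, sub_self, norm_zero]
      positivity

/-! ## One sweep -/

/-- The entries above the diagonal of the Hermitian part; the superdiagonal entries in the rows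
before `i` are those of a deflated matrix. -/
noncomputable def superEntry (i : ℕ) (S : Generators) (l j : ℕ) : ℂ :=
  if j = l + 1 ∧ i ≤ l then S.β l else -(S.p l * conj (S.q j))

/-- The Hermitian part (up to the diagonal) with generators `S`. -/
noncomputable def genEntry (i : ℕ) (S : Generators) (l j : ℕ) : ℂ :=
  if l = j then S.d l else if l < j then superEntry i S l j else conj (superEntry i S j l)

/-- The Hermitian part (up to the diagonal) with generators `S`, deflated in the rows before
`i`. -/
noncomputable def genMatrix (n i : ℕ) (S : Generators) : Matrix (Fin n) (Fin n) ℂ :=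
  toMat n (genEntry i S)

/-- Take the stored values where they are known and the exactly transformed entries elsewhere. The
dropped positions then contribute no error, and the result is a full matrix to which the next
rotation can be applied. -/
theorem exists_tracked_of_local_error {n : ℕ} {P : ℕ → ℕ → Prop} {V W : ℕ → ℕ → ℂ}
    {M : Matrix (Fin n) (Fin n) ℂ} {b e : ℝ} (hb : 0 ≤ b) (hM : ‖toMat n W - M‖ ≤ e)
    (h : ∀ l j, l < n → j < n → P l j → ‖V l j - W l j‖ ≤ b) :
    ∃ X : ℕ → ℕ → ℂ, (∀ l j, P l j → X l j = V l j) ∧ ‖toMat n X - M‖ ≤ e + n * b := by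
  classical
  refine ⟨fun l j => if P l j then V l j else W l j, fun l j hP => if_pos hP, ?_⟩
  refine (norm_sub_le_norm_sub_add_norm_sub _ (toMat n W) _).trans ?_
  rw [add_comm]
  refine add_le_add hM (frobenius_norm_le_mul hb fun l j => ?_)
  rw [Matrix.sub_apply, toMat_apply, toMat_apply]
  split_ifs with hP
  · exact h l j l.2 j.2 hP
  · rwa [sub_self, norm_zero]

theorem norm_toVec_sub_le_of_local_error {n : ℕ} {x y : ℕ → ℂ} {z : Fin n → ℂ} {b e : ℝ}
    (hb : 0 ≤ b) (hM : ‖WithLp.toLp 2 (toVec n y - z)‖ ≤ e)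
    (h : ∀ l, l < n → ‖x l - y l‖ ≤ b) :
    ‖WithLp.toLp 2 (toVec n x - z)‖ ≤ e + n * b := by
  have e1 : WithLp.toLp 2 (toVec n x - z) =
      WithLp.toLp 2 (toVec n x - toVec n y) + WithLp.toLp 2 (toVec n y - z) := by
    rw [← WithLp.toLp_add, sub_add_sub_cancel]
  rw [e1, add_comm e]
  refine (norm_add_le _ _).trans (add_le_add (norm_toLp_le_mul hb fun l => ?_) hM)
  exact h l l.2

theorem norm_toVec_le_of_sub {n : ℕ} {x y : Fin n → ℂ} {e : ℝ}
    (h : ‖WithLp.toLp 2 (x - y)‖ ≤ e) :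
    ‖WithLp.toLp 2 x‖ ≤ ‖WithLp.toLp 2 y‖ + e := by
  have : WithLp.toLp 2 x = WithLp.toLp 2 y + WithLp.toLp 2 (x - y) := by
    rw [← WithLp.toLp_add, add_sub_cancel]
  rw [this]
  exact (norm_add_le _ _).trans (by gcongr)

/-- A bootstrap: over at most `n` rotations the accumulated error does not exceed the initial norm
`N`, so all intermediate entries are at most `2 * N`. This turns the local bound `200 * u * (2 * N)`
into the constant 400. -/
theorem steps_mul_le {n k : ℕ} {u N : ℝ} (hk : k ≤ n) (hu : 0 ≤ u) (hN : 0 ≤ N)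
    (hsmall : 1200 * n ^ 2 * u ≤ 1) : k * (n * (400 * u * N)) ≤ N := by
  have hk' : (k : ℝ) ≤ n := by exact_mod_cast hk
  calc (k : ℝ) * (n * (400 * u * N)) ≤ n * (n * (400 * u * N)) := by gcongr
    _ = (400 * n ^ 2 * u) * N := by ring
    _ ≤ 1 * N := by
      gcongr
      have : 0 ≤ (n : ℝ) ^ 2 * u := by positivity
      linarith
    _ = N := one_mul N

/-- Each local error is carried along by exact rotations, which preserve the norms. The errors of
`k` rotations therefore add up without amplification, in the matrix and in `p`. -/
theorem elim_phase {u : ℝ} {n i : ℕ} {E : ℕ → ElimState} {q : ℕ → ℂ} {c₀ s₀ : ℕ → ℂ}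
    {G : Matrix (Fin n) (Fin n) ℂ} {c s : ℕ → ℂ}
    (hu : 0 ≤ u) (hsmall : 1200 * n ^ 2 * u ≤ 1)
    (hG : ∃ X : ℕ → ℕ → ℂ, G = toMat n X ∧
      ∀ l j, elimRegion i (n - 1) l j → X l j = elimEntry i (n - 1) q (E (n - 1)) l j)
    (hcs : ∀ m, i ≤ m → m + 1 < n → RotationApprox u (c m) (s m) (c₀ m) (s₀ m))
    (hp : ∀ m, i ≤ m → m + 1 < n → ∀ l, ‖(E m).p l - rotVec m (c₀ m) (s₀ m) (E (m + 1)).p l‖ ≤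
      100 * u * (‖(E (m + 1)).p m‖ + ‖(E (m + 1)).p (m + 1)‖))
    (hE : ∀ m, i ≤ m → m + 1 < n → ∀ (N : ℝ) (X : ℕ → ℕ → ℂ),
      (∀ l j, l < n → j < n → ‖X l j‖ ≤ N) →
      (∀ l j, elimRegion i (m + 1) l j → X l j = elimEntry i (m + 1) q (E (m + 1)) l j) →
      ∀ l j, l < n → j < n → elimRegion i m l j →
        ‖elimEntry i m q (E m) l j - rotRows m (c₀ m) (s₀ m) X l j‖ ≤ 200 * u * N)
    (k : ℕ) (hk : i + k + 1 ≤ n) :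
    (∃ X : ℕ → ℕ → ℂ, (∀ l j, elimRegion i (n - 1 - k) l j →
        X l j = elimEntry i (n - 1 - k) q (E (n - 1 - k)) l j) ∧
      ‖toMat n X - rotChain n c₀ s₀ k * G‖ ≤ k * (n * (400 * u * ‖G‖))) ∧
    ‖WithLp.toLp 2 (toVec n (E (n - 1 - k)).p -
        (rotChain n c₀ s₀ k).mulVec (toVec n (E (n - 1)).p))‖ ≤
      k * (n * (400 * u * ‖WithLp.toLp 2 (toVec n (E (n - 1)).p)‖)) := by
  have hunit : ∀ m, i ≤ m → m + 1 < n → ‖c₀ m‖ ^ 2 + ‖s₀ m‖ ^ 2 = 1 :=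
    fun m h1 h2 => (hcs m h1 h2).unit
  induction k with
  | zero =>
    obtain ⟨X, rfl, hX⟩ := hG
    exact ⟨⟨X, hX, by simp [rotChain]⟩, by simp [rotChain]⟩
  | succ k ih =>
    obtain ⟨⟨X, hX, hXG⟩, hv⟩ := ih (by omega)
    obtain ⟨m, hm⟩ : ∃ m, n - 1 - (k + 1) = m := ⟨_, rfl⟩
    have hm1 : n - 1 - k = m + 1 := by omega
    have hm2 : n - 2 - k = m := by omega
    have hmn : m + 1 < n := by omega
    have him : i ≤ m := by omega
    have hU := rotChain_mem_unitaryGroup hunit k (by omega)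
    have hR := rotMat_mem_unitaryGroup hmn (hunit m him hmn)
    rw [hm]
    rw [hm1] at hX hv
    simp only [rotChain, hm2]
    push_cast
    constructor
    · have hN : ∀ l j, l < n → j < n → ‖X l j‖ ≤ 2 * ‖G‖ := by
        intro l j hl hj
        have h1 := norm_entry_le_frobenius_norm (toMat n X) ⟨l, hl⟩ ⟨j, hj⟩
        rw [toMat_apply] at h1
        have h2 := norm_le_norm_add_norm_sub' (toMat n X) (rotChain n c₀ s₀ k * G)
        rw [frobenius_norm_unitary_mul hU] at h2
        have h3 := steps_mul_le (k := k) (by omega) hu (norm_nonneg G) hsmall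
        exact h1.trans (h2.trans (by linarith))
      have hloc := hE m him hmn (2 * ‖G‖) X hN hX
      have hXG' : ‖toMat n (rotRows m (c₀ m) (s₀ m) X) -
          rotMat n m (c₀ m) (s₀ m) * rotChain n c₀ s₀ k * G‖ ≤ k * (n * (400 * u * ‖G‖)) := by
        rw [← rotMat_mul hmn, Matrix.mul_assoc, ← Matrix.mul_sub, frobenius_norm_unitary_mul hR]
        exact hXG
      obtain ⟨Y, hY, hYG⟩ := exists_tracked_of_local_error (by positivity) hXG' hloc
      exact ⟨Y, hY, hYG.trans (le_of_eq (by ring))⟩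
    · set p₀ := toVec n (E (n - 1)).p
      have hN : ∀ l, l < n → ‖(E (m + 1)).p l‖ ≤ 2 * ‖WithLp.toLp 2 p₀‖ := by
        intro l hl
        have h1 := norm_entry_le_norm_toLp (toVec n (E (m + 1)).p) ⟨l, hl⟩
        have h2 := norm_toVec_le_of_sub hv
        rw [norm_toLp_unitary_mulVec hU] at h2
        have h3 := steps_mul_le (k := k) (by omega) hu (norm_nonneg (WithLp.toLp 2 p₀)) hsmall
        exact h1.trans (h2.trans (by linarith))
      have hv' : ‖WithLp.toLp 2 (toVec n (rotVec m (c₀ m) (s₀ m) (E (m + 1)).p) -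
          (rotMat n m (c₀ m) (s₀ m) * rotChain n c₀ s₀ k).mulVec p₀)‖ ≤
          k * (n * (400 * u * ‖WithLp.toLp 2 p₀‖)) := by
        rw [← rotMat_mulVec hmn, ← Matrix.mulVec_mulVec, ← Matrix.mulVec_sub,
          norm_toLp_unitary_mulVec hR]
        exact hv
      have := norm_toVec_sub_le_of_local_error (b := 400 * u * ‖WithLp.toLp 2 p₀‖) (by positivity)
        hv' fun l hl => (hp m him hmn l).trans (by
          have h1 := hN m (by omega)
          have h2 := hN (m + 1) hmn
          calc 100 * u * (‖(E (m + 1)).p m‖ + ‖(E (m + 1)).p (m + 1)‖)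
              ≤ 100 * u * (2 * ‖WithLp.toLp 2 p₀‖ + 2 * ‖WithLp.toLp 2 p₀‖) := by gcongr
            _ = _ := by ring)
      exact this.trans (le_of_eq (by ring))

/-- The same accumulation for column rotations, starting from the matrix reached by the elimination.
Here `q` is the rotated vector. -/
theorem back_phase {u : ℝ} {n i : ℕ} {R : ℕ → BackState} {γ p : ℕ → ℂ} {c₀ s₀ : ℕ → ℂ}
    {X₀ : ℕ → ℕ → ℂ} {c s : ℕ → ℂ}
    (hu : 0 ≤ u) (hu1 : u ≤ 1 / 1000) (hsmall : 1200 * n ^ 2 * u ≤ 1)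
    (hX₀ : ∀ l j, l < n → j < n → backRegion i (n - 1) l j →
      X₀ l j = backEntry i (n - 1) γ p (R (n - 1)) l j)
    (hcs : ∀ m, i ≤ m → m + 1 < n → RotationApprox u (c m) (s m) (c₀ m) (s₀ m))
    (hR : ∀ m, i ≤ m → m + 1 < n → BackStep u γ p (c m) (s m) m (R (m + 1)) (R m))
    (k : ℕ) (hk : i + k + 1 ≤ n) :
    (∃ X : ℕ → ℕ → ℂ, (∀ l j, backRegion i (n - 1 - k) l j →
        X l j = backEntry i (n - 1 - k) γ p (R (n - 1 - k)) l j) ∧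
      ‖toMat n X - toMat n X₀ * (rotChain n c₀ s₀ k).conjTranspose‖ ≤
        k * (n * (400 * u * ‖toMat n X₀‖))) ∧
    ‖WithLp.toLp 2 (toVec n (R (n - 1 - k)).q -
        (rotChain n c₀ s₀ k).mulVec (toVec n (R (n - 1)).q))‖ ≤
      k * (n * (400 * u * ‖WithLp.toLp 2 (toVec n (R (n - 1)).q)‖)) := by
  have hunit : ∀ m, i ≤ m → m + 1 < n → ‖c₀ m‖ ^ 2 + ‖s₀ m‖ ^ 2 = 1 :=
    fun m h1 h2 => (hcs m h1 h2).unit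
  induction k with
  | zero =>
    refine ⟨?_, by simp [rotChain]⟩
    -- `X₀` agrees with the variables only at indices below `n`, whereas the induction wants
    -- agreement on the whole region. A local error bound `b = 0` redefines it outside at no cost.
    obtain ⟨X, hX, hX'⟩ := exists_tracked_of_local_error (n := n) (b := 0) (e := 0) le_rfl
      (M := toMat n X₀) (W := X₀) (P := backRegion i (n - 1))
      (V := backEntry i (n - 1) γ p (R (n - 1))) (by simp) (by
        intro l j hl hj h; rw [hX₀ l j hl hj h]; simp)
    exact ⟨X, hX, by simpa [rotChain] using hX'⟩
  | succ k ih =>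
    obtain ⟨⟨X, hX, hXG⟩, hv⟩ := ih (by omega)
    obtain ⟨m, hm⟩ : ∃ m, n - 1 - (k + 1) = m := ⟨_, rfl⟩
    have hm1 : n - 1 - k = m + 1 := by omega
    have hm2 : n - 2 - k = m := by omega
    have hmn : m + 1 < n := by omega
    have him : i ≤ m := by omega
    have hU := rotChain_mem_unitaryGroup hunit k (by omega)
    have hU' : (rotChain n c₀ s₀ k).conjTranspose ∈ Matrix.unitaryGroup (Fin n) ℂ :=
      Unitary.star_mem hU
    have hQ := rotMat_mem_unitaryGroup hmn (hunit m him hmn)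
    have hQ' : (rotMat n m (c₀ m) (s₀ m)).conjTranspose ∈ Matrix.unitaryGroup (Fin n) ℂ :=
      Unitary.star_mem hQ
    obtain ⟨hq, hE⟩ := (hR m him hmn).norm_sub_le (hcs m him hmn) him hu hu1
    rw [hm]
    rw [hm1] at hX hv
    simp only [rotChain, hm2]
    push_cast
    constructor
    · have hN : ∀ l j, l < n → j < n → ‖X l j‖ ≤ 2 * ‖toMat n X₀‖ := by
        intro l j hl hj
        have h1 := norm_entry_le_frobenius_norm (toMat n X) ⟨l, hl⟩ ⟨j, hj⟩
        rw [toMat_apply] at h1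
        have h2 := norm_le_norm_add_norm_sub' (toMat n X)
          (toMat n X₀ * (rotChain n c₀ s₀ k).conjTranspose)
        rw [frobenius_norm_mul_unitary hU'] at h2
        have h3 := steps_mul_le (k := k) (by omega) hu (norm_nonneg (toMat n X₀)) hsmall
        exact h1.trans (h2.trans (by linarith))
      have hloc := hE n (2 * ‖toMat n X₀‖) X hmn hN hX
      have hXG' : ‖toMat n (rotCols m (c₀ m) (s₀ m) X) - toMat n X₀ *
          (rotMat n m (c₀ m) (s₀ m) * rotChain n c₀ s₀ k).conjTranspose‖ ≤
          k * (n * (400 * u * ‖toMat n X₀‖)) := by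
        rw [← mul_conjTranspose_rotMat hmn, Matrix.conjTranspose_mul, ← Matrix.mul_assoc,
          ← Matrix.sub_mul, frobenius_norm_mul_unitary hQ']
        exact hXG
      obtain ⟨Y, hY, hYG⟩ := exists_tracked_of_local_error (by positivity) hXG' hloc
      exact ⟨Y, hY, hYG.trans (le_of_eq (by ring))⟩
    · set p₀ := toVec n (R (n - 1)).q
      have hN : ∀ l, l < n → ‖(R (m + 1)).q l‖ ≤ 2 * ‖WithLp.toLp 2 p₀‖ := by
        intro l hl
        have h1 := norm_entry_le_norm_toLp (toVec n (R (m + 1)).q) ⟨l, hl⟩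
        have h2 := norm_toVec_le_of_sub hv
        rw [norm_toLp_unitary_mulVec hU] at h2
        have h3 := steps_mul_le (k := k) (by omega) hu (norm_nonneg (WithLp.toLp 2 p₀)) hsmall
        exact h1.trans (h2.trans (by linarith))
      have hv' : ‖WithLp.toLp 2 (toVec n (rotVec m (c₀ m) (s₀ m) (R (m + 1)).q) -
          (rotMat n m (c₀ m) (s₀ m) * rotChain n c₀ s₀ k).mulVec p₀)‖ ≤
          k * (n * (400 * u * ‖WithLp.toLp 2 p₀‖)) := by
        rw [← rotMat_mulVec hmn, ← Matrix.mulVec_mulVec, ← Matrix.mulVec_sub,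
          norm_toLp_unitary_mulVec hQ]
        exact hv
      have := norm_toVec_sub_le_of_local_error (b := 400 * u * ‖WithLp.toLp 2 p₀‖) (by positivity)
        hv' fun l hl => (hq l).trans (by
          have h1 := hN m (by omega)
          have h2 := hN (m + 1) hmn
          calc 100 * u * (‖(R (m + 1)).q m‖ + ‖(R (m + 1)).q (m + 1)‖)
              ≤ 100 * u * (2 * ‖WithLp.toLp 2 p₀‖ + 2 * ‖WithLp.toLp 2 p₀‖) := by gcongr
            _ = _ := by ring)
      exact this.trans (le_of_eq (by ring))

/-- One sweep in floating point arithmetic is close to a unitary similarity, on and above the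
diagonal. -/
theorem FlSweep.exists_unitary {u : ℝ} {n i : ℕ} {S S' : Generators} (h : FlSweep u n i S S')
    (hin : i + 1 < n) (hu : 0 ≤ u) (hsmall : 1200 * n ^ 2 * u ≤ 1) :
    ∃ U ∈ Matrix.unitaryGroup (Fin n) ℂ, U * trailing n i = trailing n i * U ∧
      (∀ l j : Fin n, l ≤ j →
        ‖(genMatrix n i S' - U * genMatrix n i S * U.conjTranspose) l j‖ ≤
          1200 * n ^ 2 * u * ‖genMatrix n i S‖) ∧
      ‖WithLp.toLp 2 (toVec n S'.p - U.mulVec (toVec n S.p))‖ ≤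
        400 * n ^ 2 * u * ‖WithLp.toLp 2 (toVec n S.p)‖ ∧
      ‖WithLp.toLp 2 (toVec n S'.q - U.mulVec (toVec n S.q))‖ ≤
        400 * n ^ 2 * u * ‖WithLp.toLp 2 (toVec n S.q)‖ := by
  have hn2 : (2 : ℝ) ≤ n := by exact_mod_cast (by omega : 2 ≤ n)
  have hu1 : u ≤ 1 / 1000 := by nlinarith
  obtain ⟨E, R, c, s, hE0, hE, hR0, hR, rfl⟩ := h
  have hrot := fun m (h1 : i ≤ m) (h2 : m + 1 < n) => (hE m h1 h2).exists_rotation h1 hu hu1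
  choose! c₀ s₀ hcs hp hloc using hrot
  set G := genMatrix n i S with hG
  have hunit : ∀ m, i ≤ m → m + 1 < n → ‖c₀ m‖ ^ 2 + ‖s₀ m‖ ^ 2 = 1 :=
    fun m h1 h2 => (hcs m h1 h2).unit
  set k := n - 1 - i with hk
  have hki : n - 1 - k = i := by omega
  have hkn : (k : ℝ) ≤ n := by exact_mod_cast (by omega : k ≤ n)
  have hU := rotChain_mem_unitaryGroup hunit k (by omega)
  -- Inside the initial region the variables reproduce `G` exactly: `γ = conj β` and `qt = q` give
  -- the lower part of the active columns by symmetry. The lower part of the columns before `i` is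
  -- not stored and is taken from `G`.
  obtain ⟨Z, hZ, hZ'⟩ := exists_tracked_of_local_error (n := n) (b := 0) (e := 0) le_rfl
      (M := G) (W := genEntry i S) (P := elimRegion i (n - 1))
      (V := elimEntry i (n - 1) S.q (E (n - 1))) (by simp [hG, genMatrix]) (by
        intro l j hl hj hreg
        rw [hE0]
        rcases lt_trichotomy l j with hlj | rfl | hlj
        · rw [genEntry, if_neg hlj.ne, if_pos hlj, superEntry]
          split_ifs with h1
          · obtain ⟨rfl, h1⟩ := h1
            rw [elimEntry_super _ _ _ _ h1 (by omega), sub_self, norm_zero]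
          · rw [elimEntry_upper _ _ _ _ hlj (by omega), sub_self, norm_zero]
        · simp [elimEntry_diag, genEntry]
        · rw [genEntry, if_neg hlj.ne', if_neg hlj.not_gt, superEntry]
          have hij : i ≤ j := by rcases hreg with h3 | h3 <;> omega
          by_cases h1 : l = j + 1
          · subst h1
            simp [elimEntry_sub, hij]
          · rw [elimEntry_lower _ _ _ _ (by omega), if_neg (by omega)]
            simp [mul_comm])
  have hZG : G = toMat n Z := by
    have : ‖toMat n Z - G‖ = 0 := le_antisymm (by simpa using hZ') (norm_nonneg _)
    exact (sub_eq_zero.1 (norm_eq_zero.1 this)).symm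
  obtain ⟨⟨X, hX, hXG⟩, hpv⟩ := elim_phase hu hsmall ⟨Z, hZG, hZ⟩ hcs hp
    (fun m h1 h2 N X => hloc m h1 h2 n N X h2) k (by omega)
  rw [hki] at hX hpv
  -- After the elimination every superdiagonal entry is in product form. The new phase therefore
  -- starts with no entry read from `β`, and its region is contained in the one just tracked.
  obtain ⟨⟨Y, hY, hYX⟩, hqv⟩ := back_phase (X₀ := X) (γ := (E i).γ) (p := (E i).p) (R := R)
    hu hu1 hsmall (by
      intro l j hl hj hreg
      rw [hR0]
      rcases lt_trichotomy l j with hlj | rfl | hlj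
      · rw [hX l j (Or.inl hlj.le), elimEntry_upper _ _ _ _ hlj (by omega),
          backEntry_upper _ _ _ _ _ hlj (by omega)]
      · rw [hX l l (Or.inl le_rfl), elimEntry_diag, backEntry_diag]
      · obtain ⟨rfl, hij⟩ : l = j + 1 ∧ i ≤ j := by rcases hreg with h3 | h3 <;> omega
        rw [hX _ _ (Or.inr ⟨hij, Or.inl rfl⟩), elimEntry_sub, backEntry_lower _ _ _ _ _ hlj])
    hcs hR k (by omega)
  rw [hki] at hY hqv
  set U := rotChain n c₀ s₀ k with hUdef
  have hU' : U.conjTranspose ∈ Matrix.unitaryGroup (Fin n) ℂ := Unitary.star_mem hU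
  have hle : ∀ N : ℝ, 0 ≤ N → (k : ℝ) * (n * (400 * u * N)) ≤ 400 * n ^ 2 * u * N := by
    intro N hN
    calc (k : ℝ) * (n * (400 * u * N)) ≤ n * (n * (400 * u * N)) := by gcongr
      _ = _ := by ring
  refine ⟨U, hU, rotChain_mul_trailing _ _ _ (by omega), ?_, ?_, ?_⟩
  · have hX0 : ‖toMat n X‖ ≤ 2 * ‖G‖ := by
      have h2 := norm_le_norm_add_norm_sub' (toMat n X) (U * G)
      rw [frobenius_norm_unitary_mul hU] at h2
      have h3 := steps_mul_le (k := k) (by omega) hu (norm_nonneg G) hsmall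
      linarith
    -- The constant is 400 from the elimination, plus 400 times the factor 2 in `‖toMat n X‖ ≤ 2 *
    -- ‖G‖` from the back rotation.
    have hYG : ‖toMat n Y - U * G * U.conjTranspose‖ ≤ 1200 * n ^ 2 * u * ‖G‖ := by
      refine (norm_sub_le_norm_sub_add_norm_sub _ (toMat n X * U.conjTranspose) _).trans ?_
      rw [← Matrix.sub_mul, frobenius_norm_mul_unitary hU']
      have h1 := hYX.trans (hle _ (norm_nonneg _))
      have h2 := hXG.trans (hle _ (norm_nonneg _))
      have h3 : 400 * n ^ 2 * u * ‖toMat n X‖ ≤ 400 * n ^ 2 * u * (2 * ‖G‖) := by gcongr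
      linarith
    intro l j hlj
    have e : genMatrix n i ⟨(R i).d, (R i).β, (E i).p, (R i).q⟩ l j = toMat n Y l j := by
      rw [genMatrix, toMat_apply, toMat_apply, hY _ _ (Or.inl hlj), genEntry]
      rcases hlj.lt_or_eq with h1 | rfl
      · have h1' : (l : ℕ) < j := h1
        rw [if_neg h1'.ne, if_pos h1', superEntry]
        split_ifs with h2
        · rw [h2.1, backEntry_super _ _ _ _ _ h2.2 h2.2]
        · rw [backEntry_upper _ _ _ _ _ h1' (by omega)]
      · simp [backEntry_diag]
    have := norm_entry_le_frobenius_norm (toMat n Y - U * G * U.conjTranspose) l j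
    rw [Matrix.sub_apply, e, ← Matrix.sub_apply]
    exact this.trans hYG
  · rw [hE0] at hpv
    exact hpv.trans (hle _ (norm_nonneg _))
  · rw [hR0] at hqv
    exact hqv.trans (hle _ (norm_nonneg _))

/-! ## Propagation of the errors through the loops -/

/-- Below the diagonal `G'` is an exact reflection, while $UGU^*$ is a reflection up to
$U(G-G^*)U^*$, which has the norm of $G-G^*$. The skew part of `G'` lives on the diagonal, and there
it is the diagonal of this conjugated skew part plus local errors. Restriction to the diagonal does
not increase the Frobenius norm, so the old skew part enters with constant 1; hence it grows
linearly, not exponentially, over many steps. -/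
theorem norm_sub_unitary_conj_le {n : ℕ} {G G' U : Matrix (Fin n) (Fin n) ℂ} {δ : ℝ}
    (hU : U ∈ Matrix.unitaryGroup (Fin n) ℂ) (hδ : 0 ≤ δ)
    (hG' : ∀ l j : Fin n, l < j → G' j l = conj (G' l j))
    (h : ∀ l j : Fin n, l ≤ j → ‖(G' - U * G * U.conjTranspose) l j‖ ≤ δ) :
    ‖G' - U * G * U.conjTranspose‖ ≤ n * (δ + ‖G - G.conjTranspose‖) ∧
      ‖G' - G'.conjTranspose‖ ≤ ‖G - G.conjTranspose‖ + 2 * n * δ := by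
  have hU' : U.conjTranspose ∈ Matrix.unitaryGroup (Fin n) ℂ := Unitary.star_mem hU
  set K := U * (G - G.conjTranspose) * U.conjTranspose with hK
  have hKn : ‖K‖ = ‖G - G.conjTranspose‖ := by
    rw [hK, frobenius_norm_mul_unitary hU', frobenius_norm_unitary_mul hU]
  have hKe : K = U * G * U.conjTranspose - (U * G * U.conjTranspose).conjTranspose := by
    rw [hK, Matrix.conjTranspose_mul, Matrix.conjTranspose_mul, Matrix.conjTranspose_conjTranspose,
      Matrix.mul_sub, Matrix.sub_mul, Matrix.mul_assoc U G.conjTranspose]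
  set M := U * G * U.conjTranspose with hM
  have hKlj : ∀ l j, K l j = M l j - conj (M j l) := by
    intro l j; rw [hKe]; rfl
  constructor
  · refine frobenius_norm_le_mul (by positivity) fun l j => ?_
    rcases le_or_gt l j with hlj | hlj
    · exact (h l j hlj).trans (le_add_of_nonneg_right (norm_nonneg _))
    · have e : (G' - M) l j = conj ((G' - M) j l) - K l j := by
        rw [Matrix.sub_apply, Matrix.sub_apply, hG' j l hlj, hKlj, map_sub]; ring
      rw [e]
      refine (norm_sub_le _ _).trans ?_
      rw [RCLike.norm_conj, ← hKn]
      exact add_le_add (h j l hlj.le) (norm_entry_le_frobenius_norm K l j)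
  · have e : G' - G'.conjTranspose = (Matrix.diagonal fun l => K l l) +
        Matrix.diagonal fun l => (G' - M) l l - conj ((G' - M) l l) := by
      ext l j
      rw [Matrix.add_apply, Matrix.sub_apply, Matrix.conjTranspose_apply, RCLike.star_def]
      rcases lt_trichotomy l j with hlj | rfl | hlj
      · rw [Matrix.diagonal_apply_ne _ hlj.ne, Matrix.diagonal_apply_ne _ hlj.ne, hG' l j hlj]
        simp
      · rw [Matrix.diagonal_apply_eq, Matrix.diagonal_apply_eq, hKlj, Matrix.sub_apply, map_sub]
        ring
      · rw [Matrix.diagonal_apply_ne _ hlj.ne', Matrix.diagonal_apply_ne _ hlj.ne', hG' j l hlj]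
        simp
    rw [e]
    refine (norm_add_le _ _).trans (add_le_add ?_ ?_)
    · rw [← hKn]
      refine frobenius_norm_le_of_entries fun l j => ?_
      by_cases hlj : l = j
      · subst hlj; simp
      · simp [hlj]
    · have e2 : (2 : ℝ) * n * δ = n * (2 * δ) := by ring
      rw [e2]
      refine frobenius_norm_le_mul (by positivity) fun l j => ?_
      by_cases hlj : l = j
      · subst hlj
        rw [Matrix.diagonal_apply_eq]
        refine (norm_sub_le _ _).trans ?_
        rw [RCLike.norm_conj]
        linarith [h l l le_rfl]
      · rw [Matrix.diagonal_apply_ne _ hlj, norm_zero]; positivity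

/-- The Hermitian part with the accumulated shift `σ` added back to the active diagonal. -/
noncomputable def shiftedMatrix (n i : ℕ) (S : Generators) (σ : ℂ) : Matrix (Fin n) (Fin n) ℂ :=
  genMatrix n i S + σ • trailing n i

theorem shiftedMatrix_apply_ne {n : ℕ} (i : ℕ) (S : Generators) (σ : ℂ) {l j : Fin n}
    (h : l ≠ j) : shiftedMatrix n i S σ l j = genEntry i S l j := by
  have : (l : ℕ) ≠ j := fun h' => h (Fin.ext h')
  simp [shiftedMatrix, genMatrix, trailing, toMat_apply, this]

theorem shiftedMatrix_apply_self {n : ℕ} (i : ℕ) (S : Generators) (σ : ℂ) (l : Fin n) :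
    shiftedMatrix n i S σ l l = S.d l + if i ≤ l then σ else 0 := by
  simp [shiftedMatrix, genMatrix, trailing, toMat_apply, genEntry]

theorem genEntry_conj (i : ℕ) (S : Generators) {l j : ℕ} (h : l < j) :
    genEntry i S j l = conj (genEntry i S l j) := by
  rw [genEntry, if_neg h.ne', if_neg h.not_gt, genEntry, if_neg h.ne, if_pos h]

theorem shiftedMatrix_conj {n : ℕ} (i : ℕ) (S : Generators) (σ : ℂ) (l j : Fin n) (h : l < j) :
    shiftedMatrix n i S σ j l = conj (shiftedMatrix n i S σ l j) := by
  rw [shiftedMatrix_apply_ne _ _ _ h.ne, shiftedMatrix_apply_ne _ _ _ h.ne', genEntry_conj]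
  exact h

theorem norm_smul_trailing_le (n i : ℕ) (σ : ℂ) : ‖σ • trailing n i‖ ≤ n * ‖σ‖ := by
  refine frobenius_norm_le_mul (norm_nonneg _) fun l j => ?_
  rw [Matrix.smul_apply, trailing, toMat_apply, smul_eq_mul]
  split_ifs <;> simp

theorem unitary_conj_shiftedMatrix {n i : ℕ} {U : Matrix (Fin n) (Fin n) ℂ}
    (hU : U ∈ Matrix.unitaryGroup (Fin n) ℂ) (hc : U * trailing n i = trailing n i * U)
    (S : Generators) (σ : ℂ) :
    U * shiftedMatrix n i S σ * U.conjTranspose =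
      U * genMatrix n i S * U.conjTranspose + σ • trailing n i := by
  have hU' : U * U.conjTranspose = 1 := Matrix.mem_unitaryGroup_iff.1 hU
  rw [shiftedMatrix, Matrix.mul_add, Matrix.add_mul, Matrix.mul_smul, hc, Matrix.smul_mul,
    Matrix.mul_assoc (trailing n i), hU', Matrix.mul_one]

/-- The quantities that bound the accumulated errors: `a` is the norm of the Hermitian matrix, `s`
bounds the total shifts, `b` the error of a single step, and `T` the number of steps. -/
structure Budget (n T : ℕ) (a u ε s b : ℝ) : Prop where
  n_pos : (1 : ℝ) ≤ n
  a_nonneg : 0 ≤ a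
  u_nonneg : 0 ≤ u
  ε_nonneg : 0 ≤ ε
  s_nonneg : 0 ≤ s
  small : 1200 * n ^ 2 * u ≤ 1
  small_vec : T * (800 * n ^ 2 * u) ≤ 1
  sweep : 5000 * ((n : ℝ) + 1) ^ 4 * u * (a + s) ≤ b
  deflate : 2 * n * (5 * ε + 4 * (n + 2) * u * (a + s)) ≤ b
  total : T * ((n + 1) * (T + 1) * b) ≤ a + s

theorem Budget.b_nonneg {n T : ℕ} {a u ε s b : ℝ} (B : Budget n T a u ε s b) : 0 ≤ b := by
  have h1 := B.u_nonneg
  have h2 := B.a_nonneg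
  have h3 := B.s_nonneg
  exact le_trans (by positivity) B.sweep

theorem Budget.u_le {n T : ℕ} {a u ε s b : ℝ} (B : Budget n T a u ε s b) : u ≤ 1 / 1000 := by
  have h1 := B.small
  have h2 := B.n_pos
  have h3 := B.u_nonneg
  have : (1 : ℝ) ≤ n ^ 2 := one_le_pow₀ h2
  nlinarith

/-- After `t` steps, the generators `S` with accumulated shift `σ` represent a matrix unitarily
similar to `A + p q^*`, up to `t` times the errors of a single step. -/
structure NearSimilar {n : ℕ} (T : ℕ) (u b : ℝ) (A : Matrix (Fin n) (Fin n) ℂ)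
    (p q : Fin n → ℂ) (t i : ℕ) (S : Generators) (σ : ℂ) (U : Matrix (Fin n) (Fin n) ℂ) :
    Prop where
  unitary : U ∈ Matrix.unitaryGroup (Fin n) ℂ
  near : ‖shiftedMatrix n i S σ - U * A * U.conjTranspose‖ ≤ t * ((n + 1) * (T + 1) * b)
  skew : ‖shiftedMatrix n i S σ - (shiftedMatrix n i S σ).conjTranspose‖ ≤ t * b
  near_p : ‖WithLp.toLp 2 (toVec n S.p - U.mulVec p)‖ ≤
    t * (800 * n ^ 2 * u) * ‖WithLp.toLp 2 p‖
  near_q : ‖WithLp.toLp 2 (toVec n S.q - U.mulVec q)‖ ≤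
    t * (800 * n ^ 2 * u) * ‖WithLp.toLp 2 q‖

/-! ### Error growth under one iteration, one deflation, and the loops. -/

section Steps

variable {n T : ℕ} {u ε s b : ℝ} {A : Matrix (Fin n) (Fin n) ℂ} {p q : Fin n → ℂ}

theorem NearSimilar.norm_shifted_le {t i : ℕ} {S : Generators} {σ : ℂ}
    {U : Matrix (Fin n) (Fin n) ℂ} (h : NearSimilar T u b A p q t i S σ U) :
    ‖shiftedMatrix n i S σ‖ ≤ ‖A‖ + t * ((n + 1) * (T + 1) * b) := by
  have hU' : U.conjTranspose ∈ Matrix.unitaryGroup (Fin n) ℂ := Unitary.star_mem h.unitary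
  have h1 := norm_le_norm_add_norm_sub' (shiftedMatrix n i S σ) (U * A * U.conjTranspose)
  rw [frobenius_norm_mul_unitary hU', frobenius_norm_unitary_mul h.unitary] at h1
  linarith [h.near]

theorem Budget.partial_total {a : ℝ} (B : Budget n T a u ε s b) {t : ℕ} (ht : t ≤ T) :
    t * ((n + 1) * (T + 1) * b) ≤ a + s := by
  refine le_trans ?_ B.total
  have := B.b_nonneg
  gcongr

theorem norm_genMatrix_le {i : ℕ} {S : Generators} {σ : ℂ} :
    ‖genMatrix n i S‖ ≤ ‖shiftedMatrix n i S σ‖ + n * ‖σ‖ := by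
  have h1 : genMatrix n i S = shiftedMatrix n i S σ - σ • trailing n i := by
    rw [shiftedMatrix, add_sub_cancel_right]
  rw [h1]
  exact (norm_sub_le _ _).trans (add_le_add le_rfl (norm_smul_trailing_le n i σ))

theorem NearSimilar.norm_genMatrix_le {t i : ℕ} {S : Generators} {σ : ℂ}
    {U : Matrix (Fin n) (Fin n) ℂ} (h : NearSimilar T u b A p q t i S σ U)
    (B : Budget n T ‖A‖ u ε s b) (ht : t ≤ T) (hσ : ‖σ‖ ≤ s) :
    ‖genMatrix n i S‖ ≤ (n + 2) * (‖A‖ + s) := by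
  have h1 := h.norm_shifted_le
  have h2 := B.partial_total ht
  have h3 : ‖genMatrix n i S‖ ≤ _ := _root_.norm_genMatrix_le (σ := σ)
  have h4 : (n : ℝ) * ‖σ‖ ≤ n * s := by gcongr
  have h5 : 0 ≤ (n : ℝ) * ‖A‖ := by positivity
  have h6 := B.s_nonneg
  linarith

theorem norm_d_le_genMatrix {i : ℕ} {S : Generators} {l : ℕ} (hl : l < n) :
    ‖S.d l‖ ≤ ‖genMatrix n i S‖ := by
  have := norm_entry_le_frobenius_norm (genMatrix n i S) ⟨l, hl⟩ ⟨l, hl⟩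
  rwa [genMatrix, toMat_apply, genEntry, if_pos rfl] at this

theorem norm_upper_le_genMatrix {i : ℕ} {S : Generators} {l j : ℕ} (hlj : l < j) (hj : j < n) :
    ‖superEntry i S l j‖ ≤ ‖genMatrix n i S‖ := by
  have := norm_entry_le_frobenius_norm (genMatrix n i S) ⟨l, by omega⟩ ⟨j, hj⟩
  rwa [genMatrix, toMat_apply, genEntry, if_neg hlj.ne, if_pos hlj] at this

theorem norm_skew_le {n : ℕ} {G G' : Matrix (Fin n) (Fin n) ℂ} :
    ‖G' - G'.conjTranspose‖ ≤ ‖G - G.conjTranspose‖ + 2 * ‖G' - G‖ := by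
  have e : G' - G'.conjTranspose =
      (G - G.conjTranspose) + ((G' - G) - (G' - G).conjTranspose) := by
    rw [Matrix.conjTranspose_sub]; abel
  rw [e]
  refine (norm_add_le _ _).trans ?_
  have := norm_sub_le (G' - G) (G' - G).conjTranspose
  rw [Matrix.frobenius_norm_conjTranspose] at this
  linarith

/-- One shifted QR iteration. -/
theorem NearSimilar.iterate {t i : ℕ} {S S₁ : Generators} {σ σ₁ μ : ℂ} {d₁ : ℕ → ℂ}
    {U : Matrix (Fin n) (Fin n) ℂ} (h : NearSimilar T u b A p q t i S σ U)
    (B : Budget n T ‖A‖ u ε s b) (ht : t + 1 ≤ T) (hin : i + 1 < n) (hσ : ‖σ‖ ≤ s)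
    (hσ₁ : ‖σ₁‖ ≤ s) (hσσ : Rounds u (σ + μ) σ₁) (hd : FlAddDiag u n i S.d (-μ) d₁)
    (hsweep : FlSweep u n i ⟨d₁, S.β, S.p, S.q⟩ S₁) :
    ∃ U₁, NearSimilar T u b A p q (t + 1) i S₁ σ₁ U₁ := by
  have hu := B.u_nonneg
  have hu1 := B.u_le
  have hs := B.s_nonneg
  have hn := B.n_pos
  have hb := B.b_nonneg
  have hA := norm_nonneg A
  set W := ‖A‖ + s with hW
  have hW0 : 0 ≤ W := by positivity
  set G := shiftedMatrix n i S σ with hG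
  set S₂ : Generators := ⟨d₁, S.β, S.p, S.q⟩ with hS₂
  set G₁ := shiftedMatrix n i S₂ σ₁ with hG₁
  set G' := shiftedMatrix n i S₁ σ₁ with hG'
  have hM := h.norm_genMatrix_le B (by omega) hσ
  have he := B.partial_total (t := t) (by omega)
  -- the shift
  have hη : ‖G₁ - G‖ ≤ n * (u * ((n + 7) * W)) := by
    refine frobenius_norm_le_mul (by positivity) fun l j => ?_
    rw [Matrix.sub_apply]
    by_cases hlj : l = j
    · subst hlj
      rw [hG, hG₁, shiftedMatrix_apply_self, shiftedMatrix_apply_self]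
      have hdl := hd l
      by_cases hil : i ≤ l
      · rw [if_pos ⟨hil, l.2⟩] at hdl
        rw [if_pos hil, if_pos hil]
        have h1 := hdl.norm_sub_le
        have h2 := hσσ.norm_sub_le
        have h3 := hσσ.le_norm
        -- Only computed total shifts are bounded by `s`. The size of the individual shift is
        -- recovered from two successive totals.
        have h4 : ‖σ + μ‖ ≤ 2 * s := by nlinarith [norm_nonneg (σ + μ)]
        have h5 : ‖μ‖ ≤ 3 * s := by
          have := norm_sub_le (σ + μ) σ
          rw [add_sub_cancel_left] at this
          linarith
        have h6 : ‖S.d l‖ ≤ (n + 2) * W := (norm_d_le_genMatrix l.2).trans hM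
        have h7 : ‖S.d l + -μ‖ ≤ (n + 2) * W + 3 * s := by
          refine (norm_add_le _ _).trans ?_
          rw [norm_neg]; linarith
        have e : S₂.d l + σ₁ - (S.d l + σ) = (d₁ l - (S.d l + -μ)) + (σ₁ - (σ + μ)) := by
          simp only [hS₂]; ring
        rw [e]
        refine (norm_add_le _ _).trans ?_
        calc ‖d₁ l - (S.d l + -μ)‖ + ‖σ₁ - (σ + μ)‖
            ≤ u * ((n + 2) * W + 3 * s) + u * (2 * s) := by
              gcongr
              · exact h1.trans (by gcongr)
              · exact h2.trans (by gcongr)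
          _ = u * ((n + 2) * W + 5 * s) := by ring
          _ ≤ u * ((n + 7) * W) := by gcongr; linarith
      · rw [if_neg (by tauto)] at hdl
        rw [if_neg hil, if_neg hil]
        have : S₂.d l = S.d l := hdl
        rw [this, sub_self, norm_zero]
        positivity
    · rw [hG, hG₁, shiftedMatrix_apply_ne _ _ _ hlj, shiftedMatrix_apply_ne _ _ _ hlj]
      have hlj' : (l : ℕ) ≠ j := fun h' => hlj (Fin.ext h')
      have : genEntry i S₂ l j = genEntry i S l j := by
        simp only [genEntry, if_neg hlj', superEntry, hS₂]
      rw [this, sub_self, norm_zero]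
      positivity
  set η := u * ((n + 7) * W) with hηdef
  have hη0 : 0 ≤ η := by positivity
  have hηW : n * η ≤ W := by
    have h1 : (n : ℝ) * (n + 7) * u ≤ 1 := by
      refine le_trans ?_ B.small
      have : (n : ℝ) * (n + 7) ≤ 1200 * n ^ 2 := by nlinarith
      gcongr
    calc n * η = (n * (n + 7) * u) * W := by rw [hηdef]; ring
      _ ≤ 1 * W := by gcongr
      _ = W := one_mul W
  have hskew₁ := norm_skew_le (G := G) (G' := G₁)
  have hG₁n : ‖genMatrix n i S₂‖ ≤ (n + 3) * W := by
    have h1 : ‖genMatrix n i S₂‖ ≤ _ := _root_.norm_genMatrix_le (σ := σ₁)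
    have h2 := norm_le_norm_add_norm_sub' G₁ G
    have h3 := h.norm_shifted_le
    have h4 : (n : ℝ) * ‖σ₁‖ ≤ n * s := by gcongr
    have h5 : 0 ≤ (n : ℝ) * ‖A‖ := by positivity
    linarith
  -- the sweep
  obtain ⟨Q, hQ, hQc, hup, hpQ, hqQ⟩ := hsweep.exists_unitary hin hu B.small
  have hQ' : Q.conjTranspose ∈ Matrix.unitaryGroup (Fin n) ℂ := Unitary.star_mem hQ
  set δ := 1200 * n ^ 2 * u * ((n + 3) * W) with hδ
  have hδ0 : 0 ≤ δ := by positivity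
  have hup' : ∀ l j : Fin n, l ≤ j → ‖(G' - Q * G₁ * Q.conjTranspose) l j‖ ≤ δ := by
    intro l j hlj
    -- `Q` commutes with the projection onto the active coordinates, so the accumulated shift
    -- cancels.
    have e : G' - Q * G₁ * Q.conjTranspose =
        genMatrix n i S₁ - Q * genMatrix n i S₂ * Q.conjTranspose := by
      rw [hG₁, unitary_conj_shiftedMatrix hQ hQc, hG', shiftedMatrix]; abel
    rw [e]
    exact (hup l j hlj).trans (mul_le_mul_of_nonneg_left hG₁n (by positivity))
  obtain ⟨hD, hK⟩ := norm_sub_unitary_conj_le hQ hδ0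
    (fun l j hlj => shiftedMatrix_conj i S₁ σ₁ l j hlj) hup'
  -- One iteration raises the skew part by at most `2nη` from the shift and `2nδ` from the sweep;
  -- `b` is chosen to cover both.
  have hbb : 2 * n * (η + δ) ≤ b := by
    refine le_trans ?_ B.sweep
    have h1 : (n : ℝ) + 7 ≤ 4 * (n + 1) := by linarith
    have h2 : (n : ℝ) + 3 ≤ 2 * (n + 1) := by linarith
    have h3 : (n : ℝ) ≤ n + 1 := by linarith
    have h4 : (1 : ℝ) ≤ (n + 1) ^ 2 := one_le_pow₀ (by linarith)
    calc 2 * n * (η + δ) = 2 * n * ((n + 7) + 1200 * n ^ 2 * (n + 3)) * u * W := by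
          rw [hηdef, hδ]; ring
      _ ≤ 2 * (n + 1) * (4 * (n + 1) + 1200 * (n + 1) ^ 2 * (2 * (n + 1))) * u * W := by
          gcongr
      _ = (8 * (n + 1) ^ 2 * 1 + 4800 * (n + 1) ^ 4) * u * W := by ring
      _ ≤ (8 * (n + 1) ^ 2 * (n + 1) ^ 2 + 4992 * (n + 1) ^ 4) * u * W := by
          gcongr
          norm_num
      _ = _ := by ring
  have hsk := h.skew
  have hta : (t : ℝ) * b ≤ T * b := by
    gcongr
    exact_mod_cast (by omega : t ≤ T)
  have hT1 : (t : ℝ) + 1 ≤ T := by exact_mod_cast ht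
  have hnη : 0 ≤ n * η := by positivity
  have hnδ : 0 ≤ n * δ := by positivity
  refine ⟨Q * U, mul_mem hQ h.unitary, ?_, ?_, ?_, ?_⟩
  · have e : Q * U * A * (Q * U).conjTranspose = Q * (U * A * U.conjTranspose) * Q.conjTranspose := by
      simp only [Matrix.conjTranspose_mul, Matrix.mul_assoc]
    have h1 : ‖G' - Q * U * A * (Q * U).conjTranspose‖ ≤
        ‖G' - Q * G₁ * Q.conjTranspose‖ + (‖G₁ - G‖ + ‖G - U * A * U.conjTranspose‖) := by
      refine (norm_sub_le_norm_sub_add_norm_sub _ (Q * G₁ * Q.conjTranspose) _).trans ?_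
      rw [e, ← Matrix.sub_mul, ← Matrix.mul_sub, frobenius_norm_mul_unitary hQ',
        frobenius_norm_unitary_mul hQ]
      gcongr
      exact norm_sub_le_norm_sub_add_norm_sub _ _ _
    refine h1.trans ?_
    have h2 : ‖G₁ - G₁.conjTranspose‖ ≤ T * b + b := by linarith
    -- The skew part, at most `(T + 1) * b`, enters with the factor `n`. With `nη + nδ ≤ (T + 1) *
    -- b` this gives `(n + 1) * (T + 1) * b`, the increment in `NearSimilar.near`.
    have h3 : n * (δ + ‖G₁ - G₁.conjTranspose‖) ≤ n * δ + n * (T * b + b) := by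
      rw [← mul_add]; gcongr
    push_cast
    have h4 := h.near
    have h5 : n * η + n * δ ≤ (T + 1) * b := by
      have : 0 ≤ (T : ℝ) * b := by positivity
      linarith
    linarith
  · push_cast
    linarith
  · have e : toVec n S₁.p - (Q * U).mulVec p =
        (toVec n S₁.p - Q.mulVec (toVec n S₂.p)) + Q.mulVec (toVec n S.p - U.mulVec p) := by
      rw [Matrix.mulVec_sub, Matrix.mulVec_mulVec]; simp only [hS₂]; abel
    rw [e, WithLp.toLp_add]
    refine (norm_add_le _ _).trans ?_
    rw [norm_toLp_unitary_mulVec hQ]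
    have h1 := h.near_p
    have h2 := norm_toVec_le_of_sub h1
    rw [norm_toLp_unitary_mulVec h.unitary] at h2
    have h3 : (t : ℝ) * (800 * n ^ 2 * u) ≤ 1 := by
      refine le_trans ?_ B.small_vec
      gcongr
      omega
    have h4 : ‖WithLp.toLp 2 (toVec n S.p)‖ ≤ 2 * ‖WithLp.toLp 2 p‖ := by
      have := mul_le_mul_of_nonneg_right h3 (norm_nonneg (WithLp.toLp 2 p))
      linarith
    have h5 : 400 * n ^ 2 * u * ‖WithLp.toLp 2 (toVec n S₂.p)‖ ≤
        400 * n ^ 2 * u * (2 * ‖WithLp.toLp 2 p‖) := by gcongr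
    push_cast
    linarith
  · have e : toVec n S₁.q - (Q * U).mulVec q =
        (toVec n S₁.q - Q.mulVec (toVec n S₂.q)) + Q.mulVec (toVec n S.q - U.mulVec q) := by
      rw [Matrix.mulVec_sub, Matrix.mulVec_mulVec]; simp only [hS₂]; abel
    rw [e, WithLp.toLp_add]
    refine (norm_add_le _ _).trans ?_
    rw [norm_toLp_unitary_mulVec hQ]
    have h1 := h.near_q
    have h2 := norm_toVec_le_of_sub h1
    rw [norm_toLp_unitary_mulVec h.unitary] at h2
    have h3 : (t : ℝ) * (800 * n ^ 2 * u) ≤ 1 := by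
      refine le_trans ?_ B.small_vec
      gcongr
      omega
    have h4 : ‖WithLp.toLp 2 (toVec n S.q)‖ ≤ 2 * ‖WithLp.toLp 2 q‖ := by
      have := mul_le_mul_of_nonneg_right h3 (norm_nonneg (WithLp.toLp 2 q))
      linarith
    have h5 : 400 * n ^ 2 * u * ‖WithLp.toLp 2 (toVec n S₂.q)‖ ≤
        400 * n ^ 2 * u * (2 * ‖WithLp.toLp 2 q‖) := by gcongr
    push_cast
    linarith

/-- The exact superdiagonal entry when the stopping test is satisfied. -/
theorem FlSuperAbs.norm_le {i : ℕ} {S : Generators} {r : ℝ} (h : FlSuperAbs u i S r)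
    (hu : 0 ≤ u) (hu1 : u ≤ 1 / 1000) (hr : r ≤ ε) :
    ‖S.β i + S.p i * conj (S.q (i + 1))‖ ≤ 5 * ε + 2 * u * ‖S.β i‖ := by
  obtain ⟨z, ⟨t, ht, hz⟩, habs⟩ := h
  have h1 := habs.le hu (by linarith)
  have h2 := hz.le_norm
  have h3 := ht.norm_sub_le
  have h4 := ht.le_norm
  set v := S.p i * conj (S.q (i + 1))
  have h5 : ‖z‖ ≤ 2 * ε := by
    have : 1 / 2 ≤ (1 - u) ^ 2 := by nlinarith
    nlinarith [mul_le_mul_of_nonneg_right this (norm_nonneg z)]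
  have h6 : ‖S.β i + t‖ ≤ 4 * ε := by nlinarith [norm_nonneg (S.β i + t)]
  -- Since the sum is small, the product is about `-β`. Its rounding error is therefore relative to
  -- `β`, however large `p` and `q` are.
  have h7 : ‖t‖ ≤ ‖S.β i‖ + 4 * ε := by
    have := norm_sub_le (S.β i + t) (S.β i)
    rw [add_sub_cancel_left] at this
    linarith
  have h8 : ‖v‖ ≤ 2 * (‖S.β i‖ + 4 * ε) := by nlinarith [norm_nonneg v]
  have e : S.β i + v = (S.β i + t) - (t - v) := by ring
  rw [e]
  refine (norm_sub_le _ _).trans ?_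
  have h9 := mul_le_mul_of_nonneg_left h8 hu
  have : 0 ≤ ε := by linarith [norm_nonneg z]
  nlinarith

/-- Deflation, and addition of the accumulated shift. -/
theorem NearSimilar.deflate {t i : ℕ} {S : Generators} {σ : ℂ} {d' : ℕ → ℂ} {r : ℝ}
    {U : Matrix (Fin n) (Fin n) ℂ} (h : NearSimilar T u b A p q t i S σ U)
    (B : Budget n T ‖A‖ u ε s b) (ht : t + 1 ≤ T) (hin : i + 1 < n) (hσ : ‖σ‖ ≤ s)
    (hr : FlSuperAbs u i S r) (hrε : r ≤ ε) (hd : FlAddDiag u n i S.d σ d') :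
    NearSimilar T u b A p q (t + 1) (i + 1) ⟨d', S.β, S.p, S.q⟩ 0 U := by
  have hu := B.u_nonneg
  have hu1 := B.u_le
  have hs := B.s_nonneg
  have hn := B.n_pos
  have hb := B.b_nonneg
  have hA := norm_nonneg A
  have hε := B.ε_nonneg
  set W := ‖A‖ + s with hW
  have hW0 : 0 ≤ W := by positivity
  set G := shiftedMatrix n i S σ with hG
  set S' : Generators := ⟨d', S.β, S.p, S.q⟩ with hS'
  set G' := shiftedMatrix n (i + 1) S' 0 with hG'
  have hM := h.norm_genMatrix_le B (by omega) hσ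
  set η := 5 * ε + 4 * (n + 2) * u * W with hη
  have hη0 : 0 ≤ η := by positivity
  have hβ : ‖S.β i‖ ≤ (n + 2) * W := by
    have := norm_upper_le_genMatrix (n := n) (i := i) (S := S) (Nat.lt_succ_self i) hin
    rw [superEntry, if_pos ⟨rfl, le_rfl⟩] at this
    exact this.trans hM
  have hup : ∀ l j : ℕ, l < j → ‖genEntry (i + 1) S' l j - genEntry i S l j‖ ≤ η := by
    intro l j hlj
    rw [genEntry, genEntry, if_neg hlj.ne, if_neg hlj.ne, if_pos hlj, if_pos hlj]
    -- Deflation changes a single entry above the diagonal: $\beta_i$ becomes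
    -- $-p_i\overline{q_{i+1}}$, and the change is exactly the quantity in the stopping test.
    by_cases hli : j = l + 1 ∧ l = i
    · obtain ⟨rfl, rfl⟩ := hli
      rw [superEntry, if_neg (by omega), superEntry, if_pos ⟨rfl, le_rfl⟩, ← neg_add', norm_neg,
        add_comm]
      refine (hr.norm_le hu hu1 hrε).trans ?_
      have h1 := mul_le_mul_of_nonneg_left hβ hu
      have h2 : 0 ≤ u * ((n + 2) * W) := by positivity
      linarith
    · have : superEntry (i + 1) S' l j = superEntry i S l j := by
        rw [superEntry, superEntry]
        by_cases h1 : j = l + 1 ∧ i ≤ l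
        · rw [if_pos h1, if_pos ⟨h1.1, by omega⟩]
        · rw [if_neg h1, if_neg (by omega)]
      rw [this, sub_self, norm_zero]
      exact hη0
  have hdiff : ‖G' - G‖ ≤ n * η := by
    refine frobenius_norm_le_mul hη0 fun l j => ?_
    rw [Matrix.sub_apply]
    rcases lt_trichotomy l j with hlj | rfl | hlj
    · rw [hG, hG', shiftedMatrix_apply_ne _ _ _ hlj.ne, shiftedMatrix_apply_ne _ _ _ hlj.ne]
      exact hup l j hlj
    · rw [hG, hG', shiftedMatrix_apply_self, shiftedMatrix_apply_self, ite_self, add_zero]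
      have hdl := hd l
      by_cases hil : i ≤ l
      · rw [if_pos ⟨hil, l.2⟩] at hdl
        rw [if_pos hil]
        refine hdl.norm_sub_le.trans ?_
        have h1 : ‖S.d l + σ‖ ≤ (n + 2) * W + s :=
          (norm_add_le _ _).trans (add_le_add ((norm_d_le_genMatrix l.2).trans hM) hσ)
        calc u * ‖S.d l + σ‖ ≤ u * ((n + 2) * W + s) := by gcongr
          _ ≤ u * ((n + 2) * W + 3 * ((n + 2) * W)) := by
            gcongr
            nlinarith
          _ = 4 * (n + 2) * u * W := by ring
          _ ≤ η := by rw [hη]; linarith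
      · rw [if_neg (by tauto)] at hdl
        rw [if_neg hil, add_zero]
        have : S'.d l = S.d l := hdl
        rw [this, sub_self, norm_zero]
        exact hη0
    · rw [hG, hG', shiftedMatrix_conj _ _ _ _ _ hlj, shiftedMatrix_conj _ _ _ _ _ hlj, ← map_sub,
        RCLike.norm_conj, shiftedMatrix_apply_ne _ _ _ hlj.ne, shiftedMatrix_apply_ne _ _ _ hlj.ne]
      exact hup j l hlj
  have hbb := B.deflate
  have hnη : 0 ≤ n * η := by positivity
  have hφ : 0 ≤ 800 * (n : ℝ) ^ 2 * u := by positivity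
  refine ⟨h.unitary, ?_, ?_, ?_, ?_⟩
  · refine (norm_sub_le_norm_sub_add_norm_sub _ G _).trans ?_
    have h1 := h.near
    push_cast
    have h2 : b ≤ (n + 1) * (T + 1) * b := by
      have h3 : 0 ≤ (n : ℝ) * b := by positivity
      have h4 : 0 ≤ (T : ℝ) * b := by positivity
      have h5 : 0 ≤ (n : ℝ) * (T * b) := by positivity
      linarith
    linarith
  · refine (norm_skew_le (G := G)).trans ?_
    have h1 := h.skew
    push_cast
    linarith
  · refine h.near_p.trans ?_
    gcongr
    exact Nat.le_succ t
  · refine h.near_q.trans ?_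
    gcongr
    exact Nat.le_succ t

/-- The inner loop. -/
theorem NearSimilar.innerLoop {η : ℝ} {i : ℕ} {S S' : Generators} {σ σ' : ℂ} {L : List ℂ}
    (hloop : FlInnerLoop u ε η n i S σ S' σ' L) (B : Budget n T ‖A‖ u ε s b) (hin : i + 1 < n) :
    ∀ {t : ℕ} {U : Matrix (Fin n) (Fin n) ℂ}, NearSimilar T u b A p q t i S σ U →
      t + L.length ≤ T → ‖σ‖ ≤ s → (∀ z ∈ L, ‖z‖ ≤ s) →
      ‖σ'‖ ≤ s ∧ (∃ r, FlSuperAbs u i S' r ∧ r ≤ ε) ∧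
        ∃ U', NearSimilar T u b A p q (t + L.length) i S' σ' U' := by
  induction hloop with
  | stop_test hr hlt =>
    intro t U h _ hσ _
    exact ⟨hσ, ⟨_, hr, hlt.le⟩, U, h⟩
  | @iterate S S₁ S' σ σ₁ σ' μ r d₁ L hr hge hμ hσσ hd hsweep hrest ih =>
    intro t U h ht hσ hL
    rw [List.length_cons] at ht
    have hσ₁ : ‖σ₁‖ ≤ s := hL _ List.mem_cons_self
    obtain ⟨U₁, h₁⟩ := h.iterate B (by omega) hin hσ hσ₁ hσσ hd hsweep
    have := ih h₁ (by omega) hσ₁ fun z hz => hL z (List.mem_cons_of_mem _ hz)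
    rwa [List.length_cons, ← add_assoc, add_right_comm]

/-- One pass of the outer loop. -/
theorem NearSimilar.outerStep {η : ℝ} {i t : ℕ} {S S' : Generators} {L : List ℂ}
    {U : Matrix (Fin n) (Fin n) ℂ} (h : NearSimilar T u b A p q t i S 0 U)
    (hstep : FlOuterStep u ε η n i S S' L) (B : Budget n T ‖A‖ u ε s b) (hin : i + 1 < n)
    (ht : t + L.length + 1 ≤ T) (hL : ∀ z ∈ L, ‖z‖ ≤ s) :
    ∃ U', NearSimilar T u b A p q (t + L.length + 1) (i + 1) S' 0 U' := by
  obtain ⟨V, σ, d', hloop, hd, rfl⟩ := hstep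
  obtain ⟨hσ, ⟨r, hr, hrε⟩, U', h'⟩ := NearSimilar.innerLoop hloop B hin h (by omega)
    (by simpa using B.s_nonneg) hL
  exact ⟨U', h'.deflate B ht hin hσ hr hrε hd⟩

end Steps

/-! ## Finished entries -/

/-- `S` and `S'` agree in the diagonal, `p` and `q` before the index `i`. -/
def AgreeBefore (i : ℕ) (S S' : Generators) : Prop :=
  ∀ l, l < i → S'.d l = S.d l ∧ S'.p l = S.p l ∧ S'.q l = S.q l

theorem AgreeBefore.trans {i : ℕ} {S S' S'' : Generators} (h : AgreeBefore i S S')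
    (h' : AgreeBefore i S' S'') : AgreeBefore i S S'' := fun l hl =>
  ⟨(h' l hl).1.trans (h l hl).1, (h' l hl).2.1.trans (h l hl).2.1,
    (h' l hl).2.2.trans (h l hl).2.2⟩

theorem ElimStep.eq_of_lt {u : ℝ} {i m l : ℕ} {q : ℕ → ℂ} {E E' : ElimState} {c s : ℂ}
    (h : ElimStep u i q m E E' c s) (hl : l < m) : E'.d l = E.d l ∧ E'.p l = E.p l := by
  have h1 : l ≠ m := by omega
  have h2 : l ≠ m + 1 := by omega
  constructor
  · obtain ⟨x, y, -, -, hd⟩ := h.diag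
    rw [hd]; simp [h1, h2]
  · obtain ⟨x, y, v, w, r, r', -, -, -, -, -, -, ⟨-, z, -, hp⟩ | ⟨-, hp⟩⟩ := h.rank_one <;>
    rw [hp] <;> simp [h1, h2]

theorem BackStep.eq_of_lt {u : ℝ} {m l : ℕ} {γ p : ℕ → ℂ} {R R' : BackState} {c s : ℂ}
    (h : BackStep u γ p c s m R R') (hl : l < m) : R'.d l = R.d l ∧ R'.q l = R.q l := by
  have h1 : l ≠ m := by omega
  have h2 : l ≠ m + 1 := by omega
  constructor
  · obtain ⟨w, x, y, b, -, -, -, -, hd, -⟩ := h.diag_super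
    rw [hd]; simp [h1, h2]
  · obtain ⟨x, y, -, -, hq⟩ := h.rotate_q
    rw [hq]; simp [h1, h2]

/-- All rotations act in planes `(m, m + 1)` with `i ≤ m`. Outputs formed from the last generators
can thus be read off as soon as their index has been deflated. -/
theorem FlSweep.agreeBefore {u : ℝ} {n i : ℕ} {S S' : Generators} (h : FlSweep u n i S S')
    (hin : i + 1 < n) : AgreeBefore i S S' := by
  obtain ⟨E, R, c, s, hE0, hE, hR0, hR, rfl⟩ := h
  intro l hl
  have hEl : ∀ k, i + k + 1 ≤ n → (E (n - 1 - k)).d l = S.d l ∧ (E (n - 1 - k)).p l = S.p l := by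
    intro k
    induction k with
    | zero => intro _; rw [Nat.sub_zero, hE0]; exact ⟨rfl, rfl⟩
    | succ k ih =>
      intro hk
      have h1 := (hE (n - 1 - (k + 1)) (by omega) (by omega)).eq_of_lt (l := l) (by omega)
      rw [show n - 1 - (k + 1) + 1 = n - 1 - k by omega] at h1
      have h2 := ih (by omega)
      exact ⟨h1.1.trans h2.1, h1.2.trans h2.2⟩
  have hRl : ∀ k, i + k + 1 ≤ n →
      (R (n - 1 - k)).d l = (E i).d l ∧ (R (n - 1 - k)).q l = S.q l := by
    intro k
    induction k with
    | zero => intro _; rw [Nat.sub_zero, hR0]; exact ⟨rfl, rfl⟩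
    | succ k ih =>
      intro hk
      have h1 := (hR (n - 1 - (k + 1)) (by omega) (by omega)).eq_of_lt (l := l) (by omega)
      rw [show n - 1 - (k + 1) + 1 = n - 1 - k by omega] at h1
      have h2 := ih (by omega)
      exact ⟨h1.1.trans h2.1, h1.2.trans h2.2⟩
  have h1 := hEl (n - 1 - i) (by omega)
  have h2 := hRl (n - 1 - i) (by omega)
  rw [show n - 1 - (n - 1 - i) = i by omega] at h1 h2
  exact ⟨h2.1.trans h1.1, h1.2, h2.2⟩

theorem FlAddDiag.eq_of_lt {u : ℝ} {n i l : ℕ} {d d' : ℕ → ℂ} {μ : ℂ}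
    (h : FlAddDiag u n i d μ d') (hl : l < i) : d' l = d l := by
  have := h l
  rwa [if_neg (by omega)] at this

theorem FlInnerLoop.agreeBefore {u ε η : ℝ} {n i : ℕ} {S S' : Generators} {σ σ' : ℂ} {L : List ℂ}
    (h : FlInnerLoop u ε η n i S σ S' σ' L) (hin : i + 1 < n) : AgreeBefore i S S' := by
  induction h with
  | stop_test => exact fun l _ => ⟨rfl, rfl, rfl⟩
  | iterate hr hge hμ hσ hd hsweep hrest ih =>
    refine AgreeBefore.trans ?_ ih
    intro l hl
    have := hsweep.agreeBefore hin l hl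
    exact ⟨this.1.trans (hd.eq_of_lt hl), this.2⟩

theorem FlOuterStep.agreeBefore {u ε η : ℝ} {n i : ℕ} {S S' : Generators} {L : List ℂ}
    (h : FlOuterStep u ε η n i S S' L) (hin : i + 1 < n) : AgreeBefore i S S' := by
  obtain ⟨V, σ, d', hloop, hd, rfl⟩ := h
  intro l hl
  have := hloop.agreeBefore hin l hl
  exact ⟨(hd.eq_of_lt hl).trans this.1, this.2⟩

/-! ## Eigenvalues of the final matrix -/

/-- The matrix is block lower triangular, with the first indices as singleton blocks and the
remaining ones in a single block. The linear factors of the singletons divide the characteristic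
polynomial, which gives the multiplicities too. -/
theorem diagonal_le_charpoly_roots {n ℓ : ℕ} (M : Matrix (Fin n) (Fin n) ℂ)
    (h : ∀ l j : Fin n, (l : ℕ) < ℓ → l < j → M l j = 0) :
    (Finset.univ.filter fun j : Fin n => (j : ℕ) < ℓ).val.map (fun j => M j j) ≤
      M.charpoly.roots := by
  classical
  set s := Finset.univ.filter fun j : Fin n => (j : ℕ) < ℓ with hs
  -- `min` merges all indices from `ℓ` on into one block. The order dual is needed because
  -- `Matrix.BlockTriangular` describes upper triangular matrices.
  set b : Fin n → ℕᵒᵈ := fun j => OrderDual.toDual (min (j : ℕ) ℓ) with hb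
  have hM : M.BlockTriangular b := by
    intro i j hij
    have hij : min (i : ℕ) ℓ < min (j : ℕ) ℓ := hij
    exact h i j (by omega) (by change (i : ℕ) < j; omega)
  have hblock : ∀ l ∈ s, (M.toSquareBlock b (b l)).charpoly =
      Polynomial.X - Polynomial.C (M l l) := by
    intro l hl
    have hl : (l : ℕ) < ℓ := by simpa [hs] using hl
    let U : Unique {j // b j = b l} :=
      { default := ⟨l, rfl⟩
        uniq := by
          rintro ⟨j, hj⟩
          have hj : min (j : ℕ) ℓ = min (l : ℕ) ℓ := hj
          exact Subtype.ext (Fin.ext (by change (j : ℕ) = l; omega)) }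
    have hdef : (default : {j // b j = b l}) = ⟨l, rfl⟩ := rfl
    rw [Matrix.charpoly, Matrix.det_unique, hdef, Matrix.charmatrix_apply_eq]
    rfl
  have hinj : Set.InjOn b s := by
    intro l hl j hj hlj
    have hl : (l : ℕ) < ℓ := by simpa [hs] using hl
    have hj : (j : ℕ) < ℓ := by simpa [hs] using hj
    have hlj : min (l : ℕ) ℓ = min (j : ℕ) ℓ := hlj
    exact Fin.ext (by omega)
  have hdvd : ((s.val.map fun j => M j j).map fun a => Polynomial.X - Polynomial.C a).prod ∣
      M.charpoly := by
    rw [Multiset.map_map]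
    change (∏ l ∈ s, (Polynomial.X - Polynomial.C (M l l))) ∣ _
    rw [hM.charpoly, ← Finset.prod_congr rfl hblock,
      ← Finset.prod_image (f := fun a => (M.toSquareBlock b a).charpoly) hinj]
    exact Finset.prod_dvd_prod_of_subset _ _ _ (Finset.image_subset_image (Finset.subset_univ _))
  have := Polynomial.roots.le_of_dvd M.charpoly_monic.ne_zero hdvd
  rwa [Polynomial.roots_multiset_prod_X_sub_C] at this

theorem unitary_conj_add_vecMulVec_charpoly {n : ℕ} {U : Matrix (Fin n) (Fin n) ℂ}
    (hU : U ∈ Matrix.unitaryGroup (Fin n) ℂ) (A : Matrix (Fin n) (Fin n) ℂ) (p q : Fin n → ℂ) :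
    (U.conjTranspose * A * U + Matrix.vecMulVec (U.conjTranspose.mulVec p)
      (star (U.conjTranspose.mulVec q))).charpoly = (A + Matrix.vecMulVec p (star q)).charpoly := by
  have hU' : U * U.conjTranspose = 1 := Matrix.mem_unitaryGroup_iff.1 hU
  have e : U.conjTranspose * A * U + Matrix.vecMulVec (U.conjTranspose.mulVec p)
      (star (U.conjTranspose.mulVec q)) =
      U.conjTranspose * ((A + Matrix.vecMulVec p (star q)) * U) := by
    rw [Matrix.star_mulVec, Matrix.conjTranspose_conjTranspose, ← Matrix.vecMulVec_mul,
      ← Matrix.mul_vecMulVec, Matrix.add_mul, Matrix.mul_add, Matrix.mul_assoc, Matrix.mul_assoc]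
  rw [e, Matrix.charpoly_mul_comm, Matrix.mul_assoc, hU', Matrix.mul_one]

/-! ## The whole algorithm -/

theorem le_foldr_max {l : List ℝ} {x : ℝ} (h : x ∈ l) : x ≤ l.foldr max 0 := by
  induction l with
  | nil => simp at h
  | cons a l ih =>
    rw [List.foldr_cons]
    rcases List.mem_cons.1 h with rfl | h
    · exact le_max_left _ _
    · exact (ih h).trans (le_max_right _ _)

theorem maxShift_nonneg (L : ℕ → List ℂ) (ℓ : ℕ) : 0 ≤ maxShift L ℓ := by
  rw [maxShift]
  induction ((List.range ℓ).flatMap L).map fun z => ‖z‖ with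
  | nil => simp
  | cons a l ih => exact ih.trans (le_max_right _ _)

theorem norm_le_maxShift {L : ℕ → List ℂ} {ℓ k : ℕ} (hk : k < ℓ) {z : ℂ} (hz : z ∈ L k) :
    ‖z‖ ≤ maxShift L ℓ :=
  le_foldr_max (List.mem_map.2 ⟨z, List.mem_flatMap.2 ⟨k, List.mem_range.2 hk, hz⟩, rfl⟩)

theorem sweepCount_succ (L : ℕ → List ℂ) (k : ℕ) :
    sweepCount L (k + 1) = sweepCount L k + (L k).length := by
  simp [sweepCount, List.range_succ]

theorem sweepCount_mono (L : ℕ → List ℂ) : Monotone (sweepCount L) :=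
  monotone_nat_of_le_succ fun k => by rw [sweepCount_succ]; exact Nat.le_add_right _ _

section Whole

variable {n T : ℕ} {u ε s b : ℝ} {A : Matrix (Fin n) (Fin n) ℂ} {p q : Fin n → ℂ}

/-- The Hessenberg condition says $A_{lj}=-p_l\overline{q_j}$ above the superdiagonal, and `A` is
Hermitian. Hence the generators represent `A` without error. -/
theorem nearSimilar_initial (hA : A.IsHermitian)
    (hH : IsLowerHessenberg (A + Matrix.vecMulVec p (star q))) :
    NearSimilar T u b A p q 0 0 (initialGenerators A p q) 0 1 := by
  have hup : ∀ l j : Fin n, l < j → genEntry 0 (initialGenerators A p q) l j = A l j := by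
    intro l j hlj
    have hlj' : (l : ℕ) < j := hlj
    rw [genEntry, if_neg hlj'.ne, if_pos hlj', superEntry]
    by_cases h1 : (j : ℕ) = l + 1
    · rw [if_pos ⟨h1, Nat.zero_le _⟩]
      have h2 : (l : ℕ) + 1 < n := h1 ▸ j.2
      simp only [initialGenerators, dif_pos h2]
      congr 1
      exact Fin.ext h1.symm
    · rw [if_neg (by omega)]
      have := hH l j (by omega)
      rw [Matrix.add_apply, Matrix.vecMulVec_apply, Pi.star_apply, RCLike.star_def] at this
      simp only [initialGenerators, l.2, j.2, dif_pos, Fin.eta]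
      exact (eq_neg_of_add_eq_zero_left this).symm
  have e : shiftedMatrix n 0 (initialGenerators A p q) 0 = A := by
    ext l j
    rcases lt_trichotomy l j with hlj | rfl | hlj
    · rw [shiftedMatrix_apply_ne _ _ _ hlj.ne, hup l j hlj]
    · simp [shiftedMatrix_apply_self, initialGenerators]
    · rw [shiftedMatrix_apply_ne _ _ _ hlj.ne', genEntry_conj _ _ hlj, hup j l hlj]
      exact hA.apply l j
  have ep : toVec n (initialGenerators A p q).p = p := by
    ext l; simp [toVec, initialGenerators]
  have eq : toVec n (initialGenerators A p q).q = q := by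
    ext l; simp [toVec, initialGenerators]
  refine ⟨one_mem _, ?_, ?_, ?_, ?_⟩
  · rw [e]; simp
  · rw [e, hA.eq]; simp
  · rw [ep]; simp
  · rw [eq]; simp

/-- Each pass costs its number of QR iterations plus one step for deflation and the return of the
shift. After `k` passes the step count is therefore `k + sweepCount L k`. -/
theorem nearSimilar_passes {η : ℝ} {S : ℕ → Generators} {L : ℕ → List ℂ} {ℓ : ℕ}
    (hA : A.IsHermitian) (hH : IsLowerHessenberg (A + Matrix.vecMulVec p (star q)))
    (hS0 : S 0 = initialGenerators A p q)
    (hS : ∀ i, i + 1 < n → FlOuterStep u ε η n i (S i) (S (i + 1)) (L i))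
    (B : Budget n T ‖A‖ u ε (maxShift L ℓ) b) (hT : n + sweepCount L ℓ ≤ T) (k : ℕ)
    (hkℓ : k ≤ ℓ) (hkn : k + 1 ≤ n) :
    ∃ U, NearSimilar T u b A p q (k + sweepCount L k) k (S k) 0 U := by
  induction k with
  | zero =>
    rw [hS0]
    exact ⟨1, nearSimilar_initial hA hH⟩
  | succ k ih =>
    obtain ⟨U, hU⟩ := ih (by omega) (by omega)
    have hmono := sweepCount_mono L hkℓ
    have hsucc := sweepCount_succ L k
    have := hU.outerStep (hS k (by omega)) B (by omega) (by omega)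
      fun z hz => norm_le_maxShift (by omega) hz
    rwa [show k + sweepCount L k + (L k).length + 1 = k + 1 + sweepCount L (k + 1) by
      omega] at this

/-- The computed eigenvalues are exact ones of a matrix with nearby generators. -/
theorem NearSimilar.exists_perturbation {t k ℓ : ℕ} {S : Generators}
    {U : Matrix (Fin n) (Fin n) ℂ} (h : NearSimilar T u b A p q t k S 0 U)
    (B : Budget n T ‖A‖ u ε s b) (ht : t ≤ T) (hk : k ≤ ℓ) (hℓ : ℓ ≤ k ∨ n ≤ k + 1)
    {lam : Fin n → ℂ}
    (hlam : ∀ j : Fin n, (j : ℕ) < ℓ → FlEntry u (S.d j) (S.p j) (S.q j) (lam j)) :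
    ∃ (δA : Matrix (Fin n) (Fin n) ℂ) (δp δq : Fin n → ℂ),
      (Finset.univ.filter fun j : Fin n => (j : ℕ) < ℓ).val.map lam ≤
        ((A + δA) + Matrix.vecMulVec (p + δp) (star (q + δq))).charpoly.roots ∧
      ‖δA‖ ≤ n * (3 * u * ((n + 2) * (‖A‖ + s))) + t * ((n + 1) * (T + 1) * b) ∧
      ‖WithLp.toLp 2 δp‖ ≤ (6 * u + t * (800 * n ^ 2 * u)) * ‖WithLp.toLp 2 p‖ ∧
      ‖WithLp.toLp 2 δq‖ ≤ (t * (800 * n ^ 2 * u)) * ‖WithLp.toLp 2 q‖ := by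
  have hu := B.u_nonneg
  have hu1 := B.u_le
  have hM := h.norm_genMatrix_le B ht (by simpa using B.s_nonneg)
  have hMn := h.near
  have hU := h.unitary
  have hUt : U.conjTranspose ∈ Matrix.unitaryGroup (Fin n) ℂ := Unitary.star_mem hU
  have hUU : U.conjTranspose * U = 1 := Matrix.mem_unitaryGroup_iff'.1 hU
  have hM0 : shiftedMatrix n k S 0 = genMatrix n k S := by simp [shiftedMatrix]
  rw [hM0] at hMn
  set M := genMatrix n k S with hMdef
  -- The error of the product and that of the sum are distributed over the two terms: `α` will
  -- perturb the diagonal and `β` the vector `p`.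
  have hlam' : ∀ j : Fin n, ∃ α β : ℂ, ‖α‖ ≤ u ∧ ‖β‖ ≤ 3 * u ∧ ((j : ℕ) < ℓ →
      lam j = S.d j * (1 + α) + S.p j * (1 + β) * conj (S.q j)) := by
    intro j
    by_cases hj : (j : ℕ) < ℓ
    · obtain ⟨w, ⟨δ₁, h1, rfl⟩, δ₂, h2, h3⟩ := hlam j hj
      refine ⟨δ₂, δ₁ + δ₂ + δ₁ * δ₂, h2, ?_, fun _ => by rw [h3]; ring⟩
      refine (norm_add_le _ _).trans ?_
      have h4 := norm_add_le δ₁ δ₂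
      rw [norm_mul]
      have h5 : ‖δ₁‖ * ‖δ₂‖ ≤ u * 1 := by
        gcongr
        linarith
      linarith
    · exact ⟨0, 0, by simpa using hu, by simpa using hu, fun h => absurd h hj⟩
  choose α β hα hβ hlamj using hlam'
  -- Either the row is already deflated (`l < ℓ ≤ k`), or `n ≤ k + 1` and `l < j < n` again force `l
  -- < k`. So `β` is never read.
  have hMup : ∀ l j : Fin n, (l : ℕ) < ℓ → l < j → M l j = -(S.p l * conj (S.q j)) := by
    intro l j hl hlj
    have hlj' : (l : ℕ) < j := hlj
    have hj := j.2
    rw [hMdef, genMatrix, toMat_apply, genEntry, if_neg hlj'.ne, if_pos hlj', superEntry,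
      if_neg (by omega)]
  have hMdiag : ∀ l : Fin n, M l l = S.d l := by
    intro l
    rw [hMdef, genMatrix, toMat_apply, genEntry, if_pos rfl]
  set pS := toVec n S.p with hpS
  set qS := toVec n S.q with hqS
  set p' : Fin n → ℂ := fun l => S.p l * (1 + β l) with hp'
  -- The entries right of the diagonal are changed along with `p'`, so that they still cancel the
  -- rank-one term exactly. The diagonal of the sum is then `lam` in the first `ℓ` rows.
  set A' : Matrix (Fin n) (Fin n) ℂ := Matrix.of fun l j =>
    if (l : ℕ) < ℓ then (if l = j then S.d l * (1 + α l) else if l < j then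
      -(p' l * conj (S.q j)) else M l j) else M l j with hA'
  have hA'M : ‖A' - M‖ ≤ n * (3 * u * ((n + 2) * (‖A‖ + s))) := by
    have hs := B.s_nonneg
    refine frobenius_norm_le_mul (by positivity) fun l j => ?_
    refine le_trans ?_ (mul_le_mul_of_nonneg_left
      ((norm_entry_le_frobenius_norm M l j).trans hM) (by positivity))
    rw [Matrix.sub_apply, hA', Matrix.of_apply]
    split_ifs with h1 h2 h3
    · subst h2
      rw [hMdiag]
      have e : S.d l * (1 + α l) - S.d l = α l * S.d l := by ring
      rw [e, norm_mul]
      gcongr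
      linarith [hα l]
    · rw [hMup l j h1 h3]
      have e : -(p' l * conj (S.q j)) - -(S.p l * conj (S.q j)) =
          β l * -(S.p l * conj (S.q j)) := by rw [hp']; ring
      rw [e, norm_mul]
      gcongr
      exact hβ l
    · rw [sub_self, norm_zero]; positivity
    · rw [sub_self, norm_zero]; positivity
  have hp'S : ‖WithLp.toLp 2 (p' - pS)‖ ≤ 3 * u * ‖WithLp.toLp 2 pS‖ := by
    refine norm_toLp_le_of_entries (by positivity) fun l => ?_
    have e : (p' - pS) l = β l * pS l := by
      rw [Pi.sub_apply, hp', hpS]; simp only [toVec]; ring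
    rw [e, norm_mul]
    gcongr
    exact hβ l
  have hpSn : ‖WithLp.toLp 2 pS‖ ≤ 2 * ‖WithLp.toLp 2 p‖ := by
    have h2 := norm_toVec_le_of_sub h.near_p
    rw [norm_toLp_unitary_mulVec hU] at h2
    have h3 : (t : ℝ) * (800 * n ^ 2 * u) ≤ 1 := by
      refine le_trans ?_ B.small_vec
      gcongr
    have := mul_le_mul_of_nonneg_right h3 (norm_nonneg (WithLp.toLp 2 p))
    linarith
  have hback : ∀ x y : Fin n → ℂ, ‖WithLp.toLp 2 (U.conjTranspose.mulVec x - y)‖ =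
      ‖WithLp.toLp 2 (x - U.mulVec y)‖ := by
    intro x y
    have e : U.conjTranspose.mulVec x - y = U.conjTranspose.mulVec (x - U.mulVec y) := by
      rw [Matrix.mulVec_sub, Matrix.mulVec_mulVec, hUU, Matrix.one_mulVec]
    rw [e, norm_toLp_unitary_mulVec hUt]
  refine ⟨U.conjTranspose * A' * U - A, U.conjTranspose.mulVec p' - p,
    U.conjTranspose.mulVec qS - q, ?_, ?_, ?_, ?_⟩
  · rw [add_sub_cancel, add_sub_cancel, add_sub_cancel, unitary_conj_add_vecMulVec_charpoly hU]
    refine le_trans (le_of_eq ?_) (diagonal_le_charpoly_roots (ℓ := ℓ) _ ?_)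
    · refine Multiset.map_congr rfl fun l hl => ?_
      have hl : (l : ℕ) < ℓ := by simpa using hl
      rw [Matrix.add_apply, Matrix.vecMulVec_apply, hA', Matrix.of_apply, if_pos hl, if_pos rfl,
        hlamj l hl]
      rfl
    · intro l j hl hlj
      rw [Matrix.add_apply, Matrix.vecMulVec_apply, hA', Matrix.of_apply, if_pos hl,
        if_neg hlj.ne, if_pos hlj]
      exact neg_add_cancel _
  · have e : U.conjTranspose * A' * U - A =
        U.conjTranspose * (A' - U * A * U.conjTranspose) * U := by
      rw [Matrix.mul_sub, Matrix.sub_mul]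
      congr 1
      rw [← Matrix.mul_assoc, ← Matrix.mul_assoc, hUU, Matrix.one_mul, Matrix.mul_assoc, hUU,
        Matrix.mul_one]
    rw [e, frobenius_norm_mul_unitary hU, frobenius_norm_unitary_mul hUt]
    exact (norm_sub_le_norm_sub_add_norm_sub _ M _).trans (add_le_add hA'M hMn)
  · rw [hback]
    have e : p' - U.mulVec p = (p' - pS) + (pS - U.mulVec p) := by abel
    rw [e, WithLp.toLp_add, add_mul]
    refine (norm_add_le _ _).trans (add_le_add ?_ h.near_p)
    refine hp'S.trans ?_
    calc 3 * u * ‖WithLp.toLp 2 pS‖ ≤ 3 * u * (2 * ‖WithLp.toLp 2 p‖) := by gcongr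
      _ = _ := by ring
  · rw [hback]
    exact h.near_q

/-- A budget for `T = n + K` steps. -/
theorem budget_of_small {κ K : ℕ} {a x : ℝ} (hn : (1 : ℝ) ≤ n) (ha : 0 ≤ a) (hs : 0 ≤ s)
    (hu : 0 ≤ u) (hε : 0 ≤ ε) (hεle : ε ≤ κ * ((n : ℝ) + 1) ^ κ * a * u)
    (hx : x = (n : ℝ) + K + 1) (hsmall : (6000 + 10 * κ) * x ^ (κ + 7) * u ≤ 1) :
    Budget n (n + K) a u ε s ((5000 + 10 * κ) * x ^ (κ + 4) * u * (a + s)) := by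
  have hK : (0 : ℝ) ≤ K := Nat.cast_nonneg K
  have hκ : (0 : ℝ) ≤ κ := Nat.cast_nonneg κ
  have hx1 : 1 ≤ x := by linarith
  have hnx : (n : ℝ) + 1 ≤ x := by linarith
  have hpow : ∀ {i j : ℕ}, i ≤ j → x ^ i ≤ x ^ j := fun h => pow_le_pow_right₀ hx1 h
  have hW : 0 ≤ a + s := by linarith
  have hx3 : 6000 * x ^ 3 * u ≤ 1 := by
    refine le_trans ?_ hsmall
    gcongr ?_ * ?_ * u
    · linarith
    · exact hpow (by omega)
  have hnx' : (n : ℝ) ≤ x := by linarith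
  -- In `b` the power `κ + 4` dominates both `(n + 1) ^ 4` from the sweep and `x ^ (κ + 1)` from the
  -- tolerance. The factor `T * (n + 1) * (T + 1) ≤ x ^ 3` in the total accounts for `κ + 7` in the
  -- smallness condition.
  refine ⟨hn, ha, hu, hε, hs, ?_, ?_, ?_, ?_, ?_⟩
  · refine le_trans ?_ hx3
    have h1 : (n : ℝ) ^ 2 ≤ x ^ 3 := (pow_le_pow_left₀ (by linarith) hnx' 2).trans
      (hpow (by norm_num))
    gcongr
    norm_num
  · refine le_trans ?_ hx3
    push_cast
    calc ((n : ℝ) + K) * (800 * n ^ 2 * u) ≤ x * (6000 * x ^ 2 * u) := by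
          gcongr
          · linarith
          · norm_num
      _ = _ := by ring
  · gcongr ?_ * ?_ * u * (a + s)
    · linarith
    · exact (pow_le_pow_left₀ (by linarith) hnx 4).trans (hpow (by omega))
  · have h1 : ε ≤ κ * x ^ κ * u * (a + s) := by
      refine hεle.trans ?_
      calc κ * ((n : ℝ) + 1) ^ κ * a * u ≤ κ * x ^ κ * (a + s) * u := by
            gcongr
            linarith
        _ = _ := by ring
    calc 2 * n * (5 * ε + 4 * (n + 2) * u * (a + s))
        ≤ 2 * x * (5 * (κ * x ^ κ * u * (a + s)) + 4 * (2 * x) * u * (a + s)) := by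
          gcongr
          linarith
      _ = (10 * κ * x ^ (κ + 1) + 16 * x ^ 2) * u * (a + s) := by ring
      _ ≤ (10 * κ * x ^ (κ + 4) + 5000 * x ^ (κ + 4)) * u * (a + s) := by
          gcongr (10 * κ * ?_ + ?_ * ?_) * u * (a + s)
          · exact hpow (by omega)
          · norm_num
          · exact hpow (by omega)
      _ = _ := by ring
  · push_cast
    have h1 : (5000 + 10 * κ) * x ^ (κ + 7) * u ≤ 1 := by
      refine le_trans ?_ hsmall
      gcongr
      norm_num
    calc ((n : ℝ) + K) * ((n + 1) * (n + K + 1) * ((5000 + 10 * κ) * x ^ (κ + 4) * u * (a + s)))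
        ≤ x * (x * x * ((5000 + 10 * κ) * x ^ (κ + 4) * u * (a + s))) := by
          gcongr
          · linarith
          · linarith
      _ = ((5000 + 10 * κ) * x ^ (κ + 7) * u) * (a + s) := by ring
      _ ≤ 1 * (a + s) := by gcongr
      _ = a + s := one_mul _

end Whole

theorem theorem4p4 (κ : ℕ) :
    ∃ C : ℕ, ∀ (n : ℕ) (A : Matrix (Fin n) (Fin n) ℂ) (p q : Fin n → ℂ),
      A.IsHermitian → IsLowerHessenberg (A + Matrix.vecMulVec p (star q)) →
      ∀ (u ε η : ℝ), 0 < u → 0 < ε → ε ≤ κ * ((n : ℝ) + 1) ^ κ * ‖A‖ * u →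
      ∀ (lam : Fin n → ℂ) (L : ℕ → List ℂ), FlShiftedQR u ε η A p q lam L →
      ∀ ℓ : ℕ, 1 ≤ ℓ → ℓ ≤ n →
        C * ((n : ℝ) + sweepCount L ℓ + 1) ^ C * u ≤ 1 →
        ∃ (δA : Matrix (Fin n) (Fin n) ℂ) (δp δq : Fin n → ℂ),
          (Finset.univ.filter fun j : Fin n => (j : ℕ) < ℓ).val.map lam ≤
            ((A + δA) + Matrix.vecMulVec (p + δp) (star (q + δq))).charpoly.roots ∧
          ‖δA‖ ≤ C * ((n : ℝ) + sweepCount L ℓ + 1) ^ C * (‖A‖ + maxShift L ℓ) * u ∧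
          ‖WithLp.toLp 2 δp‖ ≤
            C * ((n : ℝ) + sweepCount L ℓ + 1) ^ C * ‖WithLp.toLp 2 p‖ * u ∧
          ‖WithLp.toLp 2 δq‖ ≤
            C * ((n : ℝ) + sweepCount L ℓ + 1) ^ C * ‖WithLp.toLp 2 q‖ * u := by
  -- One number serves as factor and exponent. The factor is the one in `budget_of_small`, and as an
  -- exponent it is far above the required `κ + 7`.
  refine ⟨6000 + 10 * κ, ?_⟩
  rintro n A p q hA hH u ε η hu hε hεle lam L ⟨S, hS0, hS, -, hlam⟩ ℓ hℓ1 hℓn hsmall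
  have hn : (1 : ℝ) ≤ n := by exact_mod_cast hℓ1.trans hℓn
  obtain ⟨x, hx⟩ : ∃ x : ℝ, x = (n : ℝ) + sweepCount L ℓ + 1 := ⟨_, rfl⟩
  rw [← hx] at hsmall ⊢
  have hK : (0 : ℝ) ≤ sweepCount L ℓ := Nat.cast_nonneg _
  have hκ : (0 : ℝ) ≤ κ := Nat.cast_nonneg κ
  have hx1 : 1 ≤ x := by linarith
  have hnx : (n : ℝ) + 1 ≤ x := by linarith
  have hpow : ∀ {i j : ℕ}, i ≤ j → x ^ i ≤ x ^ j := fun h => pow_le_pow_right₀ hx1 h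
  have hs := maxShift_nonneg L ℓ
  have hsmall' : (6000 + 10 * κ) * x ^ (κ + 7) * u ≤ 1 := by
    refine le_trans ?_ hsmall
    push_cast
    gcongr ?_ * ?_ * u
    exact hpow (by omega)
  have B := budget_of_small hn (norm_nonneg A) hs hu.le hε.le hεle hx hsmall'
  set T := n + sweepCount L ℓ with hT
  set b := (5000 + 10 * κ) * x ^ (κ + 4) * u * (‖A‖ + maxShift L ℓ) with hb
  -- There are only `n - 1` passes. For `ℓ = n` the last row needs no deflation, as nothing lies to
  -- the right of its diagonal entry.
  obtain ⟨k, hk⟩ : ∃ k, k = min ℓ (n - 1) := ⟨_, rfl⟩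
  obtain ⟨U, hU⟩ := nearSimilar_passes hA hH hS0 hS B le_rfl k (by omega) (by omega)
  have hmono := sweepCount_mono L (show k ≤ ℓ by omega)
  have htT : k + sweepCount L k ≤ T := by omega
  have hagree : ∀ m, k + m + 1 ≤ n → AgreeBefore k (S k) (S (k + m)) := by
    intro m
    induction m with
    | zero => exact fun _ l _ => ⟨rfl, rfl, rfl⟩
    | succ m ih =>
      intro hm
      refine (ih (by omega)).trans fun l hl => ?_
      exact (hS (k + m) (by omega)).agreeBefore (by omega) l (by omega)
  -- The outputs are formed after the last pass, but for indices before `k` the generators no longer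
  -- change after pass `k`, so `S k` suffices. This keeps later iterations and shifts out of the
  -- bound.
  have hlam' : ∀ j : Fin n, (j : ℕ) < ℓ →
      FlEntry u ((S k).d j) ((S k).p j) ((S k).q j) (lam j) := by
    intro j hj
    have h1 := hlam j
    by_cases hkn : k = n - 1
    · rwa [hkn]
    · have h2 := hagree (n - 1 - k) (by omega) j (by omega)
      rw [show k + (n - 1 - k) = n - 1 by omega] at h2
      rwa [h2.1, h2.2.1, h2.2.2] at h1
  obtain ⟨δA, δp, δq, hroots, hδA, hδp, hδq⟩ := hU.exists_perturbation B htT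
    (ℓ := ℓ) (by omega) (by omega) hlam'
  set t := k + sweepCount L k with ht
  have htx : (t : ℝ) ≤ x := by
    have : (t : ℝ) ≤ T := by exact_mod_cast htT
    rw [hT] at this
    push_cast at this
    linarith
  have hTx : (T : ℝ) + 1 = x := by rw [hT, hx]; push_cast; ring
  have hvec : 6 * u + t * (800 * n ^ 2 * u) ≤
      ((6000 + 10 * κ : ℕ) : ℝ) * x ^ (6000 + 10 * κ) * u := by
    have hnx' : (n : ℝ) ≤ x := by linarith
    push_cast
    calc 6 * u + t * (800 * n ^ 2 * u) ≤ 6 * u + x * (800 * x ^ 2 * u) := by gcongr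
      _ = 6 * 1 * u + 800 * x ^ 3 * u := by ring
      _ ≤ 6 * x ^ (6000 + 10 * κ) * u + 800 * x ^ (6000 + 10 * κ) * u := by
        gcongr 6 * ?_ * u + 800 * ?_ * u
        · exact one_le_pow₀ hx1
        · exact hpow (by omega)
      _ = 806 * x ^ (6000 + 10 * κ) * u := by ring
      _ ≤ (6000 + 10 * κ) * x ^ (6000 + 10 * κ) * u := by
        gcongr
        linarith
  refine ⟨δA, δp, δq, hroots, ?_, ?_, ?_⟩
  · refine hδA.trans ?_
    set W := ‖A‖ + maxShift L ℓ with hW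
    have hW0 : 0 ≤ W := by positivity
    rw [hTx, hb]
    push_cast
    calc n * (3 * u * ((n + 2) * W)) +
          t * ((n + 1) * x * ((5000 + 10 * κ) * x ^ (κ + 4) * u * W))
        ≤ x * (3 * u * ((2 * x) * W)) + x * (x * x * ((5000 + 10 * κ) * x ^ (κ + 4) * u * W)) := by
          gcongr
          · linarith
          · linarith
      _ = (6 * x ^ 2 + (5000 + 10 * κ) * x ^ (κ + 7)) * W * u := by ring
      _ ≤ (6 * x ^ (6000 + 10 * κ) + (5000 + 10 * κ) * x ^ (6000 + 10 * κ)) * W * u := by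
          gcongr (6 * ?_ + (5000 + 10 * κ) * ?_) * W * u
          · exact hpow (by omega)
          · exact hpow (by omega)
      _ = (5006 + 10 * κ) * x ^ (6000 + 10 * κ) * W * u := by ring
      _ ≤ _ := by
        gcongr
        norm_num
  · exact hδp.trans ((mul_le_mul_of_nonneg_right hvec (norm_nonneg _)).trans
      (mul_right_comm _ _ _).le)
  · have : t * (800 * n ^ 2 * u) ≤ 6 * u + t * (800 * n ^ 2 * u) := by linarith
    exact hδq.trans ((mul_le_mul_of_nonneg_right (this.trans hvec) (norm_nonneg _)).trans
      (mul_right_comm _ _ _).le)
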